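/- Let $K$ be a field of characteristic zero and let $J=J_{\bar 0}\oplus J_{\bar 1}$ be a unital Jordan superalgebra over $K$ with unit $e$. For $a\in J$ let $L_a$ be the left multiplication by $a$, and let $P(x,y)=x\cdot y$. Let $\mathfrak g=Lie(J)=\mathfrak g[-1]\oplus\mathfrak g[0]\oplus\mathfrak g[1]$ be the Tits--Kantor--Koecher Lie superalgebra: $\mathfrak g[1]=J$, $\mathfrak g[0]=\langle L_a,[L_a,L_b]\mid a,b\in J\rangle\subset \operatorname{End}(J)$, $\mathfrak g[-1]=\langle P,[L_a,P]\mid a\in J\rangle\subset\operatorname{Hom}(J\otimes J,J)$, where $\mathfrak g[1]$ and $\mathfrak g[-1]$ are abelian, $[L,M]$ is the supercommutator, $[L,x]=L(x)$, $[B,x]=B(x,\cdot)$ and $[L,B](x,y)=L(B(x,y))-(-1)^{|L||B|}\bigl(B(Lx,y)+(-1)^{|x||y|}B(Ly,x)\bigr)$ for $x,y\in\mathfrak g[1]$, $L,M\in\mathfrak g[0]$, $B\in\mathfrak g[-1]$. Put $h=L_e$ and $f=-P$, so that $[e,f]=h$, $[h,e]=e$, $[h,f]=-f$. Then $\mathfrak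 g$ has a universal central extension $\pi:\hat{\mathfrak g}\to\mathfrak g$. For any such extension, lift $e,h,f$ to the unique elements $\hat e,\hat h,\hat f\in\hat{\mathfrak g}$ satisfying the same relations, and lift $a\in J=\mathfrak g[1]$ to the element $\hat a$ of $\hat{\mathfrak g}$ with $\pi(\hat a)=a$ and $[\hat h,\hat a]=\hat a$. Let $J\text{-mod}_{1/2}$ be the category of special $J$-modules: finite-dimensional superspaces $M$ with an action $a\otimes m\mapsto a\circ m$ of $J$ such that the null split extension $J\oplus M$ (with $a\cdot m=a\circ m$, $m\cdot a=(-1)^{|a||m|}a\circ m$, $M\cdot M=0$) is a Jordan superalgebra and $e$ acts as $\frac12\operatorname{id}$. Let $\hat{\mathfrak g}\text{-mod}_{1/2}$ be the category of finite-dimensional $\hat{\mathfrak g}$-modules $V$ with a very short grading, i.e. $V=V[-\tfrac12]\oplus V[\tfrac12]$, where $V[\pm\frac12]$ is the eigenspace of $\hat h$ with eigenvalue $\pm\frac12$. Morphisms in both categories are the even linear maps that commute with the actions. Let $Jor:\hat{\mathfrak g}\text{-mod}_{1/2}\to J\text{-mod}_{1/2}$ be the functor $Jor(V)=V[\frac12]$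 with $a\circ v=[\hat a,\hat f]v$. There is a functor $Lie:J\text{-mod}_{1/2}\to\hat{\mathfrak g}\text{-mod}_{1/2}$, unique up to natural isomorphism, with $Lie(M)=M\oplus M$ as a superspace, naturally in $M$, such that for all $a,b\in J$ $$\hat a(m_1,m_2)=(0,a\circ m_1),\qquad \bigl(-\tfrac12[\hat f,[\hat f,\hat b]]\bigr)(m_1,m_2)=(b\circ m_2,0).$$ The functors $Lie$ and $Jor$ are mutually inverse equivalences of the categories $J\text{-mod}_{1/2}$ and $\hat{\mathfrak g}\text{-mod}_{1/2}$. -/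

import Mathlib

set_option linter.unusedSectionVars false
set_option linter.unusedSimpArgs false
set_option linter.unusedVariables false
open CategoryTheory

universe u v w

namespace Super

/-! ### Superspaces -/

/-- A superspace over `K`: a vector space with a decomposition `V = V₀ ⊕ V₁` indexed by `ZMod 2`. -/
class SuperSpace (K : Type v) (V : Type u) [Field K] [AddCommGroup V] [Module K V] where
  gr : ZMod 2 → Submodule K V
  isCompl : IsCompl (gr 0) (gr 1)

section Basics

variable (K : Type v) [Field K]

/-- The homogeneous component `V_i` of a superspace. -/
def gr {V : Type u} [AddCommGroup V] [Module K V] [SuperSpace K V] (i : ZMod 2) : Submodule K V :=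
  SuperSpace.gr i

/-- The sign `(-1)^{ij}`. -/
def sgn (i j : ZMod 2) : K := if i = 1 ∧ j = 1 then -1 else 1

theorem sgn_zero_left (j : ZMod 2) : sgn K 0 j = 1 := by simp [sgn]
theorem sgn_zero_right (j : ZMod 2) : sgn K j 0 = 1 := by simp [sgn]
theorem sgn_one_one : sgn K 1 1 = -1 := by simp [sgn]
theorem zmod2_one_add_one : (1 : ZMod 2) + 1 = 0 := by decide

theorem zmod2_cases (i : ZMod 2) : i = 0 ∨ i = 1 := by
  revert i; decide

section
variable {V : Type u} [AddCommGroup V] [Module K V] [SuperSpace K V]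

/-- The projection of a superspace onto its odd part along its even part. -/
noncomputable def oddProj : V →ₗ[K] V :=
  Submodule.projection (gr K 1) (gr K 0) (SuperSpace.isCompl (K := K) (V := V)).symm

theorem oddProj_mem (x : V) : oddProj K x ∈ gr K (V := V) 1 :=
  Submodule.projection_apply_mem _ _

theorem sub_oddProj_mem (x : V) : x - oddProj K x ∈ gr K (V := V) 0 := by
  have h := Submodule.projection_add_projection_eq_self
    (SuperSpace.isCompl (K := K) (V := V)).symm x
  have h2 : x - oddProj K x = Submodule.projection (gr K 0) (gr K 1)
      (SuperSpace.isCompl (K := K) (V := V)) x := by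
    rw [sub_eq_iff_eq_add, add_comm]; exact h.symm
  rw [h2]
  exact Submodule.projection_apply_mem _ _

theorem oddProj_of_odd {x : V} (hx : x ∈ gr K (V := V) 1) : oddProj K x = x :=
  Submodule.projection_apply_of_mem_left _ hx

theorem oddProj_of_even {x : V} (hx : x ∈ gr K (V := V) 0) : oddProj K x = 0 :=
  (Submodule.projection_apply_eq_zero_iff _).2 hx

theorem exists_homog (x : V) :
    ∃ y ∈ gr K (V := V) 0, ∃ z ∈ gr K (V := V) 1, x = y + z :=
  ⟨_, sub_oddProj_mem K x, _, oddProj_mem K x, by abel⟩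

theorem eq_zero_of_even_odd {x : V} (h0 : x ∈ gr K (V := V) 0) (h1 : x ∈ gr K (V := V) 1) :
    x = 0 := by
  rw [← oddProj_of_odd K h1, oddProj_of_even K h0]

/-- To prove an additive property of all vectors, it suffices to treat homogeneous ones. -/
theorem homog_induction {p : V → Prop} (hadd : ∀ x y, p x → p y → p (x + y))
    (h : ∀ i, ∀ x ∈ gr K (V := V) i, p x) (x : V) : p x := by
  obtain ⟨y, hy, z, hz, rfl⟩ := exists_homog K x
  exact hadd _ _ (h 0 y hy) (h 1 z hz)

/-- Two linear maps that agree on homogeneous vectors are equal. -/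
theorem ext_homog {W : Type w} [AddCommGroup W] [Module K W] {f g : V →ₗ[K] W}
    (h : ∀ i, ∀ x ∈ gr K (V := V) i, f x = g x) : f = g := by
  ext x
  refine homog_induction K (p := fun x => f x = g x) ?_ h x
  intro x y hx hy
  simp [hx, hy]

/-- A linear subspace stable under the odd projection is a superspace with the induced grading. -/
@[reducible] def SuperSpace.ofSubmodule (S : Submodule K V) (hS : ∀ x ∈ S, oddProj K x ∈ S) :
    SuperSpace K S where
  gr i := (Super.gr K i).comap S.subtype
  isCompl := by
    refine IsCompl.of_le ?_ ?_
    · rintro x ⟨h0, h1⟩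
      have := eq_zero_of_even_odd K (x := (x : V)) h0 h1
      simpa using this
    · rintro x -
      refine Submodule.mem_sup.2 ⟨x - ⟨oddProj K x, hS x x.2⟩, ?_, ⟨oddProj K x, hS x x.2⟩, ?_, ?_⟩
      · exact sub_oddProj_mem K (x : V)
      · exact oddProj_mem K (x : V)
      · simp

end

variable {V W U : Type*} [AddCommGroup V] [Module K V] [SuperSpace K V]
  [AddCommGroup W] [Module K W] [SuperSpace K W] [AddCommGroup U] [Module K U] [SuperSpace K U]

/-- The direct sum of two superspaces. -/
instance : SuperSpace K (V × W) where
  gr i := (gr K i).prod (gr K i)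
  isCompl := by
    refine IsCompl.of_le ?_ ?_
    · rintro ⟨x, y⟩ ⟨h0, h1⟩
      have hx := eq_zero_of_even_odd K h0.1 h1.1
      have hy := eq_zero_of_even_odd K h0.2 h1.2
      simp only at hx hy
      simp [hx, hy]
    · rintro ⟨x, y⟩ -
      refine Submodule.mem_sup.2 ⟨(x - oddProj K x, y - oddProj K y), ?_,
        (oddProj K x, oddProj K y), ?_, ?_⟩
      · exact ⟨sub_oddProj_mem K x, sub_oddProj_mem K y⟩
      · exact ⟨oddProj_mem K x, oddProj_mem K y⟩
      · simp

/-- The superspace of linear maps: `f` has degree `i` if it maps `V_j` to `W_{i+j}` for all `j`. -/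
instance : SuperSpace K (V →ₗ[K] W) where
  gr i :=
    { carrier := {f | ∀ j, ∀ x ∈ gr K (V := V) j, f x ∈ gr K (V := W) (i + j)}
      add_mem' := fun hf hg j x hx => add_mem (hf j x hx) (hg j x hx)
      zero_mem' := fun j x _ => zero_mem _
      smul_mem' := fun c f hf j x hx => Submodule.smul_mem _ c (hf j x hx) }
  isCompl := by
    refine IsCompl.of_le ?_ ?_
    · rintro f ⟨h0, h1⟩
      rw [Submodule.mem_bot]
      refine ext_homog K fun j x hx => ?_
      have a0 := h0 j x hx
      have a1 := h1 j x hx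
      rcases zmod2_cases j with rfl | rfl
      · exact eq_zero_of_even_odd K (by simpa using a0) (by simpa using a1)
      · exact eq_zero_of_even_odd K (by simpa [zmod2_one_add_one] using a1) (by simpa using a0)
    · rintro f -
      refine Submodule.mem_sup.2
        ⟨oddProj K ∘ₗ f ∘ₗ oddProj K +
            (LinearMap.id - oddProj K) ∘ₗ f ∘ₗ (LinearMap.id - oddProj K), ?_,
          (LinearMap.id - oddProj K) ∘ₗ f ∘ₗ oddProj K +
            oddProj K ∘ₗ f ∘ₗ (LinearMap.id - oddProj K), ?_, ?_⟩
      · intro j x hx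
        rcases zmod2_cases j with rfl | rfl
        · simpa [oddProj_of_even K hx] using sub_oddProj_mem K (f x)
        · simpa [oddProj_of_odd K hx] using oddProj_mem K (f x)
      · intro j x hx
        rcases zmod2_cases j with rfl | rfl
        · simpa [oddProj_of_even K hx] using oddProj_mem K (f x)
        · simpa [oddProj_of_odd K hx, zmod2_one_add_one] using sub_oddProj_mem K (f x)
      · ext x
        simp
        abel

theorem apply_mem {f : V →ₗ[K] W} {x : V} {i j : ZMod 2} (hf : f ∈ gr K (V := V →ₗ[K] W) i)
    (hx : x ∈ gr K (V := V) j) : f x ∈ gr K (V := W) (i + j) := hf j x hx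

theorem mem_gr_prod {x : V × W} {i : ZMod 2} :
    x ∈ gr K (V := V × W) i ↔ x.1 ∈ gr K (V := V) i ∧ x.2 ∈ gr K (V := W) i := Iff.rfl

theorem mem_gr_hom {f : V →ₗ[K] W} {i : ZMod 2} :
    f ∈ gr K (V := V →ₗ[K] W) i ↔ ∀ j, ∀ x ∈ gr K (V := V) j, f x ∈ gr K (V := W) (i + j) :=
  Iff.rfl

end Basics

section Sflip

variable {K : Type v} [Field K] {V W U : Type*} [AddCommGroup V] [Module K V] [SuperSpace K V]
  [AddCommGroup W] [Module K W] [SuperSpace K W] [AddCommGroup U] [Module K U]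

/-- The flip of a bilinear map with the sign rule: `sflip B w v = (-1)^{|v||w|} B v w` for
homogeneous `v`, `w` (see `sflip_apply`). -/
noncomputable def sflip (B : V →ₗ[K] W →ₗ[K] U) : W →ₗ[K] V →ₗ[K] U :=
  B.flip - (2 : K) • B.flip.compl₁₂ (oddProj K) (oddProj K)

theorem sflip_apply (B : V →ₗ[K] W →ₗ[K] U) {v : V} {w : W} {i j : ZMod 2}
    (hv : v ∈ gr K (V := V) i) (hw : w ∈ gr K (V := W) j) :
    sflip B w v = sgn K i j • B v w := by
  rcases zmod2_cases i with rfl | rfl <;> rcases zmod2_cases j with rfl | rfl <;>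
    simp [sflip, sgn, oddProj_of_even, oddProj_of_odd, hv, hw]
  rw [two_smul]; abel

end Sflip

/-! ### Jordan superalgebras and Lie superalgebras -/

section Algebras

/-- The identities of a Jordan superalgebra, for a product `m` on a superspace: the product is even,
supercommutative, and satisfies the (linearized) super Jordan identity. -/
structure IsJordanProduct {K : Type v} [Field K] {A : Type u} [AddCommGroup A] [Module K A]
    [SuperSpace K A] (m : A →ₗ[K] A →ₗ[K] A) : Prop where
  mul_mem : ∀ {i j : ZMod 2} {a b : A}, a ∈ gr K (V := A) i → b ∈ gr K (V := A) j →
    m a b ∈ gr K (V := A) (i + j)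
  comm : ∀ {i j : ZMod 2} {a b : A}, a ∈ gr K (V := A) i → b ∈ gr K (V := A) j →
    m a b = sgn K i j • m b a
  jordan : ∀ {i j k l : ZMod 2} {a b c d : A}, a ∈ gr K (V := A) i → b ∈ gr K (V := A) j →
    c ∈ gr K (V := A) k → d ∈ gr K (V := A) l →
    m (m (m a b) c) d
      + (sgn K j k * sgn K j l * sgn K k l) • m (m (m a d) c) b
      + (sgn K i j * sgn K i k * sgn K i l * sgn K k l) • m (m (m b d) c) a
    = m (m a b) (m c d) + sgn K j k • m (m a c) (m b d)
      + (sgn K l j * sgn K l k) • m (m a d) (m b c)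

/-- A unital Jordan superalgebra. -/
class UnitalJordanSuperalgebra (K : Type v) (J : Type u) [Field K] [AddCommGroup J] [Module K J]
    [SuperSpace K J] where
  mul : J →ₗ[K] J →ₗ[K] J
  isJordan : IsJordanProduct mul
  one : J
  one_mem : one ∈ gr K (V := J) 0
  one_mul : ∀ a, mul one a = a

/-- A Lie superalgebra. -/
class LieSuperalgebra (K : Type v) (L : Type u) [Field K] [AddCommGroup L] [Module K L]
    [SuperSpace K L] where
  bracket : L →ₗ[K] L →ₗ[K] L
  bracket_mem : ∀ {i j : ZMod 2} {x y : L}, x ∈ gr K (V := L) i → y ∈ gr K (V := L) j →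
    bracket x y ∈ gr K (V := L) (i + j)
  skew : ∀ {i j : ZMod 2} {x y : L}, x ∈ gr K (V := L) i → y ∈ gr K (V := L) j →
    bracket x y = -(sgn K i j • bracket y x)
  jacobi : ∀ {i j k : ZMod 2} {x y z : L}, x ∈ gr K (V := L) i → y ∈ gr K (V := L) j →
    z ∈ gr K (V := L) k →
    bracket x (bracket y z) = bracket (bracket x y) z + sgn K i j • bracket y (bracket x z)

variable (K : Type v) [Field K]

/-- The product of a Jordan superalgebra; `jmul K a` is the operator `L_a` of left
multiplication. -/
def jmul {J : Type u} [AddCommGroup J] [Module K J] [SuperSpace K J]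
    [UnitalJordanSuperalgebra K J] : J →ₗ[K] J →ₗ[K] J :=
  UnitalJordanSuperalgebra.mul

/-- The unit element of a unital Jordan superalgebra. -/
def jone (J : Type u) [AddCommGroup J] [Module K J] [SuperSpace K J]
    [UnitalJordanSuperalgebra K J] : J :=
  UnitalJordanSuperalgebra.one (K := K)

/-- The bracket of a Lie superalgebra. -/
def sbr {L : Type u} [AddCommGroup L] [Module K L] [SuperSpace K L]
    [LieSuperalgebra K L] : L →ₗ[K] L →ₗ[K] L :=
  LieSuperalgebra.bracket

end Algebras

/-! ### Jordan identities in operator form -/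

section JordanLemmas

variable {K : Type v} [Field K] {J : Type u} [AddCommGroup J] [Module K J] [SuperSpace K J]
  [UnitalJordanSuperalgebra K J]

theorem jmul_mem {i j : ZMod 2} {a b : J} (ha : a ∈ gr K (V := J) i) (hb : b ∈ gr K (V := J) j) :
    jmul K a b ∈ gr K (V := J) (i + j) :=
  (UnitalJordanSuperalgebra.isJordan (K := K) (J := J)).mul_mem ha hb

theorem jmul_comm {i j : ZMod 2} {a b : J} (ha : a ∈ gr K (V := J) i)
    (hb : b ∈ gr K (V := J) j) : jmul K a b = sgn K i j • jmul K b a :=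
  (UnitalJordanSuperalgebra.isJordan (K := K) (J := J)).comm ha hb

theorem jmul_hom_mem {i : ZMod 2} {a : J} (ha : a ∈ gr K (V := J) i) :
    jmul K a ∈ gr K (V := J →ₗ[K] J) i := fun _ _ hb => jmul_mem ha hb

/-- The super Jordan identity with all products written as left multiplications. -/
theorem jordan_left {i j k l : ZMod 2} {a b c d : J} (ha : a ∈ gr K (V := J) i)
    (hb : b ∈ gr K (V := J) j) (hc : c ∈ gr K (V := J) k) (hd : d ∈ gr K (V := J) l) :
    jmul K (jmul K (jmul K a b) c) d
      + (sgn K j k * sgn K j l * sgn K k l) • jmul K (jmul K (jmul K a d) c) b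
      + (sgn K i j * sgn K i k * sgn K i l * sgn K k l) • jmul K (jmul K (jmul K b d) c) a
    = jmul K (jmul K a b) (jmul K c d) + sgn K j k • jmul K (jmul K a c) (jmul K b d)
      + (sgn K l j * sgn K l k) • jmul K (jmul K a d) (jmul K b c) :=
  (UnitalJordanSuperalgebra.isJordan (K := K) (J := J)).jordan ha hb hc hd

end JordanLemmas

section JordanLemmas2

variable {K : Type v} [Field K] {J : Type u} [AddCommGroup J] [Module K J] [SuperSpace K J]
  [UnitalJordanSuperalgebra K J]

/-- The supercommutator of two left multiplications is a superderivation. -/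
theorem jordan_derivation {i j k l : ZMod 2} {a b c d : J} (ha : a ∈ gr K (V := J) i)
    (hb : b ∈ gr K (V := J) j) (hc : c ∈ gr K (V := J) k) (hd : d ∈ gr K (V := J) l) :
    jmul K a (jmul K b (jmul K c d)) - sgn K i j • jmul K b (jmul K a (jmul K c d))
    = jmul K (jmul K a (jmul K b c) - sgn K i j • jmul K b (jmul K a c)) d
      + sgn K (i + j) k •
        jmul K c (jmul K a (jmul K b d) - sgn K i j • jmul K b (jmul K a d)) := by
  have h1 := congrArg
    (fun t => (sgn K k l * sgn K k j * sgn K k i * sgn K l j * sgn K l i * sgn K j i * sgn K k l) • t)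
    (jordan_left hc hd hb ha)
  have h2 := congrArg
    (fun t => (sgn K k j * sgn K k i * sgn K l j * sgn K l i) • t)
    (jordan_left hc hd ha hb)
  have c1 := jmul_comm (jmul_mem hb (jmul_mem hc hd)) ha
  have c2 := jmul_comm (jmul_mem ha (jmul_mem hc hd)) hb
  have c3 := jmul_comm (jmul_mem hc hd) hb
  have c4 := jmul_comm (jmul_mem hc hd) ha
  have c5 := jmul_comm hc ha
  have c6 := jmul_comm hd ha
  have c7 := jmul_comm hc hb
  have c8 := jmul_comm hd hb
  have c9 := jmul_comm hb ha
  have d1 := jmul_comm (jmul_mem ha hc) hb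
  have d2 := jmul_comm (jmul_mem ha hd) hb
  have d3 := jmul_comm (jmul_mem hb hc) ha
  have d4 := jmul_comm (jmul_mem hb hd) ha
  have d5 := jmul_comm (jmul_mem hb (jmul_mem ha hd)) hc
  have d6 := jmul_comm (jmul_mem ha (jmul_mem hb hd)) hc
  rcases zmod2_cases i with rfl | rfl <;> rcases zmod2_cases j with rfl | rfl <;>
  rcases zmod2_cases k with rfl | rfl <;> rcases zmod2_cases l with rfl | rfl <;>
  simp only [sgn_zero_left, sgn_zero_right, sgn_one_one, zmod2_one_add_one, add_zero, zero_add,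
    mul_one, one_smul, neg_smul, mul_neg, neg_neg] at c1 c2 c3 c4 c5 c6 c7 c8 c9 d1 d2 d3 d4 d5 d6 h1 h2 ⊢ <;>
  simp only [c5, c6, c7, c8, c9, c3, c4, d1, d2, d3, d4, c1, c2, d5, d6, map_neg,
    LinearMap.neg_apply, map_sub, map_add, LinearMap.sub_apply, LinearMap.add_apply] at h1 h2 ⊢ <;>
  linear_combination (norm := abel) h1 - h2

set_option maxHeartbeats 2000000 in
/-- The identity `[L_b, [L_a, P]] = -[L_{b·a}, P]`, where `P` is the product of `J`. -/
theorem jordan_act_act {i j k l : ZMod 2} {a b x y : J} (ha : a ∈ gr K (V := J) i)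
    (hb : b ∈ gr K (V := J) j) (hx : x ∈ gr K (V := J) k) (hy : y ∈ gr K (V := J) l) :
    jmul K b (jmul K a (jmul K x y) - (jmul K (jmul K a x) y
        + sgn K i k • jmul K x (jmul K a y)))
      - sgn K j i • ((jmul K a (jmul K (jmul K b x) y) - (jmul K (jmul K a (jmul K b x)) y
          + sgn K i (j + k) • jmul K (jmul K b x) (jmul K a y)))
        + sgn K j k • (jmul K a (jmul K x (jmul K b y)) - (jmul K (jmul K a x) (jmul K b y)
          + sgn K i k • jmul K x (jmul K a (jmul K b y)))))
    = -(jmul K (jmul K b a) (jmul K x y) - (jmul K (jmul K (jmul K b a) x) y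
        + sgn K (j + i) k • jmul K x (jmul K (jmul K b a) y))) := by
  have h1 := congrArg (fun t => sgn K i j • t) (jordan_left ha hb hx hy)
  have h2 := congrArg (fun t => (sgn K i j * sgn K k l) • t) (jordan_left ha hb hy hx)
  have h3 := congrArg (fun t => sgn K k i • t) (jordan_left hb hx ha hy)
  have c1 := jmul_comm ha hb
  have c2 := jmul_comm hy hx
  have c3 := jmul_comm hx ha
  have c4 := jmul_comm (jmul_mem hb hy) (jmul_mem ha hx)
  have c5 := jmul_comm (jmul_mem ha hy) (jmul_mem hb hx)
  have e1 := jmul_comm (jmul_mem ha hy) hx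
  have e2 := jmul_comm (jmul_mem hx (jmul_mem ha hy)) hb
  have e3 := jmul_comm (jmul_mem hb hy) hx
  have e4 := jmul_comm (jmul_mem hx (jmul_mem hb hy)) ha
  have e5 := jmul_comm (jmul_mem (jmul_mem hb ha) hy) hx
  have e6 := jmul_comm (jmul_mem (jmul_mem ha hx) hy) hb
  have e7 := jmul_comm (jmul_mem (jmul_mem hb hx) hy) ha
  have e8 := jmul_comm (jmul_mem hb hx) ha
  have e9 := jmul_comm (jmul_mem hb hy) ha
  have f1 := jmul_comm (jmul_mem ha (jmul_mem hb hy)) hx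
  have f2 := jmul_comm (jmul_mem hx hy) ha
  have f3 := jmul_comm (jmul_mem ha (jmul_mem hx hy)) hb
  rcases zmod2_cases i with rfl | rfl <;> rcases zmod2_cases j with rfl | rfl <;>
  rcases zmod2_cases k with rfl | rfl <;> rcases zmod2_cases l with rfl | rfl <;>
  simp only [sgn_zero_left, sgn_zero_right, sgn_one_one, zmod2_one_add_one, add_zero, zero_add,
    mul_one, one_smul, neg_smul, mul_neg, neg_neg] at c1 c2 c3 c4 c5 e1 e2 e3 e4 e5 e6 e7 e8 e9 f1 f2 f3 h1 h2 h3 ⊢ <;>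
  simp only [c1, c2, c3, c4, c5, e1, e2, e3, e4, e5, e6, e7, e8, e9, f1, f2, f3, map_neg,
    LinearMap.neg_apply, map_sub, map_add, LinearMap.sub_apply, LinearMap.add_apply] at h1 h2 h3 ⊢ <;>
  linear_combination (norm := abel) h3 - h1 - h2

end JordanLemmas2

/-! ### The Tits-Kantor-Koecher construction -/

section Ambient

variable {K : Type v} [Field K]

section SflipLemmas

variable {V W U : Type*} [AddCommGroup V] [Module K V] [SuperSpace K V]
  [AddCommGroup W] [Module K W] [SuperSpace K W] [AddCommGroup U] [Module K U]

theorem sflip_add (B C : V →ₗ[K] W →ₗ[K] U) : sflip (B + C) = sflip B + sflip C := by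
  ext w v
  simp [sflip, two_smul]
  abel

theorem sflip_sub (B C : V →ₗ[K] W →ₗ[K] U) : sflip (B - C) = sflip B - sflip C := by
  ext w v
  simp [sflip, two_smul]
  abel

theorem sflip_smul (c : K) (B : V →ₗ[K] W →ₗ[K] U) : sflip (c • B) = c • sflip B := by
  ext w v
  simp only [sflip, LinearMap.sub_apply, LinearMap.smul_apply, LinearMap.flip_apply,
    LinearMap.compl₁₂_apply]
  module

theorem sgn_comm (i j : ZMod 2) : sgn K i j = sgn K j i := by
  simp [sgn, and_comm]

theorem sgn_mul_self (i j : ZMod 2) : sgn K i j * sgn K i j = 1 := by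
  unfold sgn; split_ifs <;> simp

theorem sflip_sflip (B : V →ₗ[K] W →ₗ[K] U) : sflip (sflip B) = B := by
  refine ext_homog K fun i v hv => ext_homog K fun j w hw => ?_
  rw [sflip_apply _ hw hv, sflip_apply _ hv hw, smul_smul, sgn_comm, sgn_mul_self, one_smul]

end SflipLemmas

variable {J : Type u} [AddCommGroup J] [Module K J] [SuperSpace K J]

/-- For a bilinear map `B` and an operator `L` on `J`, the bilinear map
`(x, y) ↦ B(L x, y) + (-1)^{|x||y|} B(L y, x)`. -/
noncomputable def insertOp (B : J →ₗ[K] J →ₗ[K] J) (L : J →ₗ[K] J) : J →ₗ[K] J →ₗ[K] J :=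
  B ∘ₗ L + sflip (B ∘ₗ L)

/-- The supercommutator `m x y - (-1)^{|x||y|} m y x` of a bilinear product `m`. -/
noncomputable def superComm {V : Type u} [AddCommGroup V] [Module K V] [SuperSpace K V]
    (m : V →ₗ[K] V →ₗ[K] V) : V →ₗ[K] V →ₗ[K] V := m - sflip m

theorem superComm_apply {V : Type u} [AddCommGroup V] [Module K V] [SuperSpace K V]
    (m : V →ₗ[K] V →ₗ[K] V) {x y : V} {i j : ZMod 2} (hx : x ∈ gr K (V := V) i)
    (hy : y ∈ gr K (V := V) j) : superComm m x y = m x y - sgn K i j • m y x := by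
  rw [superComm, LinearMap.sub_apply, LinearMap.sub_apply, sflip_apply _ hy hx, sgn_comm]

variable (K J)

/-- The graded vector space `J ⊕ End(J) ⊕ Hom(J ⊗ J, J)`, with components of degrees
`1`, `0`, `-1`, that contains the TKK superalgebra. -/
abbrev Ambient : Type u := J × (J →ₗ[K] J) × (J →ₗ[K] J →ₗ[K] J)

/-- The bilinear product `(x, L, A) ∗ (y, M, B)` on the ambient space whose components are
`L(y)`, `L ∘ M + A(y, ·)` and `L ∘ B + insertOp A M`; its supercommutator is the TKK bracket. -/
noncomputable def ambientMul : Ambient K J →ₗ[K] Ambient K J →ₗ[K] Ambient K J :=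
  LinearMap.mk₂ K
    (fun X Y => (X.2.1 Y.1, X.2.1 ∘ₗ Y.2.1 + X.2.2 Y.1,
      Y.2.2.compr₂ X.2.1 + insertOp X.2.2 Y.2.1))
    (by
      intro X X' Y
      refine Prod.ext ?_ (Prod.ext ?_ ?_)
      · simp
      · ext; simp; abel
      · ext x y
        simp [insertOp, LinearMap.add_comp, sflip_add]; abel)
    (by
      intro c X Y
      refine Prod.ext ?_ (Prod.ext ?_ ?_)
      · simp
      · ext; simp
      · ext x y
        simp [insertOp, LinearMap.smul_comp, sflip_smul])
    (by
      intro X Y Y'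
      refine Prod.ext ?_ (Prod.ext ?_ ?_)
      · simp
      · ext; simp; abel
      · ext x y
        simp [insertOp, LinearMap.comp_add, sflip_add]; abel)
    (by
      intro c X Y
      refine Prod.ext ?_ (Prod.ext ?_ ?_)
      · simp
      · ext; simp
      · ext x y
        simp [insertOp, LinearMap.comp_smul, sflip_smul])

/-- The bracket `[X, Y] = X ∗ Y - (-1)^{|X||Y|} Y ∗ X`. For `x, y` in degree `1`, `L, M` in degree
`0` and `A, B` in degree `-1` it is given by `[x, y] = 0`, `[A, B] = 0`, `[L, x] = L(x)`,
`[A, x] = A(x, ·)`, `[L, M] = L ∘ M - (-1)^{|L||M|} M ∘ L` and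
`[L, B](x, y) = L(B(x, y)) - (-1)^{|L||B|} (B(L x, y) + (-1)^{|x||y|} B(L y, x))`. -/
noncomputable def ambientBr : Ambient K J →ₗ[K] Ambient K J →ₗ[K] Ambient K J :=
  superComm (ambientMul K J)

variable {K J}

/-- Supersymmetric bilinear maps. -/
def SuperSymm (B : J →ₗ[K] J →ₗ[K] J) : Prop := sflip B = B

theorem SuperSymm.apply {B : J →ₗ[K] J →ₗ[K] J} (h : SuperSymm B) {p q : ZMod 2} {x y : J}
    (hx : x ∈ gr K (V := J) p) (hy : y ∈ gr K (V := J) q) : B x y = sgn K p q • B y x := by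
  have := sflip_apply B hy hx
  rw [h, sgn_comm] at this
  exact this

theorem insertOp_symm (B : J →ₗ[K] J →ₗ[K] J) (L : J →ₗ[K] J) : SuperSymm (insertOp B L) := by
  rw [SuperSymm, insertOp, sflip_add, sflip_sflip, add_comm]

theorem SuperSymm.compr₂ {B : J →ₗ[K] J →ₗ[K] J} (h : SuperSymm B) (L : J →ₗ[K] J) :
    SuperSymm (B.compr₂ L) := by
  refine ext_homog K fun i v hv => ext_homog K fun j w hw => ?_
  rw [sflip_apply _ hw hv]
  simp only [LinearMap.compr₂_apply]
  rw [h.apply hv hw, map_smul, sgn_comm]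

theorem SuperSymm.add {B C : J →ₗ[K] J →ₗ[K] J} (h : SuperSymm B) (h' : SuperSymm C) :
    SuperSymm (B + C) := by
  rw [SuperSymm, sflip_add, h, h']

theorem SuperSymm.sub_smul {B C : J →ₗ[K] J →ₗ[K] J} (c : K) (h : SuperSymm B)
    (h' : SuperSymm C) : SuperSymm (B - c • C) := by
  rw [SuperSymm, sflip_sub, sflip_smul, h, h']

theorem SuperSymm.smul {B : J →ₗ[K] J →ₗ[K] J} (c : K) (h : SuperSymm B) :
    SuperSymm (c • B) := by
  rw [SuperSymm, sflip_smul, h]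

theorem insertOp_apply {B : J →ₗ[K] J →ₗ[K] J} (h : SuperSymm B) {L : J →ₗ[K] J}
    {j p q : ZMod 2} {x y : J} (hL : L ∈ gr K (V := J →ₗ[K] J) j)
    (hx : x ∈ gr K (V := J) p) (hy : y ∈ gr K (V := J) q) :
    insertOp B L x y = B (L x) y + sgn K j p • B x (L y) := by
  rw [insertOp, LinearMap.add_apply, LinearMap.add_apply, sflip_apply _ hy hx,
    LinearMap.comp_apply, LinearMap.comp_apply, h.apply (apply_mem K hL hy) hx, smul_smul]
  congr 2
  rcases zmod2_cases j with rfl | rfl <;> rcases zmod2_cases p with rfl | rfl <;>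
    rcases zmod2_cases q with rfl | rfl <;> simp [sgn, zmod2_one_add_one]

theorem ambientBr_apply {X Y : Ambient K J} {i j : ZMod 2} (hX : X ∈ gr K (V := Ambient K J) i)
    (hY : Y ∈ gr K (V := Ambient K J) j) :
    ambientBr K J X Y = ambientMul K J X Y - sgn K i j • ambientMul K J Y X :=
  superComm_apply _ hX hY

theorem ambientBr_fst {X Y : Ambient K J} {i j : ZMod 2} (hX : X ∈ gr K (V := Ambient K J) i)
    (hY : Y ∈ gr K (V := Ambient K J) j) :
    (ambientBr K J X Y).1 = X.2.1 Y.1 - sgn K i j • Y.2.1 X.1 := by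
  rw [ambientBr_apply hX hY]; rfl

theorem ambientBr_snd {X Y : Ambient K J} {i j : ZMod 2} (hX : X ∈ gr K (V := Ambient K J) i)
    (hY : Y ∈ gr K (V := Ambient K J) j) (u : J) :
    (ambientBr K J X Y).2.1 u = X.2.1 (Y.2.1 u) + X.2.2 Y.1 u
      - sgn K i j • (Y.2.1 (X.2.1 u) + Y.2.2 X.1 u) := by
  rw [ambientBr_apply hX hY]; rfl

theorem ambientBr_trd {X Y : Ambient K J} {i j : ZMod 2} (hX : X ∈ gr K (V := Ambient K J) i)
    (hY : Y ∈ gr K (V := Ambient K J) j) (sX : SuperSymm X.2.2) (sY : SuperSymm Y.2.2)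
    {p q : ZMod 2} {x y : J} (hx : x ∈ gr K (V := J) p) (hy : y ∈ gr K (V := J) q) :
    (ambientBr K J X Y).2.2 x y =
      X.2.1 (Y.2.2 x y) + (X.2.2 (Y.2.1 x) y + sgn K j p • X.2.2 x (Y.2.1 y))
      - sgn K i j •
        (Y.2.1 (X.2.2 x y) + (Y.2.2 (X.2.1 x) y + sgn K i p • Y.2.2 x (X.2.1 y))) := by
  rw [ambientBr_apply hX hY, ← insertOp_apply sX hY.2.1 hx hy, ← insertOp_apply sY hX.2.1 hx hy]
  rfl

theorem ambientMul_symm {X Y : Ambient K J} (sY : SuperSymm Y.2.2) :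
    SuperSymm (ambientMul K J X Y).2.2 :=
  (sY.compr₂ _).add (insertOp_symm _ _)

theorem ambientBr_symm {X Y : Ambient K J} {i j : ZMod 2} (hX : X ∈ gr K (V := Ambient K J) i)
    (hY : Y ∈ gr K (V := Ambient K J) j) (sX : SuperSymm X.2.2) (sY : SuperSymm Y.2.2) :
    SuperSymm (ambientBr K J X Y).2.2 := by
  rw [ambientBr_apply hX hY]
  exact (ambientMul_symm sY).sub_smul _ (ambientMul_symm sX)

theorem insertOp_mem {B : J →ₗ[K] J →ₗ[K] J} {L : J →ₗ[K] J} {i j : ZMod 2}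
    (hB : B ∈ gr K (V := J →ₗ[K] J →ₗ[K] J) i) (hL : L ∈ gr K (V := J →ₗ[K] J) j) :
    insertOp B L ∈ gr K (V := J →ₗ[K] J →ₗ[K] J) (i + j) := by
  intro p x hx q y hy
  rw [insertOp, LinearMap.add_apply, LinearMap.add_apply, sflip_apply _ hy hx]
  refine add_mem ?_ (Submodule.smul_mem _ _ ?_)
  · have := hB _ _ (hL _ _ hx) _ _ hy
    rwa [← add_assoc] at this
  · have := hB _ _ (hL _ _ hy) _ _ hx
    have e : i + j + p + q = i + (j + q) + p := by ring
    rw [e]; exact this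

theorem ambientMul_mem {X Y : Ambient K J} {i j : ZMod 2} (hX : X ∈ gr K (V := Ambient K J) i)
    (hY : Y ∈ gr K (V := Ambient K J) j) :
    ambientMul K J X Y ∈ gr K (V := Ambient K J) (i + j) := by
  refine ⟨hX.2.1 _ _ hY.1, add_mem ?_ (hX.2.2 _ _ hY.1), add_mem ?_ (insertOp_mem hX.2.2 hY.2.1)⟩
  · intro p x hx
    have := hX.2.1 _ _ (hY.2.1 _ _ hx)
    rwa [← add_assoc] at this
  · intro p x hx q y hy
    have := hX.2.1 _ _ (hY.2.2 _ _ hx _ _ hy)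
    have e : i + j + p + q = i + (j + p + q) := by ring
    rw [e]; exact this

theorem ambientBr_mem {X Y : Ambient K J} {i j : ZMod 2} (hX : X ∈ gr K (V := Ambient K J) i)
    (hY : Y ∈ gr K (V := Ambient K J) j) :
    ambientBr K J X Y ∈ gr K (V := Ambient K J) (i + j) := by
  rw [ambientBr_apply hX hY]
  refine sub_mem (ambientMul_mem hX hY) (Submodule.smul_mem _ _ ?_)
  rw [add_comm]
  exact ambientMul_mem hY hX

theorem ambientBr_skew {X Y : Ambient K J} {i j : ZMod 2} (hX : X ∈ gr K (V := Ambient K J) i)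
    (hY : Y ∈ gr K (V := Ambient K J) j) :
    ambientBr K J X Y = -(sgn K i j • ambientBr K J Y X) := by
  rw [ambientBr_apply hX hY, ambientBr_apply hY hX, smul_sub, smul_smul, sgn_comm j i,
    sgn_mul_self, one_smul]
  abel

/-- The condition on two bilinear maps `A`, `B` that expresses the super Jacobi identity for
`A`, `B` and elements of degree `1`. -/
def Compatible (A B : J →ₗ[K] J →ₗ[K] J) (i j : ZMod 2) : Prop :=
  ∀ {k p q : ZMod 2} {c x y : J}, c ∈ gr K (V := J) k → x ∈ gr K (V := J) p →
    y ∈ gr K (V := J) q →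
    A (B c x) y + sgn K (j + k) p • A x (B c y) - sgn K i (j + k) • B c (A x y)
      = sgn K i j •
        (B (A c x) y + sgn K (i + k) p • B x (A c y) - sgn K j (i + k) • A c (B x y))

set_option maxHeartbeats 4000000 in
theorem ambient_jacobi {X Y Z : Ambient K J} {i j k : ZMod 2}
    (hX : X ∈ gr K (V := Ambient K J) i) (hY : Y ∈ gr K (V := Ambient K J) j)
    (hZ : Z ∈ gr K (V := Ambient K J) k) (sX : SuperSymm X.2.2) (sY : SuperSymm Y.2.2)
    (sZ : SuperSymm Z.2.2) (qXY : Compatible X.2.2 Y.2.2 i j) (qXZ : Compatible X.2.2 Z.2.2 i k)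
    (qYZ : Compatible Y.2.2 Z.2.2 j k) :
    ambientBr K J X (ambientBr K J Y Z) =
      ambientBr K J (ambientBr K J X Y) Z
        + sgn K i j • ambientBr K J Y (ambientBr K J X Z) := by
  have hXY := ambientBr_mem hX hY
  have hXZ := ambientBr_mem hX hZ
  have hYZ := ambientBr_mem hY hZ
  have sXY := ambientBr_symm hX hY sX sY
  have sXZ := ambientBr_symm hX hZ sX sZ
  have sYZ := ambientBr_symm hY hZ sY sZ
  refine Prod.ext ?_ (Prod.ext ?_ ?_)
  · simp only [Prod.fst_add, Prod.smul_fst]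
    rw [ambientBr_fst hX hYZ, ambientBr_fst hXY hZ, ambientBr_fst hY hXZ,
      ambientBr_fst hY hZ, ambientBr_fst hX hY, ambientBr_fst hX hZ,
      ambientBr_snd hX hY, ambientBr_snd hY hZ, ambientBr_snd hX hZ]
    have c1 := sX.apply hY.1 hZ.1
    have c2 := sY.apply hX.1 hZ.1
    have c3 := sZ.apply hX.1 hY.1
    rw [c1, c2, c3]
    simp only [map_sub, map_smul]
    rcases zmod2_cases i with rfl | rfl <;> rcases zmod2_cases j with rfl | rfl <;>
    rcases zmod2_cases k with rfl | rfl <;>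
    simp only [sgn_zero_left, sgn_zero_right, sgn_one_one, zmod2_one_add_one, add_zero, zero_add,
      one_smul, neg_smul] <;> abel
  · refine ext_homog K fun p u hu => ?_
    simp only [Prod.snd_add, Prod.fst_add, Prod.smul_snd, Prod.smul_fst, LinearMap.add_apply,
      LinearMap.smul_apply]
    have hXu := apply_mem K hX.2.1 hu
    have hYu := apply_mem K hY.2.1 hu
    have hZu := apply_mem K hZ.2.1 hu
    rw [ambientBr_snd hX hYZ, ambientBr_snd hXY hZ, ambientBr_snd hY hXZ,
      ambientBr_fst hY hZ, ambientBr_fst hX hY, ambientBr_fst hX hZ,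
      ambientBr_trd hX hY sX sY hZ.1 hu, ambientBr_trd hX hZ sX sZ hY.1 hu,
      ambientBr_trd hY hZ sY sZ hX.1 hu]
    simp only [ambientBr_snd hX hY, ambientBr_snd hY hZ, ambientBr_snd hX hZ, map_sub, map_smul,
      map_add, LinearMap.sub_apply, LinearMap.smul_apply, LinearMap.add_apply]
    clear hXY hXZ hYZ sXY sXZ sYZ
    rcases zmod2_cases i with rfl | rfl <;> rcases zmod2_cases j with rfl | rfl <;>
    rcases zmod2_cases k with rfl | rfl <;> rcases zmod2_cases p with rfl | rfl <;>
    simp only [sgn_zero_left, sgn_zero_right, sgn_one_one, zmod2_one_add_one, add_zero, zero_add,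
      one_smul, neg_smul] <;> abel
  · refine ext_homog K fun p u hu => ext_homog K fun q v hv => ?_
    simp only [Prod.snd_add, Prod.smul_snd, LinearMap.add_apply, LinearMap.smul_apply]
    have hXu := apply_mem K hX.2.1 hu
    have hYu := apply_mem K hY.2.1 hu
    have hZu := apply_mem K hZ.2.1 hu
    have hXv := apply_mem K hX.2.1 hv
    have hYv := apply_mem K hY.2.1 hv
    have hZv := apply_mem K hZ.2.1 hv
    have h1 := qXY hZ.1 hu hv
    have h2 := congrArg (fun t => sgn K j k • t) (qXZ hY.1 hu hv)
    have h3 := congrArg (fun t => (sgn K i j * sgn K i k) • t) (qYZ hX.1 hu hv)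
    rw [ambientBr_trd hX hYZ sX sYZ hu hv, ambientBr_trd hXY hZ sXY sZ hu hv,
      ambientBr_trd hY hXZ sY sXZ hu hv]
    rw [ambientBr_trd hY hZ sY sZ hu hv, ambientBr_trd hX hZ sX sZ hu hv,
      ambientBr_trd hX hY sX sY hu hv, ambientBr_trd hY hZ sY sZ hXu hv,
      ambientBr_trd hY hZ sY sZ hu hXv, ambientBr_trd hX hZ sX sZ hYu hv,
      ambientBr_trd hX hZ sX sZ hu hYv, ambientBr_trd hX hY sX sY hZu hv,
      ambientBr_trd hX hY sX sY hu hZv]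
    simp only [ambientBr_snd hX hY, ambientBr_snd hY hZ, ambientBr_snd hX hZ, map_sub, map_smul,
      map_add, LinearMap.sub_apply, LinearMap.smul_apply, LinearMap.add_apply]
    clear hXY hXZ hYZ sXY sXZ sYZ qXY qXZ qYZ
    obtain ⟨a, L, A⟩ := X
    obtain ⟨b, M, B⟩ := Y
    obtain ⟨c, N, C⟩ := Z
    dsimp only at h1 h2 h3 ⊢
    rcases zmod2_cases i with rfl | rfl <;> rcases zmod2_cases j with rfl | rfl <;>
    rcases zmod2_cases k with rfl | rfl <;> rcases zmod2_cases p with rfl | rfl <;>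
    simp only [sgn_zero_left, sgn_zero_right, sgn_one_one, zmod2_one_add_one, add_zero, zero_add,
      one_smul, neg_smul, mul_one, mul_neg, neg_neg] at h1 h2 h3 ⊢ <;>
    linear_combination (norm := abel) h1 - h2 + h3

end Ambient

section TKKDef

variable (K : Type v) [Field K] (J : Type u) [AddCommGroup J] [Module K J] [SuperSpace K J]
  [UnitalJordanSuperalgebra K J]

/-- An element of `J`, in degree `1`. -/
noncomputable def inJ : J →ₗ[K] Ambient K J := LinearMap.inl K J _

/-- The operator `L_a`, in degree `0`. -/
noncomputable def inL : J →ₗ[K] Ambient K J :=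
  LinearMap.inr K J _ ∘ₗ LinearMap.inl K _ _ ∘ₗ jmul K

/-- The product `P` of `J`, in degree `-1`. -/
noncomputable def inP : Ambient K J := (0, 0, jmul K)

/-- The underlying graded space of the Tits-Kantor-Koecher superalgebra of `J`:
`J` in degree `1`, the span of all `L_a` and `[L_a, L_b]` in degree `0`, and the span of `P` and all
`[L_a, P]` in degree `-1`. -/
noncomputable def tkkSubmodule : Submodule K (Ambient K J) :=
  Submodule.span K (
    {X | ∃ a : J, X = inJ K J a} ∪
    {X | ∃ a : J, X = inL K J a} ∪ {X | ∃ a b : J, X = ambientBr K J (inL K J a) (inL K J b)} ∪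
    {X | X = inP K J} ∪ {X | ∃ a : J, X = ambientBr K J (inL K J a) (inP K J)})

variable {K J}

theorem inJ_mem_gr {i : ZMod 2} {a : J} (ha : a ∈ gr K (V := J) i) :
    inJ K J a ∈ gr K (V := Ambient K J) i := ⟨ha, zero_mem _, zero_mem _⟩

theorem inL_mem_gr {i : ZMod 2} {a : J} (ha : a ∈ gr K (V := J) i) :
    inL K J a ∈ gr K (V := Ambient K J) i := ⟨zero_mem _, jmul_hom_mem ha, zero_mem _⟩

theorem jmul_mem_gr : jmul K ∈ gr K (V := J →ₗ[K] J →ₗ[K] J) 0 := by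
  intro j x hx
  rw [zero_add]
  exact jmul_hom_mem hx

theorem inP_mem_gr : inP K J ∈ gr K (V := Ambient K J) 0 :=
  ⟨zero_mem _, zero_mem _, jmul_mem_gr⟩

theorem jmul_symm : SuperSymm (jmul K (J := J)) := by
  refine ext_homog K fun i v hv => ext_homog K fun j w hw => ?_
  rw [sflip_apply _ hw hv, jmul_comm hv hw, sgn_comm]

theorem zero_symm : SuperSymm (0 : J →ₗ[K] J →ₗ[K] J) := by
  ext; simp [sflip]

theorem inL_symm (a : J) : SuperSymm (inL K J a).2.2 := zero_symm
theorem inP_symm : SuperSymm (inP K J).2.2 := jmul_symm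

theorem compatible_zero_left (B : J →ₗ[K] J →ₗ[K] J) (i j : ZMod 2) : Compatible 0 B i j := by
  intro k p q c x y _ _ _
  simp

theorem compatible_zero_right (B : J →ₗ[K] J →ₗ[K] J) (i j : ZMod 2) : Compatible B 0 i j := by
  intro k p q c x y _ _ _
  simp

variable (K) in
/-- The element `[L_a, P]` of degree `-1`. -/
noncomputable def inQ : J →ₗ[K] Ambient K J := (ambientBr K J).flip (inP K J) ∘ₗ inL K J

theorem inQ_apply (a : J) : inQ K a = ambientBr K J (inL K J a) (inP K J) := rfl

theorem inQ_mem_gr {i : ZMod 2} {a : J} (ha : a ∈ gr K (V := J) i) :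
    inQ K a ∈ gr K (V := Ambient K J) i := by
  have := ambientBr_mem (inL_mem_gr ha) (inP_mem_gr (K := K) (J := J))
  rwa [add_zero] at this

theorem inQ_symm (a : J) : SuperSymm (inQ K a).2.2 := by
  obtain ⟨y, hy, z, hz, rfl⟩ := exists_homog K a
  rw [map_add]
  exact (ambientBr_symm (inL_mem_gr hy) inP_mem_gr (inL_symm _) inP_symm).add
    (ambientBr_symm (inL_mem_gr hz) inP_mem_gr (inL_symm _) inP_symm)

theorem inQ_fst (a : J) : (inQ K a).1 = 0 := by
  refine homog_induction K (p := fun a => (inQ K a).1 = 0) ?_ ?_ a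
  · intro x y hx hy; simp [hx, hy]
  · intro i x hx
    rw [inQ_apply, ambientBr_fst (inL_mem_gr hx) inP_mem_gr]
    simp [inP, inL]

theorem inQ_snd (a : J) : (inQ K a).2.1 = 0 := by
  refine homog_induction K (p := fun a => (inQ K a).2.1 = 0) ?_ ?_ a
  · intro x y hx hy; simp [hx, hy]
  · intro i x hx
    ext u
    rw [inQ_apply, ambientBr_snd (inL_mem_gr hx) inP_mem_gr]
    simp [inP, inL]

theorem inQ_trd {i p q : ZMod 2} {a x y : J} (ha : a ∈ gr K (V := J) i)
    (hx : x ∈ gr K (V := J) p) (hy : y ∈ gr K (V := J) q) :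
    (inQ K a).2.2 x y = jmul K a (jmul K x y) - (jmul K (jmul K a x) y
      + sgn K i p • jmul K x (jmul K a y)) := by
  rw [inQ_apply, ambientBr_trd (inL_mem_gr ha) inP_mem_gr (inL_symm _) inP_symm hx hy]
  simp [inP, inL, sgn_zero_right]

theorem inP_eq : inP K J = -inQ K (jone K J) := by
  have h1 : jone K J ∈ gr K (V := J) 0 := UnitalJordanSuperalgebra.one_mem
  have h2 : ∀ a : J, jmul K (jone K J) a = a := UnitalJordanSuperalgebra.one_mul
  refine Prod.ext ?_ (Prod.ext ?_ ?_)
  · simp [inQ_fst, inP]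
  · simp [inQ_snd, inP]
  · refine ext_homog K fun p x hx => ext_homog K fun q y hy => ?_
    have := inQ_trd h1 hx hy
    simp only [h2, sgn_zero_left, one_smul] at this
    simp [this, inP]

theorem br_inL_inJ (a b : J) : ambientBr K J (inL K J a) (inJ K J b) = inJ K J (jmul K a b) := by
  revert b
  refine homog_induction K (p := fun a => ∀ b, ambientBr K J (inL K J a) (inJ K J b) =
    inJ K J (jmul K a b)) (fun x y hx hy b => by simp [hx, hy]) (fun i a ha => ?_) a
  refine homog_induction K (fun x y hx hy => by simp [hx, hy]) (fun j b hb => ?_)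
  rw [ambientBr_apply (inL_mem_gr ha) (inJ_mem_gr hb)]
  refine Prod.ext ?_ (Prod.ext ?_ ?_)
  · simp [ambientMul, inL, inJ]
  · ext; simp [ambientMul, inL, inJ]
  · ext; simp [ambientMul, inL, inJ, insertOp, sflip]

theorem br_inJ_inJ (a b : J) : ambientBr K J (inJ K J a) (inJ K J b) = 0 := by
  revert b
  refine homog_induction K (p := fun a => ∀ b, ambientBr K J (inJ K J a) (inJ K J b) =
    0) (fun x y hx hy b => by simp [hx, hy]) (fun i a ha => ?_) a
  refine homog_induction K (fun x y hx hy => by simp [hx, hy]) (fun j b hb => ?_)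
  rw [ambientBr_apply (inJ_mem_gr ha) (inJ_mem_gr hb)]
  refine Prod.ext ?_ (Prod.ext ?_ ?_)
  · simp [ambientMul, inJ]
  · ext; simp [ambientMul, inJ]
  · ext; simp [ambientMul, inJ, insertOp, sflip]

theorem br_inP_inJ (b : J) : ambientBr K J (inP K J) (inJ K J b) = inL K J b := by
  refine homog_induction K (p := fun b => ambientBr K J (inP K J) (inJ K J b) =
    inL K J b) (fun x y hx hy => by simp [hx, hy]) (fun i b hb => ?_) b
  rw [ambientBr_apply inP_mem_gr (inJ_mem_gr hb)]
  refine Prod.ext ?_ (Prod.ext ?_ ?_)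
  · simp [ambientMul, inJ, inP, inL]
  · ext; simp [ambientMul, inJ, inP, inL]
  · ext; simp [ambientMul, inJ, inP, inL, insertOp, sflip]

theorem br_inQ_inQ (a b : J) : ambientBr K J (inQ K a) (inQ K b) = 0 := by
  revert b
  refine homog_induction K (p := fun a => ∀ b, ambientBr K J (inQ K a) (inQ K b) =
    0) (fun x y hx hy b => by simp [hx, hy]) (fun i a ha => ?_) a
  refine homog_induction K (fun x y hx hy => by simp [hx, hy]) (fun j b hb => ?_)
  rw [ambientBr_apply (inQ_mem_gr ha) (inQ_mem_gr hb)]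
  refine Prod.ext ?_ (Prod.ext ?_ ?_)
  · simp [ambientMul, inQ_fst, inQ_snd]
  · ext; simp [ambientMul, inQ_fst, inQ_snd]
  · ext; simp [ambientMul, inQ_fst, inQ_snd, insertOp, sflip]

theorem br_inL_inQ {i j : ZMod 2} {a b : J} (ha : a ∈ gr K (V := J) i)
    (hb : b ∈ gr K (V := J) j) :
    ambientBr K J (inL K J b) (inQ K a) = -inQ K (jmul K b a) := by
  refine Prod.ext ?_ (Prod.ext ?_ ?_)
  · rw [ambientBr_fst (inL_mem_gr hb) (inQ_mem_gr ha)]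
    simp [inQ_fst, inQ_snd, inL]
  · ext u
    rw [ambientBr_snd (inL_mem_gr hb) (inQ_mem_gr ha)]
    simp [inQ_fst, inQ_snd, inL]
  · refine ext_homog K fun p x hx => ext_homog K fun q y hy => ?_
    rw [ambientBr_trd (inL_mem_gr hb) (inQ_mem_gr ha) (inL_symm _) (inQ_symm _) hx hy]
    have := jordan_act_act ha hb hx hy
    rw [← inQ_trd ha hx hy, ← inQ_trd ha (jmul_mem hb hx) hy, ← inQ_trd ha hx (jmul_mem hb hy),
      ← inQ_trd (jmul_mem hb ha) hx hy] at this
    simpa [inQ_snd, inL] using this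

theorem zero_trd_jacobi {X Y Z : Ambient K J} {i j k : ZMod 2}
    (hX : X ∈ gr K (V := Ambient K J) i) (hY : Y ∈ gr K (V := Ambient K J) j)
    (hZ : Z ∈ gr K (V := Ambient K J) k) (zX : X.2.2 = 0) (zY : Y.2.2 = 0)
    (sZ : SuperSymm Z.2.2) :
    ambientBr K J X (ambientBr K J Y Z) =
      ambientBr K J (ambientBr K J X Y) Z
        + sgn K i j • ambientBr K J Y (ambientBr K J X Z) :=
  ambient_jacobi hX hY hZ (zX ▸ zero_symm) (zY ▸ zero_symm) sZ (zX ▸ compatible_zero_left _ _ _)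
    (zX ▸ compatible_zero_left _ _ _) (zY ▸ compatible_zero_left _ _ _)

theorem br_inD_inL {i j k : ZMod 2} {a b c : J} (ha : a ∈ gr K (V := J) i)
    (hb : b ∈ gr K (V := J) j) (hc : c ∈ gr K (V := J) k) :
    ambientBr K J (ambientBr K J (inL K J a) (inL K J b)) (inL K J c) =
      inL K J (jmul K a (jmul K b c) - sgn K i j • jmul K b (jmul K a c)) := by
  have hD := ambientBr_mem (inL_mem_gr ha) (inL_mem_gr hb)
  have hs := ambientBr_symm (inL_mem_gr ha) (inL_mem_gr hb) (inL_symm _) (inL_symm _)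
  refine Prod.ext ?_ (Prod.ext ?_ ?_)
  · rw [ambientBr_fst hD (inL_mem_gr hc), ambientBr_fst (inL_mem_gr ha) (inL_mem_gr hb)]
    simp [inL]
  · refine ext_homog K fun p x hx => ?_
    rw [ambientBr_snd hD (inL_mem_gr hc), ambientBr_snd (inL_mem_gr ha) (inL_mem_gr hb),
      ambientBr_snd (inL_mem_gr ha) (inL_mem_gr hb)]
    have := jordan_derivation ha hb hc hx
    simp only [inL, LinearMap.comp_apply, LinearMap.inr_apply, LinearMap.inl_apply,
      LinearMap.zero_apply, add_zero, map_zero] at this ⊢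
    rw [this, add_sub_cancel_right]
  · refine ext_homog K fun p x hx => ext_homog K fun q y hy => ?_
    rw [ambientBr_trd hD (inL_mem_gr hc) hs (inL_symm _) hx hy,
      ambientBr_trd (inL_mem_gr ha) (inL_mem_gr hb) (inL_symm _) (inL_symm _) hx hy,
      ambientBr_trd (inL_mem_gr ha) (inL_mem_gr hb) (inL_symm _) (inL_symm _)
        (apply_mem K (inL_mem_gr hc).2.1 hx) hy,
      ambientBr_trd (inL_mem_gr ha) (inL_mem_gr hb) (inL_symm _) (inL_symm _) hx
        (apply_mem K (inL_mem_gr hc).2.1 hy)]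
    simp [inL]

theorem br_inQ_inJ {i j : ZMod 2} {a b : J} (ha : a ∈ gr K (V := J) i)
    (hb : b ∈ gr K (V := J) j) :
    ambientBr K J (inQ K a) (inJ K J b) =
      ambientBr K J (inL K J a) (inL K J b) - inL K J (jmul K a b) := by
  have := ambient_jacobi (inL_mem_gr ha) inP_mem_gr (inJ_mem_gr hb) (inL_symm _) inP_symm zero_symm
    (compatible_zero_left _ _ _) (compatible_zero_left _ _ _) (compatible_zero_right _ _ _)
  rw [br_inP_inJ, br_inL_inJ, br_inP_inJ, sgn_zero_right, one_smul, ← inQ_apply] at this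
  rw [this, add_sub_cancel_right]

end TKKDef

section TKKLie

variable {K : Type v} [Field K] {J : Type u} [AddCommGroup J] [Module K J] [SuperSpace K J]
  [UnitalJordanSuperalgebra K J]

theorem inD_trd {j k : ZMod 2} {b c : J} (hb : b ∈ gr K (V := J) j)
    (hc : c ∈ gr K (V := J) k) : (ambientBr K J (inL K J b) (inL K J c)).2.2 = 0 := by
  refine ext_homog K fun p x hx => ext_homog K fun q y hy => ?_
  rw [ambientBr_trd (inL_mem_gr hb) (inL_mem_gr hc) (inL_symm _) (inL_symm _) hx hy]
  simp [inL]

theorem br_inD_inQ {i j k : ZMod 2} {a b c : J} (ha : a ∈ gr K (V := J) i)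
    (hb : b ∈ gr K (V := J) j) (hc : c ∈ gr K (V := J) k) :
    ambientBr K J (ambientBr K J (inL K J b) (inL K J c)) (inQ K a) =
      inQ K (jmul K b (jmul K c a) - sgn K j k • jmul K c (jmul K b a)) := by
  have := zero_trd_jacobi (inL_mem_gr hb) (inL_mem_gr hc) (inQ_mem_gr ha) rfl rfl (inQ_symm _)
  rw [br_inL_inQ ha hc, br_inL_inQ ha hb, map_neg, map_neg, br_inL_inQ (jmul_mem hc ha) hb,
    br_inL_inQ (jmul_mem hb ha) hc, neg_neg, neg_neg] at this
  rw [map_sub, map_smul, this, add_sub_cancel_right]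

theorem br_QJ_inQ {i j k p q : ZMod 2} {a b c x y : J} (ha : a ∈ gr K (V := J) i)
    (hb : b ∈ gr K (V := J) j) (hc : c ∈ gr K (V := J) k) (hx : x ∈ gr K (V := J) p)
    (hy : y ∈ gr K (V := J) q) :
    (inQ K b).2.2 c ((inQ K a).2.2 x y) - sgn K (j + k) i •
      ((inQ K a).2.2 ((inQ K b).2.2 c x) y
        + sgn K (j + k) p • (inQ K a).2.2 x ((inQ K b).2.2 c y)) =
    (inQ K (jmul K b (jmul K c a) - sgn K j k • jmul K c (jmul K b a)
      + jmul K (jmul K b c) a)).2.2 x y := by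
  have hW := ambientBr_mem (inQ_mem_gr hb) (inJ_mem_gr hc)
  have e2 : ∀ u, (ambientBr K J (inQ K b) (inJ K J c)).2.1 u = (inQ K b).2.2 c u := by
    intro u
    rw [ambientBr_snd (inQ_mem_gr hb) (inJ_mem_gr hc)]
    simp [inJ, inQ_fst, inQ_snd]
  have e3 : (ambientBr K J (inQ K b) (inJ K J c)).2.2 = 0 := by
    rw [br_inQ_inJ hb hc, Prod.snd_sub, Prod.snd_sub, inD_trd hb hc]
    simp [inL]
  have h := ambientBr_trd hW (inQ_mem_gr ha) (e3 ▸ zero_symm) (inQ_symm _) hx hy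
  simp only [e2, e3, inQ_snd, LinearMap.zero_apply, map_zero, smul_zero, add_zero, zero_add] at h
  rw [← h, br_inQ_inJ hb hc, map_sub, LinearMap.sub_apply, br_inD_inQ ha hb hc,
    br_inL_inQ ha (jmul_mem hb hc), sub_neg_eq_add, ← map_add]

theorem inQ_compatible {i j : ZMod 2} {a b : J} (ha : a ∈ gr K (V := J) i)
    (hb : b ∈ gr K (V := J) j) : Compatible (inQ K a).2.2 (inQ K b).2.2 i j := by
  intro k p q c x y hc hx hy
  have h1 := br_QJ_inQ ha hb hc hx hy
  have h2 := br_QJ_inQ hb ha hc hx hy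
  have e : sgn K i (j + k) • (jmul K b (jmul K c a) - sgn K j k • jmul K c (jmul K b a)
      + jmul K (jmul K b c) a) = (sgn K i j * sgn K j (i + k)) •
      (jmul K a (jmul K c b) - sgn K i k • jmul K c (jmul K a b) + jmul K (jmul K a c) b) := by
    have c1 := jmul_comm hc ha
    have c2 := jmul_comm hc hb
    have c3 := jmul_comm hb ha
    have c4 := jmul_comm (jmul_mem hb hc) ha
    have c5 := jmul_comm (jmul_mem ha hc) hb
    rw [c1, c2, c3, c4, c5]
    simp only [map_smul]
    rcases zmod2_cases i with rfl | rfl <;> rcases zmod2_cases j with rfl | rfl <;>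
    rcases zmod2_cases k with rfl | rfl <;>
    simp only [sgn_zero_left, sgn_zero_right, sgn_one_one, zmod2_one_add_one, add_zero, zero_add] <;>
    module
  have e' := congrArg (fun z => (inQ K z).2.2 x y) e
  simp only [map_smul, Prod.smul_snd, LinearMap.smul_apply] at e'
  rw [← h1, ← h2] at e'
  rw [smul_sub, smul_smul, sgn_comm (j + k) i, sgn_mul_self, one_smul, mul_smul, smul_sub,
    smul_smul (sgn K j (i + k)), sgn_comm (i + k) j, sgn_mul_self, one_smul] at e'
  rw [smul_sub] at e' ⊢
  linear_combination (norm := module) -e'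

/-- A linear property of elements of the TKK superalgebra can be checked on the homogeneous
generators. -/
theorem tkk_induction {p : Ambient K J → Prop} (h0 : p 0)
    (hadd : ∀ X Y, p X → p Y → p (X + Y)) (hsmul : ∀ (c : K) X, p X → p (c • X))
    (hJ : ∀ i, ∀ a ∈ gr K (V := J) i, p (inJ K J a))
    (hL : ∀ i, ∀ a ∈ gr K (V := J) i, p (inL K J a))
    (hD : ∀ i j, ∀ a ∈ gr K (V := J) i, ∀ b ∈ gr K (V := J) j,
      p (ambientBr K J (inL K J a) (inL K J b)))
    (hQ : ∀ i, ∀ a ∈ gr K (V := J) i, p (inQ K a)) {X : Ambient K J}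
    (hX : X ∈ tkkSubmodule K J) : p X := by
  have hQ' : ∀ a, p (inQ K a) := fun a => by
    refine homog_induction K (p := fun a => p (inQ K a)) (fun x y hx hy => ?_) hQ a
    rw [map_add]; exact hadd _ _ hx hy
  refine Submodule.span_induction ?_ h0 (fun X Y _ _ => hadd X Y) (fun c X _ => hsmul c X) hX
  rintro X ((((⟨a, rfl⟩ | ⟨a, rfl⟩) | ⟨a, b, rfl⟩) | rfl) | ⟨a, rfl⟩)
  · refine homog_induction K (p := fun a => p (inJ K J a)) (fun x y hx hy => ?_) hJ a
    rw [map_add]; exact hadd _ _ hx hy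
  · refine homog_induction K (p := fun a => p (inL K J a)) (fun x y hx hy => ?_) hL a
    rw [map_add]; exact hadd _ _ hx hy
  · revert b
    refine homog_induction K (p := fun a => ∀ b, p (ambientBr K J (inL K J a) (inL K J b)))
      (fun x y hx hy b => ?_) (fun i a ha => ?_) a
    · rw [map_add, map_add, LinearMap.add_apply]; exact hadd _ _ (hx b) (hy b)
    · refine homog_induction K (fun x y hx hy => ?_) (fun j b hb => hD i j a ha b hb)
      rw [map_add, map_add]; exact hadd _ _ hx hy
  · rw [inP_eq, ← neg_one_smul K]
    exact hsmul _ _ (hQ' _)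
  · exact hQ' a

theorem inJ_mem (a : J) : inJ K J a ∈ tkkSubmodule K J :=
  Submodule.subset_span (.inl (.inl (.inl (.inl ⟨a, rfl⟩))))

theorem inL_mem (a : J) : inL K J a ∈ tkkSubmodule K J :=
  Submodule.subset_span (.inl (.inl (.inl (.inr ⟨a, rfl⟩))))

theorem inD_mem (a b : J) : ambientBr K J (inL K J a) (inL K J b) ∈ tkkSubmodule K J :=
  Submodule.subset_span (.inl (.inl (.inr ⟨a, b, rfl⟩)))

theorem inP_mem : inP K J ∈ tkkSubmodule K J :=
  Submodule.subset_span (.inl (.inr rfl))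

theorem inQ_mem (a : J) : inQ K a ∈ tkkSubmodule K J :=
  Submodule.subset_span (.inr ⟨a, rfl⟩)

theorem exists_inQ {X : Ambient K J} (hX : X ∈ tkkSubmodule K J) :
    ∃ a : J, X.2.2 = (inQ K a).2.2 := by
  refine tkk_induction (p := fun X => ∃ a : J, X.2.2 = (inQ K a).2.2) ⟨0, by simp⟩ ?_ ?_ ?_ ?_ ?_ ?_
    hX
  · rintro X Y ⟨a, ha⟩ ⟨b, hb⟩
    exact ⟨a + b, by simp [ha, hb]⟩
  · rintro c X ⟨a, ha⟩
    exact ⟨c • a, by simp [ha]⟩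
  · exact fun i a ha => ⟨0, by simp [inJ]⟩
  · exact fun i a ha => ⟨0, by simp [inL]⟩
  · exact fun i j a ha b hb => ⟨0, by simp [inD_trd ha hb]⟩
  · exact fun i a ha => ⟨a, rfl⟩

theorem exists_inQ_homog {X : Ambient K J} (hX : X ∈ tkkSubmodule K J) {i : ZMod 2}
    (hi : X ∈ gr K (V := Ambient K J) i) : ∃ a ∈ gr K (V := J) i, X.2.2 = (inQ K a).2.2 := by
  obtain ⟨a, ha⟩ := exists_inQ hX
  obtain ⟨y, hy, z, hz, rfl⟩ := exists_homog K a
  rw [map_add, Prod.snd_add, Prod.snd_add] at ha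
  have hX2 : X.2.2 ∈ gr K (V := J →ₗ[K] J →ₗ[K] J) i := hi.2.2
  have hy2 := (inQ_mem_gr hy).2.2
  have hz2 := (inQ_mem_gr hz).2.2
  rcases zmod2_cases i with rfl | rfl
  · refine ⟨y, hy, ?_⟩
    have : (inQ K z).2.2 = 0 := by
      refine eq_zero_of_even_odd K ?_ hz2
      rw [← sub_eq_iff_eq_add'] at ha
      rw [← ha]
      exact sub_mem hX2 hy2
    rw [ha, this, add_zero]
  · refine ⟨z, hz, ?_⟩
    have : (inQ K y).2.2 = 0 := by
      refine eq_zero_of_even_odd K hy2 ?_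
      rw [← sub_eq_iff_eq_add] at ha
      rw [← ha]
      exact sub_mem hX2 hz2
    rw [ha, this, zero_add]

theorem tkk_symm {X : Ambient K J} (hX : X ∈ tkkSubmodule K J) : SuperSymm X.2.2 := by
  obtain ⟨a, ha⟩ := exists_inQ hX
  rw [ha]; exact inQ_symm a

theorem tkk_compatible {X Y : Ambient K J} (hX : X ∈ tkkSubmodule K J)
    (hY : Y ∈ tkkSubmodule K J) {i j : ZMod 2} (hi : X ∈ gr K (V := Ambient K J) i)
    (hj : Y ∈ gr K (V := Ambient K J) j) : Compatible X.2.2 Y.2.2 i j := by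
  obtain ⟨a, ha, ea⟩ := exists_inQ_homog hX hi
  obtain ⟨b, hb, eb⟩ := exists_inQ_homog hY hj
  rw [ea, eb]
  exact inQ_compatible ha hb

theorem br_mem_of_swap {X Y : Ambient K J} {i j : ZMod 2} (hX : X ∈ gr K (V := Ambient K J) i)
    (hY : Y ∈ gr K (V := Ambient K J) j) (h : ambientBr K J Y X ∈ tkkSubmodule K J) :
    ambientBr K J X Y ∈ tkkSubmodule K J := by
  rw [ambientBr_skew hX hY]
  exact neg_mem (Submodule.smul_mem _ _ h)

theorem br_inL_mem {i : ZMod 2} {a : J} (ha : a ∈ gr K (V := J) i) {Y : Ambient K J}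
    (hY : Y ∈ tkkSubmodule K J) : ambientBr K J (inL K J a) Y ∈ tkkSubmodule K J := by
  refine tkk_induction (p := fun Y => ambientBr K J (inL K J a) Y ∈ tkkSubmodule K J) ?_ ?_ ?_ ?_ ?_
    ?_ ?_ hY
  · simp
  · intro X Y hX hY; rw [map_add]; exact add_mem hX hY
  · intro c X hX; rw [map_smul]; exact Submodule.smul_mem _ _ hX
  · intro j b hb; rw [br_inL_inJ]; exact inJ_mem _
  · intro j b hb; exact inD_mem _ _
  · intro j k b hb c hc
    refine br_mem_of_swap (inL_mem_gr ha) (ambientBr_mem (inL_mem_gr hb) (inL_mem_gr hc)) ?_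
    rw [br_inD_inL hb hc ha]; exact inL_mem _
  · intro j b hb; rw [br_inL_inQ hb ha]; exact neg_mem (inQ_mem _)

theorem br_inD_mem {i j : ZMod 2} {a b : J} (ha : a ∈ gr K (V := J) i)
    (hb : b ∈ gr K (V := J) j) {k : ZMod 2} {Y : Ambient K J} (hY : Y ∈ tkkSubmodule K J)
    (hk : Y ∈ gr K (V := Ambient K J) k) :
    ambientBr K J (ambientBr K J (inL K J a) (inL K J b)) Y ∈ tkkSubmodule K J := by
  have h := zero_trd_jacobi (inL_mem_gr ha) (inL_mem_gr hb) hk rfl rfl (tkk_symm hY)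
  rw [← sub_eq_iff_eq_add] at h
  rw [← h]
  exact sub_mem (br_inL_mem ha (br_inL_mem hb hY))
    (Submodule.smul_mem _ _ (br_inL_mem hb (br_inL_mem ha hY)))

theorem br_mem {X Y : Ambient K J} (hX : X ∈ tkkSubmodule K J) (hY : Y ∈ tkkSubmodule K J) :
    ambientBr K J X Y ∈ tkkSubmodule K J := by
  suffices h : ∀ Y ∈ tkkSubmodule K J, ambientBr K J X Y ∈ tkkSubmodule K J from h Y hY
  refine tkk_induction (p := fun X => ∀ Y ∈ tkkSubmodule K J, ambientBr K J X Y ∈ tkkSubmodule K J)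
    ?_ ?_ ?_ ?_ ?_ ?_ ?_ hX
  · intro Y hY; simp
  · intro X X' hX hX' Y hY
    rw [map_add, LinearMap.add_apply]; exact add_mem (hX Y hY) (hX' Y hY)
  · intro c X hX Y hY
    rw [map_smul, LinearMap.smul_apply]; exact Submodule.smul_mem _ _ (hX Y hY)
  · intro i a ha Y hY
    refine tkk_induction (p := fun Y => ambientBr K J (inJ K J a) Y ∈ tkkSubmodule K J) ?_ ?_ ?_ ?_
      ?_ ?_ ?_ hY
    · simp
    · intro X Y hX hY; rw [map_add]; exact add_mem hX hY
    · intro c X hX; rw [map_smul]; exact Submodule.smul_mem _ _ hX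
    · intro j b hb; rw [br_inJ_inJ]; exact zero_mem _
    · intro j b hb
      exact br_mem_of_swap (inJ_mem_gr ha) (inL_mem_gr hb) (br_inL_mem hb (inJ_mem _))
    · intro j k b hb c hc
      exact br_mem_of_swap (inJ_mem_gr ha) (ambientBr_mem (inL_mem_gr hb) (inL_mem_gr hc))
        (br_inD_mem hb hc (inJ_mem _) (inJ_mem_gr ha))
    · intro j b hb
      refine br_mem_of_swap (inJ_mem_gr ha) (inQ_mem_gr hb) ?_
      rw [br_inQ_inJ hb ha]
      exact sub_mem (inD_mem _ _) (inL_mem _)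
  · exact fun i a ha Y hY => br_inL_mem ha hY
  · intro i j a ha b hb Y hY
    refine tkk_induction (p := fun Y => ambientBr K J (ambientBr K J (inL K J a) (inL K J b)) Y ∈
      tkkSubmodule K J) ?_ ?_ ?_ ?_ ?_ ?_ ?_ hY
    · simp
    · intro X Y hX hY; rw [map_add]; exact add_mem hX hY
    · intro c X hX; rw [map_smul]; exact Submodule.smul_mem _ _ hX
    · exact fun k c hc => br_inD_mem ha hb (inJ_mem _) (inJ_mem_gr hc)
    · exact fun k c hc => br_inD_mem ha hb (inL_mem _) (inL_mem_gr hc)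
    · exact fun k l c hc d hd => br_inD_mem ha hb (inD_mem _ _)
        (ambientBr_mem (inL_mem_gr hc) (inL_mem_gr hd))
    · exact fun k c hc => br_inD_mem ha hb (inQ_mem _) (inQ_mem_gr hc)
  · intro i a ha Y hY
    refine tkk_induction (p := fun Y => ambientBr K J (inQ K a) Y ∈ tkkSubmodule K J) ?_ ?_ ?_ ?_
      ?_ ?_ ?_ hY
    · simp
    · intro X Y hX hY; rw [map_add]; exact add_mem hX hY
    · intro c X hX; rw [map_smul]; exact Submodule.smul_mem _ _ hX
    · intro j b hb; rw [br_inQ_inJ ha hb]; exact sub_mem (inD_mem _ _) (inL_mem _)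
    · intro j b hb
      exact br_mem_of_swap (inQ_mem_gr ha) (inL_mem_gr hb) (br_inL_mem hb (inQ_mem _))
    · intro j k b hb c hc
      exact br_mem_of_swap (inQ_mem_gr ha) (ambientBr_mem (inL_mem_gr hb) (inL_mem_gr hc))
        (br_inD_mem hb hc (inQ_mem _) (inQ_mem_gr ha))
    · intro j b hb; rw [br_inQ_inQ]; exact zero_mem _

theorem oddProj_tkk {X : Ambient K J} (hX : X ∈ tkkSubmodule K J) :
    oddProj K X ∈ tkkSubmodule K J := by
  have key : ∀ (i : ZMod 2) (X : Ambient K J), X ∈ tkkSubmodule K J →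
      X ∈ gr K (V := Ambient K J) i → oddProj K X ∈ tkkSubmodule K J := by
    intro i X hX hi
    rcases zmod2_cases i with rfl | rfl
    · rw [oddProj_of_even K hi]; exact zero_mem _
    · rw [oddProj_of_odd K hi]; exact hX
  refine tkk_induction (p := fun X => oddProj K X ∈ tkkSubmodule K J) ?_ ?_ ?_ ?_ ?_ ?_ ?_ hX
  · simp
  · intro X Y hX hY; rw [map_add]; exact add_mem hX hY
  · intro c X hX; rw [map_smul]; exact Submodule.smul_mem _ _ hX
  · exact fun i a ha => key i _ (inJ_mem _) (inJ_mem_gr ha)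
  · exact fun i a ha => key i _ (inL_mem _) (inL_mem_gr ha)
  · exact fun i j a ha b hb => key _ _ (inD_mem _ _) (ambientBr_mem (inL_mem_gr ha) (inL_mem_gr hb))
  · exact fun i a ha => key i _ (inQ_mem _) (inQ_mem_gr ha)

variable (K J)

/-- The Tits-Kantor-Koecher superalgebra `Lie(J)`. -/
def TKK : Type u := tkkSubmodule K J

noncomputable instance : AddCommGroup (TKK K J) := inferInstanceAs (AddCommGroup (tkkSubmodule K J))

noncomputable instance : Module K (TKK K J) := inferInstanceAs (Module K (tkkSubmodule K J))

noncomputable instance : SuperSpace K (TKK K J) :=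
  SuperSpace.ofSubmodule K (tkkSubmodule K J) fun _ hX => oddProj_tkk hX

/-- `Lie(J)` is a Lie superalgebra under the bracket of the ambient space. -/
noncomputable instance : LieSuperalgebra K (TKK K J) where
  bracket := LinearMap.mk₂ K (M := tkkSubmodule K J) (Nₗ := tkkSubmodule K J)
    (Pₗ := tkkSubmodule K J) (fun X Y => ⟨ambientBr K J X Y, br_mem X.2 Y.2⟩)
    (fun X X' Y => Subtype.ext (by simp)) (fun c X Y => Subtype.ext (by simp))
    (fun X Y Y' => Subtype.ext (by simp)) (fun c X Y => Subtype.ext (by simp))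
  bracket_mem := fun hX hY => ambientBr_mem (K := K) (J := J) hX hY
  skew := fun hX hY => Subtype.ext (ambientBr_skew (K := K) (J := J) hX hY)
  jacobi := fun {i j k X Y Z} hX hY hZ => Subtype.ext
    (ambient_jacobi (K := K) (J := J) hX hY hZ (tkk_symm X.2) (tkk_symm Y.2) (tkk_symm Z.2)
      (tkk_compatible X.2 Y.2 hX hY) (tkk_compatible X.2 Z.2 hX hZ) (tkk_compatible Y.2 Z.2 hY hZ))

variable {K J} in
/-- `J` as the component of degree `1` of `Lie(J)`. -/
noncomputable def tkkX : J →ₗ[K] TKK K J :=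
  (inJ K J).codRestrict (tkkSubmodule K J) inJ_mem

variable {K J} in
/-- The element `L_a` of degree `0` of `Lie(J)`. -/
noncomputable def tkkL : J →ₗ[K] TKK K J :=
  (inL K J).codRestrict (tkkSubmodule K J) inL_mem

/-- The unit `e` in `Lie(J)`. With `h = L_e` and `f = -P` it spans the short subalgebra:
`[e, f] = h`, `[h, e] = e`, `[h, f] = -f`. -/
noncomputable def tkkE : TKK K J := tkkX (K := K) (jone K J)

/-- The element `h = L_e` of `Lie(J)`. -/
noncomputable def tkkH : TKK K J := tkkL (jone K J)

/-- The element `f = -P` of `Lie(J)`. -/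
noncomputable def tkkF : TKK K J := (⟨-inP K J, neg_mem inP_mem⟩ : tkkSubmodule K J)

theorem tkkH_mem_gr : tkkH K J ∈ gr K (V := TKK K J) 0 :=
  inL_mem_gr (UnitalJordanSuperalgebra.one_mem (K := K) (J := J))

theorem tkkF_mem_gr : tkkF K J ∈ gr K (V := TKK K J) 0 :=
  neg_mem (inP_mem_gr (K := K) (J := J))

variable {K J}

theorem tkkX_mem_gr {i : ZMod 2} {a : J} (ha : a ∈ gr K (V := J) i) :
    tkkX (K := K) a ∈ gr K (V := TKK K J) i :=
  inJ_mem_gr (K := K) ha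

theorem tkkH_tkkX (a : J) : sbr K (tkkH K J) (tkkX a) = tkkX (K := K) a :=
  Subtype.ext ((br_inL_inJ (jone K J) a).trans
    (congrArg _ (UnitalJordanSuperalgebra.one_mul (K := K) a)))

theorem tkkH_tkkF : sbr K (tkkH K J) (tkkF K J) = -tkkF K J := by
  refine Subtype.ext ?_
  have h : ambientBr K J (inL K J (jone K J)) (-inP K J) = - -inP K J := by
    rw [map_neg, ← inQ_apply, inP_eq, neg_neg]
  exact h

/-- In `Lie(J)` we have `[a, f] = L_a`. -/
theorem tkkX_tkkF (a : J) : sbr K (tkkX a) (tkkF K J) = tkkL a := by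
  refine Subtype.ext ?_
  have h : ambientBr K J (inJ K J a) (-inP K J) = inL K J a := by
    refine homog_induction K (p := fun a => ambientBr K J (inJ K J a) (-inP K J) = inL K J a)
      (fun x y hx hy => by rw [map_add, map_add, LinearMap.add_apply, hx, hy, map_add]) (fun i a ha => ?_) a
    rw [map_neg, ambientBr_skew (inJ_mem_gr ha) inP_mem_gr, br_inP_inJ, sgn_zero_right, one_smul,
      neg_neg]
  exact h

theorem tkkE_tkkF : sbr K (tkkE K J) (tkkF K J) = tkkH K J := tkkX_tkkF _

theorem tkkL_tkkX (a b : J) : sbr K (tkkL a) (tkkX (K := K) b) =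
    tkkX (jmul K a b) := Subtype.ext (br_inL_inJ a b)

end TKKLie

/-! ### Central extensions -/

section Central

variable {K : Type v} [Field K]

/-- An (even) homomorphism of Lie superalgebras. -/
structure IsLieHom {L L' : Type u} [AddCommGroup L] [Module K L] [SuperSpace K L]
    [LieSuperalgebra K L] [AddCommGroup L'] [Module K L'] [SuperSpace K L'] [LieSuperalgebra K L']
    (φ : L →ₗ[K] L') : Prop where
  even : ∀ i, ∀ x ∈ gr K (V := L) i, φ x ∈ gr K (V := L') i
  map_bracket : ∀ x y, φ (sbr K x y) = sbr K (φ x) (φ y)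

/-- A central extension of Lie superalgebras: a surjective homomorphism with central kernel. -/
structure IsCentralExtension {E L : Type u} [AddCommGroup E] [Module K E] [SuperSpace K E]
    [LieSuperalgebra K E] [AddCommGroup L] [Module K L] [SuperSpace K L] [LieSuperalgebra K L]
    (π : E →ₗ[K] L) : Prop extends IsLieHom π where
  surjective : Function.Surjective π
  central : ∀ z, π z = 0 → ∀ x, sbr K z x = 0

/-- A universal central extension: it maps uniquely to every central extension of `L`. -/
structure IsUniversalCentralExtension {E L : Type u} [AddCommGroup E] [Module K E]
    [SuperSpace K E] [LieSuperalgebra K E] [AddCommGroup L] [Module K L] [SuperSpace K L]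
    [LieSuperalgebra K L] (π : E →ₗ[K] L) : Prop extends IsCentralExtension π where
  universal : ∀ (E' : Type u) [AddCommGroup E'] [Module K E'] [SuperSpace K E']
    [LieSuperalgebra K E'] (π' : E' →ₗ[K] L), IsCentralExtension π' →
    ∃! φ : E →ₗ[K] E', IsLieHom φ ∧ π' ∘ₗ φ = π

section LieLemmas

variable {L : Type u} [AddCommGroup L] [Module K L] [SuperSpace K L] [LieSuperalgebra K L]

theorem sbr_mem {i j : ZMod 2} {x y : L} (hx : x ∈ gr K (V := L) i) (hy : y ∈ gr K (V := L) j) :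
    sbr K x y ∈ gr K (V := L) (i + j) := LieSuperalgebra.bracket_mem hx hy

theorem sbr_skew {i j : ZMod 2} {x y : L} (hx : x ∈ gr K (V := L) i)
    (hy : y ∈ gr K (V := L) j) : sbr K x y = -(sgn K i j • sbr K y x) :=
  LieSuperalgebra.skew hx hy

theorem sbr_jacobi {i j k : ZMod 2} {x y z : L} (hx : x ∈ gr K (V := L) i)
    (hy : y ∈ gr K (V := L) j) (hz : z ∈ gr K (V := L) k) :
    sbr K x (sbr K y z) = sbr K (sbr K x y) z + sgn K i j • sbr K y (sbr K x z) :=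
  LieSuperalgebra.jacobi hx hy hz

end LieLemmas

variable {E L : Type u} [AddCommGroup E] [Module K E] [SuperSpace K E]
    [LieSuperalgebra K E] [AddCommGroup L] [Module K L] [SuperSpace K L] [LieSuperalgebra K L]
    {π : E →ₗ[K] L}

/-- In a central extension, the bracket `[x̃, ỹ]` of arbitrary lifts `x̃, ỹ` of `x, y` (which does
not depend on the lifts). -/
noncomputable def liftBr (hπ : IsCentralExtension π) : L →ₗ[K] L →ₗ[K] E :=
  let s := (π.exists_rightInverse_of_surjective (LinearMap.range_eq_top.2 hπ.surjective)).choose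
  (sbr K).compl₁₂ s s

theorem IsCentralExtension.central_right (hπ : IsCentralExtension π) {z : E} (hz : π z = 0) (x : E) :
    sbr K x z = 0 := by
  have h0 : ∀ i, ∀ x ∈ gr K (V := E) i, ∀ j, ∀ z ∈ gr K (V := E) j, π z = 0 → sbr K x z = 0 := by
    intro i x hx j z hz h
    rw [sbr_skew hx hz, hπ.central z h x, smul_zero, neg_zero]
  obtain ⟨y, hy, w, hw, rfl⟩ := exists_homog K x
  obtain ⟨z0, hz0, z1, hz1, rfl⟩ := exists_homog K z
  have e1 := hπ.even 0 z0 hz0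
  have e2 := hπ.even 1 z1 hz1
  rw [map_add] at hz
  have e3 : π z0 = 0 := by
    refine eq_zero_of_even_odd K e1 ?_
    rw [eq_neg_of_add_eq_zero_left hz]; exact neg_mem e2
  have e4 : π z1 = 0 := by rwa [e3, zero_add] at hz
  simp [h0 _ y hy _ z0 hz0 e3, h0 _ y hy _ z1 hz1 e4, h0 _ w hw _ z0 hz0 e3, h0 _ w hw _ z1 hz1 e4]

theorem sbr_eq_liftBr (hπ : IsCentralExtension π) (x y : E) :
    sbr K x y = liftBr hπ (π x) (π y) := by
  have hs := (π.exists_rightInverse_of_surjective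
    (LinearMap.range_eq_top.2 hπ.surjective)).choose_spec
  have hs' : ∀ t, π ((π.exists_rightInverse_of_surjective
    (LinearMap.range_eq_top.2 hπ.surjective)).choose t) = t := fun t => LinearMap.congr_fun hs t
  simp only [liftBr, LinearMap.compl₁₂_apply]
  set s := (π.exists_rightInverse_of_surjective
    (LinearMap.range_eq_top.2 hπ.surjective)).choose
  have h1 := hπ.central (x - s (π x)) (by rw [map_sub, hs', sub_self]) y
  have h2 := hπ.central_right (z := y - s (π y)) (by rw [map_sub, hs', sub_self]) (s (π x))
  rw [map_sub, LinearMap.sub_apply, sub_eq_zero] at h1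
  rw [map_sub, sub_eq_zero] at h2
  rw [h1, h2]

theorem map_liftBr (hπ : IsCentralExtension π) (x y : L) :
    π (liftBr hπ x y) = sbr K x y := by
  obtain ⟨x, rfl⟩ := hπ.surjective x
  obtain ⟨y, rfl⟩ := hπ.surjective y
  rw [← sbr_eq_liftBr, hπ.map_bracket]

theorem IsCentralExtension.exists_lift (hπ : IsCentralExtension π) {i : ZMod 2} {x : L}
    (hx : x ∈ gr K (V := L) i) : ∃ y ∈ gr K (V := E) i, π y = x := by
  obtain ⟨y, rfl⟩ := hπ.surjective x
  obtain ⟨y0, h0, y1, h1, rfl⟩ := exists_homog K y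
  have e0 := hπ.even 0 y0 h0
  have e1 := hπ.even 1 y1 h1
  rw [map_add] at hx ⊢
  rcases zmod2_cases i with rfl | rfl
  · refine ⟨y0, h0, ?_⟩
    have : π y1 = 0 := eq_zero_of_even_odd K (by simpa using sub_mem hx e0) e1
    rw [this, add_zero]
  · refine ⟨y1, h1, ?_⟩
    have : π y0 = 0 := eq_zero_of_even_odd K e0 (by simpa using sub_mem hx e1)
    rw [this, zero_add]

theorem liftBr_mem (hπ : IsCentralExtension π) {i j : ZMod 2} {x y : L}
    (hx : x ∈ gr K (V := L) i) (hy : y ∈ gr K (V := L) j) :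
    liftBr hπ x y ∈ gr K (V := E) (i + j) := by
  obtain ⟨x', hx', rfl⟩ := hπ.exists_lift hx
  obtain ⟨y', hy', rfl⟩ := hπ.exists_lift hy
  rw [← sbr_eq_liftBr]
  exact sbr_mem hx' hy'

end Central

section Lifts

variable {K : Type v} [Field K] {J : Type u} [AddCommGroup J] [Module K J] [SuperSpace K J]
  [UnitalJordanSuperalgebra K J] {E : Type u} [AddCommGroup E] [Module K E] [SuperSpace K E]
  [LieSuperalgebra K E] {π : E →ₗ[K] TKK K J} (hπ : IsCentralExtension π)

/-- The lift to the central extension `E` of the element `a ∈ J = Lie(J)[1]` that lies in the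
component `E[1]`, namely `[h̃, ã]` for arbitrary lifts `h̃, ã` of `h, a`. -/
noncomputable def hatX : J →ₗ[K] E :=
  liftBr hπ (tkkH K J) ∘ₗ tkkX

/-- The lift of `e` in degree `1`. With the lifts `ĥ`, `f̂` of `h`, `f` below it spans the lift of
the short subalgebra: `[ê, f̂] = ĥ`, `[ĥ, ê] = ê`, `[ĥ, f̂] = -f̂`. -/
noncomputable def hatE : E := hatX hπ (jone K J)

/-- The lift of `f` in degree `-1`. -/
noncomputable def hatF : E := -liftBr hπ (tkkH K J) (tkkF K J)

/-- The lift `[ê, f̂]` of `h`. -/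
noncomputable def hatH : E := sbr K (hatE hπ) (hatF hπ)

theorem hatX_apply (a : J) : hatX hπ a = liftBr hπ (tkkH K J) (tkkX a) := rfl

theorem map_hatX (a : J) : π (hatX hπ a) = tkkX a := by
  rw [hatX_apply, map_liftBr, tkkH_tkkX]

theorem map_hatF : π (hatF hπ) = tkkF K J := by
  rw [hatF, map_neg, map_liftBr, tkkH_tkkF, neg_neg]

theorem map_hatH : π (hatH hπ) = tkkH K J := by
  rw [hatH, hπ.map_bracket, hatE, map_hatX, map_hatF]
  exact tkkE_tkkF

theorem hatX_mem_gr {i : ZMod 2} {a : J} (ha : a ∈ gr K (V := J) i) :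
    hatX hπ a ∈ gr K (V := E) i := by
  have := liftBr_mem hπ (tkkH_mem_gr K J) (tkkX_mem_gr (K := K) ha)
  rwa [zero_add] at this

theorem hatF_mem_gr : hatF hπ ∈ gr K (V := E) 0 := by
  have := liftBr_mem hπ (tkkH_mem_gr K J) (tkkF_mem_gr K J)
  rw [zero_add] at this
  exact neg_mem this

theorem hatH_mem_gr : hatH hπ ∈ gr K (V := E) 0 := by
  have := sbr_mem (hatX_mem_gr hπ (UnitalJordanSuperalgebra.one_mem (K := K) (J := J)))
    (hatF_mem_gr hπ)
  rwa [zero_add] at this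

theorem hatH_hatX (a : J) : sbr K (hatH hπ) (hatX hπ a) = hatX hπ a := by
  rw [sbr_eq_liftBr hπ, map_hatH, map_hatX, ← hatX_apply]

theorem hatH_hatF : sbr K (hatH hπ) (hatF hπ) = -hatF hπ := by
  rw [sbr_eq_liftBr hπ, map_hatH, map_hatF, hatF, neg_neg]

/-- The element `[â, f̂]` of degree `0`, a lift of `L_a`. -/
noncomputable def hatL : J →ₗ[K] E := (sbr K).flip (hatF hπ) ∘ₗ hatX hπ

theorem hatL_apply (a : J) : hatL hπ a = sbr K (hatX hπ a) (hatF hπ) := rfl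

theorem map_hatL (a : J) : π (hatL hπ a) = tkkL a := by
  rw [hatL_apply, hπ.map_bracket, map_hatX, map_hatF, tkkX_tkkF]

theorem hatL_mem_gr {i : ZMod 2} {a : J} (ha : a ∈ gr K (V := J) i) :
    hatL hπ a ∈ gr K (V := E) i := by
  have := sbr_mem (hatX_mem_gr hπ ha) (hatF_mem_gr hπ)
  rwa [add_zero] at this

theorem hatH_hatL (a : J) : sbr K (hatH hπ) (hatL hπ a) = 0 := by
  refine homog_induction K (p := fun a => sbr K (hatH hπ) (hatL hπ a) = 0)
    (fun x y hx hy => by rw [map_add, map_add, hx, hy, add_zero]) (fun i a ha => ?_) a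
  rw [hatL_apply, sbr_jacobi (hatH_mem_gr hπ) (hatX_mem_gr hπ ha) (hatF_mem_gr hπ), hatH_hatX,
    hatH_hatF, sgn_zero_left, one_smul, map_neg, add_neg_cancel]

theorem hatL_hatX (a b : J) : sbr K (hatL hπ a) (hatX hπ b) = hatX hπ (jmul K a b) := by
  revert b
  refine homog_induction K (p := fun a => ∀ b, sbr K (hatL hπ a) (hatX hπ b) =
    hatX hπ (jmul K a b)) (fun x y hx hy b => by simp [hx, hy]) (fun i a ha => ?_) a
  refine homog_induction K (fun x y hx hy => by simp [hx, hy]) (fun j b hb => ?_)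
  have h1 := sbr_jacobi (hatH_mem_gr hπ) (hatL_mem_gr hπ ha) (hatX_mem_gr hπ hb)
  rw [hatH_hatL, hatH_hatX, sgn_zero_left, one_smul, map_zero, LinearMap.zero_apply, zero_add] at h1
  rw [← h1, sbr_eq_liftBr hπ, map_hatH, hπ.map_bracket, map_hatL, map_hatX, tkkL_tkkX, hatX_apply]

end Lifts

/-! ### Special modules over a unital Jordan superalgebra -/

section SpecialModules

variable {K : Type v} [Field K] {J : Type u} [AddCommGroup J] [Module K J] [SuperSpace K J]
  [UnitalJordanSuperalgebra K J]

/-- The product of the null split extension `J ⊕ M` defined by an action `β` of `J` on `M`: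
`a · v = β a v`, `v · b = (-1)^{|v||b|} β b v` and `v · w = 0` for `a, b ∈ J`, `v, w ∈ M`. -/
noncomputable def nullSplitMul {M : Type u} [AddCommGroup M] [Module K M] [SuperSpace K M]
    (β : J →ₗ[K] M →ₗ[K] M) : (J × M) →ₗ[K] (J × M) →ₗ[K] (J × M) :=
  LinearMap.mk₂ K (fun x y => (jmul K x.1 y.1, β x.1 y.2 + sflip β x.2 y.1))
    (fun x x' y => Prod.ext (by simp) (by simp; abel))
    (fun c x y => Prod.ext (by simp) (by simp))
    (fun x y y' => Prod.ext (by simp) (by simp; abel))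
    (fun c x y => Prod.ext (by simp) (by simp))

variable (K J)

/-- The objects of the category `J-mod_{1/2}`: finite-dimensional Jordan bimodules (i.e. the null
split extension is a Jordan superalgebra) on which the unit acts by `1/2`. -/
structure SpecialModule where
  carrier : Type u
  [addCommGroup : AddCommGroup carrier]
  [module : Module K carrier]
  [superSpace : SuperSpace K carrier]
  [finiteDimensional : FiniteDimensional K carrier]
  act : J →ₗ[K] carrier →ₗ[K] carrier
  isBimodule : IsJordanProduct (nullSplitMul act)
  act_one : ∀ m, act (jone K J) m = (1 / 2 : K) • m

attribute [instance] SpecialModule.addCommGroup SpecialModule.module SpecialModule.superSpace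
  SpecialModule.finiteDimensional

variable {K J}

/-- Morphisms of special modules: even linear maps commuting with the action. -/
@[ext]
structure SpecialModule.Hom (M N : SpecialModule K J) where
  toLin : M.carrier →ₗ[K] N.carrier
  even : ∀ i, ∀ m ∈ gr K (V := M.carrier) i, toLin m ∈ gr K (V := N.carrier) i
  map_act : ∀ a m, toLin (M.act a m) = N.act a (toLin m)

instance : Category (SpecialModule K J) where
  Hom := SpecialModule.Hom
  id M := ⟨LinearMap.id, fun _ _ h => h, fun _ _ => rfl⟩
  comp f g := ⟨g.toLin ∘ₗ f.toLin, fun i m h => g.even i _ (f.even i m h),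
    fun a m => by simp [f.map_act, g.map_act]⟩

/-- A criterion for a Jordan bimodule. -/
theorem isJordanProduct_nullSplitMul {M : Type u} [AddCommGroup M] [Module K M] [SuperSpace K M]
    (β : J →ₗ[K] M →ₗ[K] M)
    (heven : ∀ i j, ∀ a ∈ gr K (V := J) i, ∀ m ∈ gr K (V := M) j, β a m ∈ gr K (V := M) (i + j))
    (h : ∀ i j, ∀ a ∈ gr K (V := J) i, ∀ b ∈ gr K (V := J) j, ∀ m,
      β (jmul K a b) m = β a (β b m) + sgn K i j • β b (β a m)) :
    IsJordanProduct (nullSplitMul β) := by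
  have hm : ∀ {i j : ZMod 2} {x y : J × M}, x ∈ gr K (V := J × M) i → y ∈ gr K (V := J × M) j →
      nullSplitMul β x y = (jmul K x.1 y.1, β x.1 y.2 + sgn K i j • β y.1 x.2) := by
    intro i j x y hx hy
    have : nullSplitMul β x y = (jmul K x.1 y.1, β x.1 y.2 + sflip β x.2 y.1) := rfl
    rw [this, sflip_apply β hy.1 hx.2, sgn_comm]
  have hmem : ∀ {i j : ZMod 2} {x y : J × M}, x ∈ gr K (V := J × M) i →
      y ∈ gr K (V := J × M) j → nullSplitMul β x y ∈ gr K (V := J × M) (i + j) := by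
    intro i j x y hx hy
    rw [hm hx hy]
    refine ⟨jmul_mem hx.1 hy.1, add_mem (heven _ _ _ hx.1 _ hy.2) (Submodule.smul_mem _ _ ?_)⟩
    rw [add_comm]
    exact heven _ _ _ hy.1 _ hx.2
  refine ⟨hmem, ?_, ?_⟩
  · intro i j x y hx hy
    rw [hm hx hy, hm hy hx]
    refine Prod.ext (jmul_comm hx.1 hy.1) ?_
    simp only [Prod.smul_snd, smul_add, smul_smul]
    rw [sgn_comm j i, sgn_mul_self, one_smul, add_comm]
  · intro i j k l a b c d ha hb hc hd
    rw [hm (hmem (hmem ha hb) hc) hd, hm (hmem ha hb) hc, hm (hmem (hmem ha hd) hc) hb,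
      hm (hmem ha hd) hc, hm (hmem (hmem hb hd) hc) ha, hm (hmem hb hd) hc,
      hm (hmem ha hb) (hmem hc hd), hm (hmem ha hc) (hmem hb hd), hm (hmem ha hd) (hmem hb hc),
      hm ha hb, hm ha hc, hm ha hd, hm hb hc, hm hb hd, hm hc hd]
    obtain ⟨a, a'⟩ := a
    obtain ⟨b, b'⟩ := b
    obtain ⟨c, c'⟩ := c
    obtain ⟨d, d'⟩ := d
    replace ha := ha.1
    replace hb := hb.1
    replace hc := hc.1
    replace hd := hd.1
    dsimp only at ha hb hc hd
    refine Prod.ext (jordan_left ha hb hc hd) ?_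
    simp only [Prod.snd_add, Prod.smul_snd]
    simp only [h _ _ _ (jmul_mem ha hb) _ hc, h _ _ _ (jmul_mem ha hd) _ hc,
      h _ _ _ (jmul_mem hb hd) _ hc, h _ _ _ ha _ hb, h _ _ _ ha _ hc, h _ _ _ ha _ hd,
      h _ _ _ hb _ hc, h _ _ _ hb _ hd, h _ _ _ hc _ hd, map_add, map_smul]
    clear h hm hmem heven
    rcases zmod2_cases i with rfl | rfl <;> rcases zmod2_cases j with rfl | rfl <;>
    rcases zmod2_cases k with rfl | rfl <;> rcases zmod2_cases l with rfl | rfl <;>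
    simp only [sgn_zero_left, sgn_zero_right, sgn_one_one, zmod2_one_add_one, add_zero, zero_add,
      one_smul, neg_smul, mul_one, mul_neg, neg_neg] <;>
    abel

end SpecialModules

/-! ### Modules with a very short grading and the functor `Jor` -/

section VeryShort

variable {K : Type v} [Field K] {J : Type u} [AddCommGroup J] [Module K J] [SuperSpace K J]
  [UnitalJordanSuperalgebra K J] {E : Type u} [AddCommGroup E] [Module K E] [SuperSpace K E]
  [LieSuperalgebra K E] {π : E →ₗ[K] TKK K J}

/-- The objects of the category of finite-dimensional modules with a very short grading over a
central extension `E` of `Lie(J)`: the operator `h` acts semisimply with eigenvalues `±1/2`. -/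
structure VeryShortModule (hπ : IsCentralExtension π) where
  carrier : Type u
  [addCommGroup : AddCommGroup carrier]
  [module : Module K carrier]
  [superSpace : SuperSpace K carrier]
  [finiteDimensional : FiniteDimensional K carrier]
  act : E →ₗ[K] Module.End K carrier
  act_mem : ∀ {i j : ZMod 2} {x : E} {m : carrier}, x ∈ gr K (V := E) i →
    m ∈ gr K (V := carrier) j → act x m ∈ gr K (V := carrier) (i + j)
  act_bracket : ∀ {i j : ZMod 2} {x y : E}, x ∈ gr K (V := E) i → y ∈ gr K (V := E) j →
    ∀ m, act (sbr K x y) m = act x (act y m) - sgn K i j • act y (act x m)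
  veryShort : Module.End.eigenspace (act (hatH hπ)) (1 / 2) ⊔
    Module.End.eigenspace (act (hatH hπ)) (-(1 / 2)) = ⊤

attribute [instance] VeryShortModule.addCommGroup VeryShortModule.module
  VeryShortModule.superSpace VeryShortModule.finiteDimensional

variable {hπ : IsCentralExtension π}

/-- Morphisms of modules: even linear maps commuting with the action. -/
@[ext]
structure VeryShortModule.Hom (V W : VeryShortModule hπ) where
  toLin : V.carrier →ₗ[K] W.carrier
  even : ∀ i, ∀ m ∈ gr K (V := V.carrier) i, toLin m ∈ gr K (V := W.carrier) i
  map_act : ∀ x m, toLin (V.act x m) = W.act x (toLin m)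

instance : Category (VeryShortModule hπ) where
  Hom := VeryShortModule.Hom
  id V := ⟨LinearMap.id, fun _ _ h => h, fun _ _ => rfl⟩
  comp f g := ⟨g.toLin ∘ₗ f.toLin, fun i m h => g.even i _ (f.even i m h),
    fun a m => by simp [f.map_act, g.map_act]⟩

namespace VeryShortModule

variable (V : VeryShortModule hπ)

/-- The component `V[1/2]`. -/
noncomputable def half : Submodule K V.carrier := Module.End.eigenspace (V.act (hatH hπ)) (1 / 2)

variable {V}

theorem mem_half {m : V.carrier} : m ∈ V.half ↔ V.act (hatH hπ) m = (1 / 2 : K) • m :=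
  Module.End.mem_eigenspace_iff

theorem oddProj_half {m : V.carrier} (hm : m ∈ V.half) : oddProj K m ∈ V.half := by
  have key : oddProj K ∘ₗ V.act (hatH hπ) = V.act (hatH hπ) ∘ₗ oddProj K := by
    refine ext_homog K fun i x hx => ?_
    have h := V.act_mem (hatH_mem_gr hπ) hx
    rw [zero_add] at h
    rcases zmod2_cases i with rfl | rfl
    · simp [oddProj_of_even K hx, oddProj_of_even K h]
    · simp [oddProj_of_odd K hx, oddProj_of_odd K h]
  have h2 := LinearMap.congr_fun key m
  simp only [LinearMap.comp_apply, mem_half.1 hm, map_smul] at h2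
  exact mem_half.2 h2.symm

noncomputable instance : SuperSpace K V.half := SuperSpace.ofSubmodule K V.half fun _ h => oddProj_half h

theorem act_bracket_even {x y : E} (hx : x ∈ gr K (V := E) 0) (m : V.carrier) :
    V.act (sbr K x y) m = V.act x (V.act y m) - V.act y (V.act x m) := by
  refine homog_induction K (p := fun y => V.act (sbr K x y) m =
    V.act x (V.act y m) - V.act y (V.act x m)) (fun y z hy hz => ?_) (fun i y hy => ?_) y
  · simp only [map_add, LinearMap.add_apply, hy, hz]; abel
  · rw [V.act_bracket hx hy, sgn_zero_left, one_smul]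

theorem act_hatL_mem (a : J) {m : V.carrier} (hm : m ∈ V.half) :
    V.act (hatL hπ a) m ∈ V.half := by
  have h := act_bracket_even (V := V) (hatH_mem_gr hπ) (y := hatL hπ a) m
  rw [hatH_hatL, map_zero, LinearMap.zero_apply, mem_half.1 hm, map_smul] at h
  exact mem_half.2 (sub_eq_zero.1 h.symm)

variable [CharZero K]

/-- The operator `ĥ` has no eigenvalues other than `±1/2`. -/
theorem eq_zero_of_eigen {m : V.carrier} {c : K} (hm : V.act (hatH hπ) m = c • m)
    (hc : c * c ≠ 1 / 4) : m = 0 := by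
  have h : ∀ m : V.carrier, V.act (hatH hπ) (V.act (hatH hπ) m) = (1 / 4 : K) • m := by
    intro m
    have hm : m ∈ Module.End.eigenspace (V.act (hatH hπ)) (1 / 2) ⊔
        Module.End.eigenspace (V.act (hatH hπ)) (-(1 / 2)) := by
      rw [V.veryShort]; trivial
    obtain ⟨y, hy, z, hz, rfl⟩ := Submodule.mem_sup.1 hm
    rw [Module.End.mem_eigenspace_iff] at hy hz
    simp only [map_add, hy, hz, map_smul]
    module
  have h1 := h m
  rw [hm, map_smul, hm, smul_smul, ← sub_eq_zero, ← sub_smul, smul_eq_zero, sub_eq_zero] at h1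
  exact h1.resolve_left hc

theorem hatX_half (a : J) {m : V.carrier} (hm : m ∈ V.half) : V.act (hatX hπ a) m = 0 := by
  have h := act_bracket_even (V := V) (hatH_mem_gr hπ) (y := hatX hπ a) m
  rw [hatH_hatX, mem_half.1 hm, map_smul, eq_sub_iff_add_eq] at h
  refine eq_zero_of_eigen (c := 3 / 2) (V := V) ?_ (by norm_num)
  rw [← h]; module

theorem hatF_hatF_half {m : V.carrier} (hm : m ∈ V.half) :
    V.act (hatF hπ) (V.act (hatF hπ) m) = 0 := by
  have h : ∀ m, V.act (hatH hπ) (V.act (hatF hπ) m) = V.act (hatF hπ) (V.act (hatH hπ) m)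
      - V.act (hatF hπ) m := by
    intro m
    have h := act_bracket_even (V := V) (hatH_mem_gr hπ) (y := hatF hπ) m
    rw [hatH_hatF, map_neg, LinearMap.neg_apply] at h
    rw [sub_eq_add_neg, h]; abel
  refine eq_zero_of_eigen (c := -(3 / 2)) (V := V) ?_ (by norm_num)
  rw [h, h, mem_half.1 hm, map_smul, map_sub, map_smul]
  module

theorem act_hatL_eq (a : J) {m : V.carrier} (hm : m ∈ V.half) :
    V.act (hatL hπ a) m = V.act (hatX hπ a) (V.act (hatF hπ) m) := by
  refine homog_induction K (p := fun a => V.act (hatL hπ a) m =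
    V.act (hatX hπ a) (V.act (hatF hπ) m)) (fun y z hy hz => ?_) (fun i a ha => ?_) a
  · simp only [map_add, LinearMap.add_apply, hy, hz]
  · rw [hatL_apply, V.act_bracket (hatX_mem_gr hπ ha) (hatF_mem_gr hπ), hatX_half a hm, map_zero,
      smul_zero, sub_zero]

/-- The relation defining special modules, on `V[1/2]`. -/
theorem act_hatL_jmul {i j : ZMod 2} {a b : J} (ha : a ∈ gr K (V := J) i)
    (hb : b ∈ gr K (V := J) j) {m : V.carrier} (hm : m ∈ V.half) :
    V.act (hatL hπ (jmul K a b)) m = V.act (hatL hπ a) (V.act (hatL hπ b) m)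
      + sgn K i j • V.act (hatL hπ b) (V.act (hatL hπ a) m) := by
  rw [act_hatL_eq _ hm, ← hatL_hatX, V.act_bracket (hatL_mem_gr hπ ha) (hatX_mem_gr hπ hb),
    ← act_hatL_eq b hm, act_hatL_eq b (act_hatL_mem a hm)]
  have h : V.act (hatL hπ a) (V.act (hatF hπ) m) = -V.act (hatF hπ) (V.act (hatL hπ a) m) := by
    rw [hatL_apply, V.act_bracket (hatX_mem_gr hπ ha) (hatF_mem_gr hπ), ← hatL_apply,
      hatF_hatF_half hm, map_zero, act_hatL_eq a hm, sgn_zero_right, one_smul, zero_sub]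
  rw [h, map_neg, smul_neg, sub_neg_eq_add]

/-- The object `Jor(V) = V[1/2]` with the action `a ∘ v = [a, f] v`. -/
noncomputable def jorObj (V : VeryShortModule hπ) : SpecialModule K J where
  carrier := V.half
  act := LinearMap.mk₂ K (fun a v => ⟨V.act (sbr K (hatX hπ a) (hatF hπ)) v, act_hatL_mem a v.2⟩)
    (fun a b v => Subtype.ext (by simp)) (fun c a v => Subtype.ext (by simp))
    (fun a v w => Subtype.ext (by simp)) (fun c a v => Subtype.ext (by simp))
  isBimodule := isJordanProduct_nullSplitMul _
    (fun i j a ha m hm => V.act_mem (hatL_mem_gr hπ ha) hm)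
    (fun i j a ha b hb m => Subtype.ext (act_hatL_jmul ha hb m.2))
  act_one := fun m => Subtype.ext (mem_half.1 m.2)

/-- The functor `Jor` from modules with a very short grading to special modules. -/
noncomputable def Jor (hπ : IsCentralExtension π) : VeryShortModule hπ ⥤ SpecialModule K J where
  obj V := V.jorObj
  map {V W} φ :=
    { toLin := φ.toLin.restrict (p := V.half) (q := W.half) (fun m hm => by
        rw [mem_half, ← φ.map_act, mem_half.1 hm, map_smul])
      even := fun i m hm => φ.even i _ hm
      map_act := fun a m => Subtype.ext (φ.map_act _ _) }

end VeryShortModule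

/-- `F` is the functor `Lie`: the module `Lie(M)` is `M ⊕ M`, naturally in `M`, where `a ∈ J`,
in degree `1`, acts by `(m₁, m₂) ↦ (0, a ∘ m₁)`, and `-1/2 [f, [f, b]]` for `b ∈ J`, in degree `-1`,
acts by `(m₁, m₂) ↦ (b ∘ m₂, 0)`. When `E` is perfect, in particular
for a universal central extension, these elements generate `E`, so `Lie(M)` is determined. -/
def IsLieFunctor (F : SpecialModule K J ⥤ VeryShortModule hπ) : Prop :=
  ∃ ι : ∀ M : SpecialModule K J, (M.carrier × M.carrier) ≃ₗ[K] (F.obj M).carrier,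
    (∀ (M : SpecialModule K J) (i : ZMod 2) (m₁ m₂ : M.carrier), m₁ ∈ gr K (V := M.carrier) i →
      m₂ ∈ gr K (V := M.carrier) i → ι M (m₁, m₂) ∈ gr K (V := (F.obj M).carrier) i) ∧
    (∀ (M : SpecialModule K J) (a : J) (m₁ m₂ : M.carrier),
      (F.obj M).act (hatX hπ a) (ι M (m₁, m₂)) = ι M (0, M.act a m₁)) ∧
    (∀ (M : SpecialModule K J) (b : J) (m₁ m₂ : M.carrier),
      (F.obj M).act (-(1 / 2 : K) • sbr K (hatF hπ) (sbr K (hatF hπ) (hatX hπ b)))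
        (ι M (m₁, m₂)) = ι M (M.act b m₂, 0)) ∧
    (∀ (M N : SpecialModule K J) (φ : M ⟶ N) (m₁ m₂ : M.carrier),
      VeryShortModule.Hom.toLin (F.map φ) (ι M (m₁, m₂)) =
        ι N (SpecialModule.Hom.toLin φ m₁, SpecialModule.Hom.toLin φ m₂))

end VeryShort

end Super

open Super

/-! Both directions rest on the triple `ê, ĥ, f̂`. In a very short module nothing has `ĥ`-eigenvalue
`±3/2`, so every `â`, and also the square of `f̂`, kills `V[1/2]`. Hence `[â, f̂]` acts there as `â
f̂`, and the relation that `[[â, f̂], b̂]` is the lift of `a · b` becomes `(a · b) ∘ v = a ∘ (b ∘ v)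
± b ∘ (a ∘ v)`. Moreover `f̂ : V[1/2] → V[-1/2]` is bijective with inverse `2ê`, so `V` is two
copies of `V[1/2]`, on which `f̂` and all `â` are expressed through the action of `J` alone.

Conversely, the same anticommutator relation holds in every special module: it is the Jordan
identity with `e` as third argument (`SpecialModule.act_jmul`). It makes the operators `x_a = raise
a` and `y_b = lower b` on `M ⊕ M` satisfy the triple relations of the elements `X_a = a` and `Y_b =
½ [L_b, P]` of `Lie(J)` (`SpecialModule.isTriplePair`). These relations see an element of degree `0`
only through its brackets with degrees `±1`, which leaves a central ambiguity; this is where the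
central extension enters. In `Lie(J) × gl(M ⊕ M)` the elements `(X_a, x_a)`, `(Y_b, y_b)` and the
brackets of the latter with the former span a subalgebra that maps onto `Lie(J)`. The kernel lies in
the span of the brackets and commutes with everything, so the subalgebra is a central extension of
`Lie(J)`. Universality maps `E` to it, and the second projection gives the action on `M ⊕ M`
(`IsTriplePair.exists_hom`).

Morphisms are controlled by generation. A universal central extension is perfect, and its bracket
depends only on images in `Lie(J)`; so a bracket-closed set of homogeneous elements that contains
`f̂` and the homogeneous `â` spans `E` (`IsUniversalCentralExtension.span_eq_top`). A linear map
that commutes with these elements therefore commutes with `E`. This gives the functoriality of `Lie`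
and the counit `(v, w) ↦ f̂ v + w`; the unit is `m ↦ (0, m)`.

The extension exists because `Lie(J)` is perfect: `h` acts by `±1` in degrees `±1`, and degree `0`
is spanned by brackets. For a perfect `L` one takes `L ⊗ L` modulo skew symmetry and the Jacobi
identity. -/

namespace Super

/-! ### Gradings on quotients and tensor products -/

section Gradings

variable {K : Type v} [Field K]

/-- The superspace structure on `V` whose odd part is the image of an idempotent `p` and whose
even part is its kernel. -/
@[reducible] def SuperSpace.ofIdempotent {V : Type u} [AddCommGroup V] [Module K V]
    (p : V →ₗ[K] V) (hp : ∀ x, p (p x) = p x) : SuperSpace K V where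
  gr i := if i = 0 then LinearMap.ker p else LinearMap.ker (LinearMap.id - p)
  isCompl := by
    rw [if_pos rfl, if_neg one_ne_zero]
    refine IsCompl.of_le ?_ ?_
    · rintro x ⟨h0, h1⟩
      have h0' : p x = 0 := h0
      have h1' : x - p x = 0 := h1
      simpa [h0'] using h1'
    · rintro x -
      exact Submodule.mem_sup.2 ⟨x - p x, by simp [hp], p x, by simp [hp], by simp⟩

variable {V : Type u} [AddCommGroup V] [Module K V] [SuperSpace K V]

/-- The quotient of a superspace by a graded subspace. -/
@[reducible] def SuperSpace.ofQuotient (S : Submodule K V) (hS : ∀ x ∈ S, oddProj K x ∈ S) :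
    SuperSpace K (V ⧸ S) where
  gr i := (Super.gr K i).map S.mkQ
  isCompl := by
    refine IsCompl.of_le ?_ ?_
    · rintro _ ⟨⟨y, hy, rfl⟩, z, hz, h⟩
      have h1 : z - y ∈ S := (Submodule.Quotient.eq S).1 h
      -- The odd projection of `z - y` is `z`, so `z` itself lies in `S`: the even and odd images
      -- meet only in zero.
      have h2 := hS _ h1
      rw [map_sub, oddProj_of_odd K hz, oddProj_of_even K hy, sub_zero] at h2
      rw [Submodule.mem_bot, ← h]
      exact (Submodule.Quotient.mk_eq_zero S).2 h2
    · rintro x -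
      obtain ⟨x, rfl⟩ := S.mkQ_surjective x
      exact Submodule.mem_sup.2 ⟨_, ⟨_, sub_oddProj_mem K x, rfl⟩, _, ⟨_, oddProj_mem K x, rfl⟩,
        by rw [← map_add, sub_add_cancel]⟩

/-- A subspace spanned by homogeneous vectors is graded. -/
theorem oddProj_mem_span {s : Set V} (hs : ∀ x ∈ s, ∃ i, x ∈ gr K (V := V) i) :
    ∀ x ∈ Submodule.span K s, oddProj K x ∈ Submodule.span K s := by
  intro x hx
  induction hx using Submodule.span_induction with
  | mem x hx =>
    obtain ⟨i, hi⟩ := hs x hx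
    rcases zmod2_cases i with rfl | rfl
    · rw [oddProj_of_even K hi]; exact zero_mem _
    · rw [oddProj_of_odd K hi]; exact Submodule.subset_span hx
  | zero => rw [map_zero]; exact zero_mem _
  | add x y _ _ hx hy => rw [map_add]; exact add_mem hx hy
  | smul c x _ hx => rw [map_smul]; exact Submodule.smul_mem _ _ hx

variable {W : Type w} [AddCommGroup W] [Module K W] [SuperSpace K W]

open scoped TensorProduct

variable (K V W) in
/-- The projection of a tensor product of superspaces onto its odd part. -/
noncomputable def tensorOdd : V ⊗[K] W →ₗ[K] V ⊗[K] W :=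
  TensorProduct.map (oddProj K) (LinearMap.id - oddProj K) +
    TensorProduct.map (LinearMap.id - oddProj K) (oddProj K)

theorem tensorOdd_tmul {i j : ZMod 2} {x : V} {y : W} (hx : x ∈ gr K (V := V) i)
    (hy : y ∈ gr K (V := W) j) :
    tensorOdd K V W (x ⊗ₜ y) = if i + j = 0 then 0 else x ⊗ₜ y := by
  rcases zmod2_cases i with rfl | rfl <;> rcases zmod2_cases j with rfl | rfl <;>
    simp [tensorOdd, oddProj_of_even, oddProj_of_odd, hx, hy, zmod2_one_add_one]

/-- To prove an additive property of tensors, it suffices to treat tensors of homogeneous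
vectors. -/
theorem tmul_homog_induction {p : V ⊗[K] W → Prop} (h0 : p 0)
    (hadd : ∀ s t, p s → p t → p (s + t))
    (h : ∀ i j, ∀ x ∈ gr K (V := V) i, ∀ y ∈ gr K (V := W) j, p (x ⊗ₜ y)) (t : V ⊗[K] W) :
    p t := by
  induction t using TensorProduct.induction_on with
  | zero => exact h0
  | add s t hs ht => exact hadd s t hs ht
  | tmul x y =>
    refine homog_induction K (p := fun x => p (x ⊗ₜ y)) (fun x x' hx hx' => ?_)
      (fun i x hx => ?_) x
    · rw [TensorProduct.add_tmul]; exact hadd _ _ hx hx'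
    · refine homog_induction K (p := fun y => p (x ⊗ₜ y)) (fun y y' hy hy' => ?_)
        (fun j y hy => h i j x hx y hy) y
      rw [TensorProduct.tmul_add]; exact hadd _ _ hy hy'

theorem tensorOdd_tensorOdd (t : V ⊗[K] W) :
    tensorOdd K V W (tensorOdd K V W t) = tensorOdd K V W t := by
  refine tmul_homog_induction (K := K)
    (p := fun t => tensorOdd K V W (tensorOdd K V W t) = tensorOdd K V W t)
    (by simp) (fun s t hs ht => by simp only [map_add, hs, ht]) (fun i j x hx y hy => ?_) t
  rw [tensorOdd_tmul hx hy]
  split_ifs with h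
  · simp
  · rw [tensorOdd_tmul hx hy, if_neg h]

/-- The tensor product of two superspaces. -/
noncomputable instance : SuperSpace K (V ⊗[K] W) :=
  SuperSpace.ofIdempotent (tensorOdd K V W) tensorOdd_tensorOdd

theorem tmul_mem_gr {i j : ZMod 2} {x : V} {y : W} (hx : x ∈ gr K (V := V) i)
    (hy : y ∈ gr K (V := W) j) : x ⊗ₜ y ∈ gr K (V := V ⊗[K] W) (i + j) := by
  change x ⊗ₜ y ∈ (if i + j = 0 then LinearMap.ker (tensorOdd K V W)
    else LinearMap.ker (LinearMap.id - tensorOdd K V W))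
  have h := tensorOdd_tmul hx hy
  split_ifs with h0
  · rwa [if_pos h0] at h
  · rw [if_neg h0] at h
    simp [h]

/-- An injective even linear map reflects homogeneity. -/
theorem mem_gr_of_even_injective {f : V →ₗ[K] W} (hf : Function.Injective f)
    (heven : ∀ i, ∀ x ∈ gr K (V := V) i, f x ∈ gr K (V := W) i) {i : ZMod 2} {x : V}
    (hx : f x ∈ gr K (V := W) i) : x ∈ gr K (V := V) i := by
  obtain ⟨y, hy, z, hz, rfl⟩ := exists_homog K x
  have ey := heven 0 y hy
  have ez := heven 1 z hz
  rw [map_add] at hx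
  rcases zmod2_cases i with rfl | rfl
  · have : z = 0 := hf (by
      rw [map_zero]
      exact eq_zero_of_even_odd K (by simpa using sub_mem hx ey) ez)
    rwa [this, add_zero]
  · have : y = 0 := hf (by
      rw [map_zero]
      exact eq_zero_of_even_odd K ey (by simpa using sub_mem hx ez))
    rwa [this, zero_add]

end Gradings

/-! ### The universal central extension of a perfect Lie superalgebra -/

section UCE

open scoped TensorProduct

variable (K : Type v) [Field K] (L : Type u) [AddCommGroup L] [Module K L] [SuperSpace K L]
  [LieSuperalgebra K L]

/-- The tensors that become zero in the universal central extension. -/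
def uceRelators : Set (L ⊗[K] L) :=
  {t | ∃ (i j : ZMod 2) (x y : L), x ∈ gr K (V := L) i ∧ y ∈ gr K (V := L) j ∧
      t = x ⊗ₜ y + sgn K i j • y ⊗ₜ x} ∪
  {t | ∃ (i j k : ZMod 2) (x y z : L), x ∈ gr K (V := L) i ∧ y ∈ gr K (V := L) j ∧
      z ∈ gr K (V := L) k ∧
      t = x ⊗ₜ sbr K y z - (sbr K x y ⊗ₜ z + sgn K i j • y ⊗ₜ sbr K x z)}

/-- The underlying space of the universal central extension of a perfect Lie superalgebra. -/
def UCE : Type u := (L ⊗[K] L) ⧸ Submodule.span K (uceRelators K L)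

noncomputable instance : AddCommGroup (UCE K L) :=
  inferInstanceAs (AddCommGroup ((L ⊗[K] L) ⧸ Submodule.span K (uceRelators K L)))

noncomputable instance : Module K (UCE K L) :=
  inferInstanceAs (Module K ((L ⊗[K] L) ⧸ Submodule.span K (uceRelators K L)))

/-- Homogeneity of the relators makes their span stable under the odd projection, which is what the
grading of the quotient requires. -/
theorem uceRelators_homog : ∀ t ∈ uceRelators K L, ∃ i, t ∈ gr K (V := L ⊗[K] L) i := by
  rintro _ (⟨i, j, x, y, hx, hy, rfl⟩ | ⟨i, j, k, x, y, z, hx, hy, hz, rfl⟩)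
  · refine ⟨i + j, add_mem (tmul_mem_gr hx hy) (Submodule.smul_mem _ _ ?_)⟩
    rw [add_comm]
    exact tmul_mem_gr hy hx
  · refine ⟨i + (j + k), sub_mem (tmul_mem_gr hx (sbr_mem hy hz)) (add_mem ?_
      (Submodule.smul_mem _ _ ?_))⟩
    · rw [← add_assoc]
      exact tmul_mem_gr (sbr_mem hx hy) hz
    · rw [add_left_comm]
      exact tmul_mem_gr hy (sbr_mem hx hz)

noncomputable instance : SuperSpace K (UCE K L) :=
  SuperSpace.ofQuotient _ (oddProj_mem_span (uceRelators_homog K L))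

/-- The class of `x ⊗ y` in the universal central extension. -/
noncomputable def uceMk : L →ₗ[K] L →ₗ[K] UCE K L :=
  (TensorProduct.mk K L L).compr₂ (Submodule.span K (uceRelators K L)).mkQ

variable {K L}

theorem uceMk_mem_gr {i j : ZMod 2} {x y : L} (hx : x ∈ gr K (V := L) i)
    (hy : y ∈ gr K (V := L) j) : uceMk K L x y ∈ gr K (V := UCE K L) (i + j) :=
  ⟨_, tmul_mem_gr hx hy, rfl⟩

theorem uceMk_skew {i j : ZMod 2} {x y : L} (hx : x ∈ gr K (V := L) i)
    (hy : y ∈ gr K (V := L) j) : uceMk K L x y = -(sgn K i j • uceMk K L y x) := by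
  rw [eq_neg_iff_add_eq_zero]
  exact (Submodule.Quotient.mk_eq_zero _).2
    (Submodule.subset_span (.inl ⟨i, j, x, y, hx, hy, rfl⟩))

theorem uceMk_jacobi {i j k : ZMod 2} {x y z : L} (hx : x ∈ gr K (V := L) i)
    (hy : y ∈ gr K (V := L) j) (hz : z ∈ gr K (V := L) k) :
    uceMk K L x (sbr K y z) =
      uceMk K L (sbr K x y) z + sgn K i j • uceMk K L y (sbr K x z) := by
  rw [← sub_eq_zero]
  exact (Submodule.Quotient.mk_eq_zero _).2
    (Submodule.subset_span (.inr ⟨i, j, k, x, y, z, hx, hy, hz, rfl⟩))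

/-- The linear map on the universal central extension defined by a bilinear map that satisfies
the relations of the Lie bracket. -/
noncomputable def uceLift {A : Type u} [AddCommGroup A] [Module K A] (B : L →ₗ[K] L →ₗ[K] A)
    (hs : ∀ i j : ZMod 2, ∀ x ∈ gr K (V := L) i, ∀ y ∈ gr K (V := L) j,
      B x y = -(sgn K i j • B y x))
    (hj : ∀ i j k : ZMod 2, ∀ x ∈ gr K (V := L) i, ∀ y ∈ gr K (V := L) j,
      ∀ z ∈ gr K (V := L) k, B x (sbr K y z) = B (sbr K x y) z + sgn K i j • B y (sbr K x z)) :
    UCE K L →ₗ[K] A :=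
  Submodule.liftQ (Submodule.span K (uceRelators K L)) (TensorProduct.lift B) (by
    rw [Submodule.span_le]
    rintro _ (⟨i, j, x, y, hx, hy, rfl⟩ | ⟨i, j, k, x, y, z, hx, hy, hz, rfl⟩)
    · simp [hs i j x hx y hy]
    · simp [hj i j k x hx y hy z hz])

theorem uceLift_mk {A : Type u} [AddCommGroup A] [Module K A] (B : L →ₗ[K] L →ₗ[K] A) (hs hj)
    (x y : L) : uceLift B hs hj (uceMk K L x y) = B x y := rfl

theorem uce_hom_ext {A : Type u} [AddCommGroup A] [Module K A] {f g : UCE K L →ₗ[K] A}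
    (h : ∀ x y, f (uceMk K L x y) = g (uceMk K L x y)) : f = g := by
  refine Submodule.linearMap_qext _ (TensorProduct.ext' fun x y => h x y)

/-- A linear map on the universal central extension is even if it is so on homogeneous tensors. -/
theorem uce_even {A : Type u} [AddCommGroup A] [Module K A] [SuperSpace K A] {f : UCE K L →ₗ[K] A}
    (h : ∀ i j : ZMod 2, ∀ x ∈ gr K (V := L) i, ∀ y ∈ gr K (V := L) j,
      f (uceMk K L x y) ∈ gr K (V := A) (i + j)) :
    ∀ i, ∀ t ∈ gr K (V := UCE K L) i, f t ∈ gr K (V := A) i := by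
  -- Evenness amounts to commuting with the odd projections. In this form it is an equality of
  -- linear maps, which can be tested on classes of homogeneous tensors.
  have key : f ∘ₗ oddProj K = oddProj K ∘ₗ f := by
    refine uce_hom_ext fun x y => ?_
    revert y
    refine homog_induction K (p := fun x => ∀ y, (f ∘ₗ oddProj K) (uceMk K L x y) =
      (oddProj K ∘ₗ f) (uceMk K L x y)) (fun x x' hx hx' y => by
        simp only [map_add, LinearMap.add_apply, hx, hx']) (fun i x hx => ?_) x
    refine homog_induction K (fun y y' hy hy' => by simp only [map_add, hy, hy'])
      (fun j y hy => ?_)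
    have h1 := h i j x hx y hy
    have h2 := uceMk_mem_gr hx hy
    rcases zmod2_cases (i + j) with e | e <;> rw [e] at h1 h2
    · simp [oddProj_of_even K h1, oddProj_of_even K h2]
    · simp [oddProj_of_odd K h1, oddProj_of_odd K h2]
  intro i t ht
  have h1 := LinearMap.congr_fun key t
  simp only [LinearMap.comp_apply] at h1
  rcases zmod2_cases i with rfl | rfl
  · have := sub_oddProj_mem K (f t)
    rwa [← h1, oddProj_of_even K ht, map_zero, sub_zero] at this
  · rw [oddProj_of_odd K ht] at h1
    rw [h1]
    exact oddProj_mem K (f t)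

variable (K L) in
/-- The projection of the universal central extension, `x ⊗ y ↦ [x, y]`. -/
noncomputable def uceProj : UCE K L →ₗ[K] L :=
  uceLift (sbr K) (fun _ _ _ hx _ hy => sbr_skew hx hy)
    (fun _ _ _ _ hx _ hy _ hz => sbr_jacobi hx hy hz)

theorem uceProj_mk (x y : L) : uceProj K L (uceMk K L x y) = sbr K x y := rfl

theorem uceProj_even : ∀ i, ∀ t ∈ gr K (V := UCE K L) i, uceProj K L t ∈ gr K (V := L) i :=
  uce_even fun _ _ _ hx _ hy => sbr_mem hx hy

/-- The bracket sees its arguments only through their images in `L`, so the axioms are the relators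
evaluated at these images, and the kernel of the projection is central by construction. -/
noncomputable instance : LieSuperalgebra K (UCE K L) where
  bracket := (uceMk K L).compl₁₂ (uceProj K L) (uceProj K L)
  bracket_mem := fun hx hy => uceMk_mem_gr (uceProj_even _ _ hx) (uceProj_even _ _ hy)
  skew := fun hx hy => uceMk_skew (uceProj_even _ _ hx) (uceProj_even _ _ hy)
  jacobi := fun hx hy hz =>
    uceMk_jacobi (uceProj_even _ _ hx) (uceProj_even _ _ hy) (uceProj_even _ _ hz)

theorem sbr_uce (s t : UCE K L) : sbr K s t = uceMk K L (uceProj K L s) (uceProj K L t) := rfl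

/-- Homogeneous elements of `L` have homogeneous lifts, so the bracket that a central extension
induces on `L` inherits the axioms from `E`. Skew symmetry and the Jacobi identity are the two
hypotheses of `uceLift`. -/
theorem liftBr_skew {E : Type u} [AddCommGroup E] [Module K E] [SuperSpace K E]
    [LieSuperalgebra K E] {π : E →ₗ[K] L} (hπ : IsCentralExtension π) {i j : ZMod 2} {x y : L}
    (hx : x ∈ gr K (V := L) i) (hy : y ∈ gr K (V := L) j) :
    liftBr hπ x y = -(sgn K i j • liftBr hπ y x) := by
  obtain ⟨x, hx', rfl⟩ := hπ.exists_lift hx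
  obtain ⟨y, hy', rfl⟩ := hπ.exists_lift hy
  rw [← sbr_eq_liftBr, ← sbr_eq_liftBr, sbr_skew hx' hy']

theorem liftBr_jacobi {E : Type u} [AddCommGroup E] [Module K E] [SuperSpace K E]
    [LieSuperalgebra K E] {π : E →ₗ[K] L} (hπ : IsCentralExtension π) {i j k : ZMod 2}
    {x y z : L} (hx : x ∈ gr K (V := L) i) (hy : y ∈ gr K (V := L) j)
    (hz : z ∈ gr K (V := L) k) :
    liftBr hπ x (sbr K y z) =
      liftBr hπ (sbr K x y) z + sgn K i j • liftBr hπ y (sbr K x z) := by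
  obtain ⟨x, hx', rfl⟩ := hπ.exists_lift hx
  obtain ⟨y, hy', rfl⟩ := hπ.exists_lift hy
  obtain ⟨z, hz', rfl⟩ := hπ.exists_lift hz
  simp only [← hπ.map_bracket, ← sbr_eq_liftBr]
  exact sbr_jacobi hx' hy' hz'

/-- A perfect Lie superalgebra has a universal central extension. -/
theorem uceProj_universal (hL : ∀ x : L, x ∈ Submodule.span K {z | ∃ x y : L, z = sbr K x y}) :
    IsUniversalCentralExtension (uceProj K L) := by
  have hsurj : Function.Surjective (uceProj K L) := by
    rw [← LinearMap.range_eq_top, eq_top_iff]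
    rintro x -
    refine Submodule.span_le.2 ?_ (hL x)
    rintro _ ⟨x, y, rfl⟩
    exact ⟨uceMk K L x y, uceProj_mk x y⟩
  refine ⟨⟨⟨uceProj_even, fun x y => rfl⟩, hsurj, fun z hz x => by
    rw [sbr_uce, hz, map_zero, LinearMap.zero_apply]⟩, ?_⟩
  intro E' _ _ _ _ π' hπ'
  -- The map to `E'` sends the class of `x ⊗ y` to the bracket of any lifts of `x` and `y` to `E'`.
  refine ⟨uceLift (liftBr hπ') (fun _ _ _ hx _ hy => liftBr_skew hπ' hx hy)
    (fun _ _ _ _ hx _ hy _ hz => liftBr_jacobi hπ' hx hy hz), ?_, ?_⟩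
  · have hcomp : π' ∘ₗ uceLift (liftBr hπ') (fun _ _ _ hx _ hy => liftBr_skew hπ' hx hy)
        (fun _ _ _ _ hx _ hy _ hz => liftBr_jacobi hπ' hx hy hz) = uceProj K L :=
      uce_hom_ext fun x y => map_liftBr hπ' x y
    refine ⟨⟨uce_even fun i j x hx y hy => liftBr_mem hπ' hx hy, fun s t => ?_⟩, hcomp⟩
    have h := LinearMap.congr_fun hcomp
    simp only [LinearMap.comp_apply] at h
    rw [sbr_eq_liftBr hπ', h, h, sbr_uce, uceLift_mk]
  -- The class of `x ⊗ y` is the bracket of any lifts of `x` and `y`, so a homomorphism over `L` has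
  -- no choice for its image. Perfectness enters through the existence of the lifts.
  · rintro φ ⟨hφ, hc⟩
    refine uce_hom_ext fun x y => ?_
    obtain ⟨s, rfl⟩ := hsurj x
    obtain ⟨t, rfl⟩ := hsurj y
    have h := LinearMap.congr_fun hc
    simp only [LinearMap.comp_apply] at h
    rw [← sbr_uce, hφ.map_bracket, sbr_eq_liftBr hπ', h, h, sbr_uce, uceLift_mk]

end UCE

/-! ### Perfectness of universal central extensions -/

section Perfect

variable {K : Type v} [Field K]

/-- A universal central extension is perfect. -/
theorem IsUniversalCentralExtension.perfect {E L : Type u} [AddCommGroup E] [Module K E]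
    [SuperSpace K E] [LieSuperalgebra K E] [AddCommGroup L] [Module K L] [SuperSpace K L]
    [LieSuperalgebra K L] {π : E →ₗ[K] L} (hπ : IsUniversalCentralExtension π)
    {S : Submodule K E} (hS : ∀ x y : E, sbr K x y ∈ S)
    (hodd : ∀ x ∈ S, oddProj K x ∈ S) : S = ⊤ := by
  let _ : SuperSpace K (E ⧸ S) := SuperSpace.ofQuotient S hodd
  -- The factor `E ⧸ S` is given the zero bracket, so that `E × (E ⧸ S)` is again a central
  -- extension of `L`. Two homomorphisms from `E` to it over `L` must agree.
  let _ : LieSuperalgebra K (E × (E ⧸ S)) :=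
    { bracket := (sbr K (L := E)).compl₁₂ (LinearMap.fst K E (E ⧸ S)) (LinearMap.fst K E (E ⧸ S))
        |>.compr₂ (LinearMap.inl K E (E ⧸ S))
      bracket_mem := fun hx hy => ⟨sbr_mem hx.1 hy.1, zero_mem _⟩
      skew := fun hx hy => Prod.ext (sbr_skew hx.1 hy.1) (by simp)
      jacobi := fun hx hy hz => Prod.ext (sbr_jacobi hx.1 hy.1 hz.1) (by simp) }
  have hbr : ∀ s t : E × (E ⧸ S), sbr K s t = (sbr K s.1 t.1, 0) := fun s t => rfl
  have hc : IsCentralExtension (π ∘ₗ LinearMap.fst K E (E ⧸ S)) :=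
    { even := fun i x hx => hπ.even i _ hx.1
      map_bracket := fun x y => hπ.map_bracket _ _
      surjective := fun x => by
        obtain ⟨y, rfl⟩ := hπ.surjective x
        exact ⟨(y, 0), rfl⟩
      central := fun z hz x => by
        rw [hbr, hπ.central z.1 hz]
        rfl }
  have h1 : IsLieHom (LinearMap.inl K E (E ⧸ S)) :=
    ⟨fun i x hx => ⟨hx, zero_mem _⟩, fun x y => rfl⟩
  -- The map `x ↦ (x, x mod S)` preserves brackets because `S` contains all of them. Comparison with
  -- `x ↦ (x, 0)` shows that the quotient map vanishes.
  have h2 : IsLieHom (LinearMap.prod LinearMap.id S.mkQ) :=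
    ⟨fun i x hx => ⟨hx, x, hx, rfl⟩, fun x y => Prod.ext rfl
      ((Submodule.Quotient.mk_eq_zero S).2 (hS x y))⟩
  have h := (hπ.universal _ _ hc).unique ⟨h1, rfl⟩ ⟨h2, rfl⟩
  rw [eq_top_iff]
  rintro x -
  have := congrArg Prod.snd (LinearMap.congr_fun h x)
  exact (Submodule.Quotient.mk_eq_zero S).1 this.symm

end Perfect

/-! ### Lie superalgebras of operators, products and subalgebras -/

section Constructions

variable {K : Type v} [Field K]

theorem map_oddProj_of_even {V : Type*} {W : Type*} [AddCommGroup V] [Module K V] [SuperSpace K V]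
    [AddCommGroup W] [Module K W] [SuperSpace K W] {f : V →ₗ[K] W}
    (heven : ∀ i, ∀ x ∈ gr K (V := V) i, f x ∈ gr K (V := W) i) (x : V) :
    f (oddProj K x) = oddProj K (f x) := by
  refine homog_induction K (p := fun x => f (oddProj K x) = oddProj K (f x))
    (fun x y hx hy => by simp only [map_add, hx, hy]) (fun i x hx => ?_) x
  have h := heven i x hx
  rcases zmod2_cases i with rfl | rfl
  · rw [oddProj_of_even K hx, oddProj_of_even K h, map_zero]
  · rw [oddProj_of_odd K hx, oddProj_of_odd K h]

theorem apply_mem_of_mem_span {V W U : Type*} [AddCommGroup V] [Module K V] [AddCommGroup W]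
    [Module K W] [AddCommGroup U] [Module K U] (B : V →ₗ[K] W →ₗ[K] U) {s : Set V} {t : Set W}
    {P : Submodule K U} (h : ∀ x ∈ s, ∀ y ∈ t, B x y ∈ P) {x : V} (hx : x ∈ Submodule.span K s)
    {y : W} (hy : y ∈ Submodule.span K t) : B x y ∈ P := by
  have h1 : Submodule.map₂ B (Submodule.span K s) (Submodule.span K t) ≤ P := by
    rw [Submodule.map₂_span_span, Submodule.span_le]
    rintro _ ⟨x, hx, y, hy, rfl⟩
    exact h x hx y hy
  exact h1 (Submodule.apply_mem_map₂ B hx hy)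

section Operators

variable {V : Type u} [AddCommGroup V] [Module K V] [SuperSpace K V]

theorem end_mul_mem {f g : V →ₗ[K] V} {i j : ZMod 2} (hf : f ∈ gr K (V := V →ₗ[K] V) i)
    (hg : g ∈ gr K (V := V →ₗ[K] V) j) : f ∘ₗ g ∈ gr K (V := V →ₗ[K] V) (i + j) := by
  intro k x hx
  rw [add_assoc]
  exact hf _ _ (hg _ _ hx)

variable (K V) in
/-- The supercommutator of operators. -/
noncomputable def endBr : (V →ₗ[K] V) →ₗ[K] (V →ₗ[K] V) →ₗ[K] (V →ₗ[K] V) :=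
  superComm (LinearMap.mul K (Module.End K V))

theorem endBr_apply {f g : V →ₗ[K] V} {i j : ZMod 2} (hf : f ∈ gr K (V := V →ₗ[K] V) i)
    (hg : g ∈ gr K (V := V →ₗ[K] V) j) : endBr K V f g = f ∘ₗ g - sgn K i j • (g ∘ₗ f) :=
  superComm_apply _ hf hg

theorem endBr_mem {f g : V →ₗ[K] V} {i j : ZMod 2} (hf : f ∈ gr K (V := V →ₗ[K] V) i)
    (hg : g ∈ gr K (V := V →ₗ[K] V) j) : endBr K V f g ∈ gr K (V := V →ₗ[K] V) (i + j) := by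
  rw [endBr_apply hf hg]
  refine sub_mem (end_mul_mem hf hg) (Submodule.smul_mem _ _ ?_)
  rw [add_comm]
  exact end_mul_mem hg hf

/-- The general linear Lie superalgebra of a superspace. -/
noncomputable instance : LieSuperalgebra K (V →ₗ[K] V) where
  bracket := endBr K V
  bracket_mem := endBr_mem
  skew := fun hf hg => by
    rw [endBr_apply hf hg, endBr_apply hg hf, smul_sub, smul_smul, sgn_comm, sgn_mul_self, one_smul,
      neg_sub]
  jacobi := fun {i j k f g h} hf hg hh => by
    rw [endBr_apply hf (endBr_mem hg hh), endBr_apply (endBr_mem hf hg) hh,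
      endBr_apply hg (endBr_mem hf hh), endBr_apply hf hg, endBr_apply hf hh, endBr_apply hg hh]
    ext x
    simp only [LinearMap.sub_apply, LinearMap.add_apply, LinearMap.smul_apply,
      LinearMap.comp_apply, map_sub, map_smul]
    rcases zmod2_cases i with rfl | rfl <;> rcases zmod2_cases j with rfl | rfl <;>
    rcases zmod2_cases k with rfl | rfl <;>
    simp only [sgn_zero_left, sgn_zero_right, sgn_one_one, zmod2_one_add_one, add_zero, zero_add,
      one_smul, neg_smul] <;> abel

theorem sbr_end {f g : V →ₗ[K] V} {i j : ZMod 2} (hf : f ∈ gr K (V := V →ₗ[K] V) i)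
    (hg : g ∈ gr K (V := V →ₗ[K] V) j) (x : V) : sbr K f g x = f (g x) - sgn K i j • g (f x) :=
  LinearMap.congr_fun (endBr_apply hf hg) x

end Operators

variable {L G : Type u} [AddCommGroup L] [Module K L] [SuperSpace K L] [LieSuperalgebra K L]
  [AddCommGroup G] [Module K G] [SuperSpace K G] [LieSuperalgebra K G]

/-- The direct product of two Lie superalgebras. -/
noncomputable instance : LieSuperalgebra K (L × G) where
  bracket := LinearMap.mk₂ K (fun s t => (sbr K s.1 t.1, sbr K s.2 t.2))
    (fun s s' t => Prod.ext (by simp) (by simp)) (fun c s t => Prod.ext (by simp) (by simp))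
    (fun s t t' => Prod.ext (by simp) (by simp)) (fun c s t => Prod.ext (by simp) (by simp))
  bracket_mem := fun hx hy => ⟨sbr_mem hx.1 hy.1, sbr_mem hx.2 hy.2⟩
  skew := fun hx hy => Prod.ext (sbr_skew hx.1 hy.1) (sbr_skew hx.2 hy.2)
  jacobi := fun hx hy hz => Prod.ext (sbr_jacobi hx.1 hy.1 hz.1) (sbr_jacobi hx.2 hy.2 hz.2)

theorem sbr_prod (s t : L × G) : sbr K s t = (sbr K s.1 t.1, sbr K s.2 t.2) := rfl

theorem sbr_mem_of_swap {S : Submodule K L} {i j : ZMod 2} {x y : L} (hx : x ∈ gr K (V := L) i)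
    (hy : y ∈ gr K (V := L) j) (h : sbr K y x ∈ S) : sbr K x y ∈ S := by
  rw [sbr_skew hx hy]
  exact neg_mem (Submodule.smul_mem _ _ h)

theorem sbr_skew_even {x y : L} (hx : x ∈ gr K (V := L) 0) : sbr K x y = -sbr K y x := by
  refine homog_induction K (p := fun y => sbr K x y = -sbr K y x)
    (fun y z hy hz => by rw [map_add, map_add, LinearMap.add_apply, hy, hz]; abel)
    (fun i y hy => ?_) y
  rw [sbr_skew hx hy, sgn_zero_left, one_smul]

/-- A graded subalgebra of `L × G` that is a central extension of `L` under the first projection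
yields a homomorphism to `G` from a universal central extension of `L`. -/
theorem IsUniversalCentralExtension.exists_hom {E : Type u} [AddCommGroup E] [Module K E]
    [SuperSpace K E] [LieSuperalgebra K E] {π : E →ₗ[K] L} (hπ : IsUniversalCentralExtension π)
    {S : Submodule K (L × G)} (hodd : ∀ s ∈ S, oddProj K s ∈ S)
    (hbr : ∀ s ∈ S, ∀ t ∈ S, sbr K s t ∈ S) (hsurj : ∀ x : L, ∃ s ∈ S, s.1 = x)
    (hcentral : ∀ s ∈ S, s.1 = 0 → ∀ t ∈ S, sbr K s t = 0) :
    ∃ ρ : E →ₗ[K] G, IsLieHom ρ ∧ ∀ s ∈ S, ∀ t ∈ S,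
      ρ (liftBr hπ.toIsCentralExtension s.1 t.1) = sbr K s.2 t.2 := by
  let _ : SuperSpace K S := SuperSpace.ofSubmodule K S hodd
  let _ : LieSuperalgebra K S :=
    { bracket := LinearMap.mk₂ K (fun s t => ⟨sbr K (s : L × G) t, hbr s s.2 t t.2⟩)
        (fun s s' t => Subtype.ext (by simp)) (fun c s t => Subtype.ext (by simp))
        (fun s t t' => Subtype.ext (by simp)) (fun c s t => Subtype.ext (by simp))
      bracket_mem := fun hx hy => sbr_mem (K := K) (L := L × G) hx hy
      skew := fun hx hy => Subtype.ext (sbr_skew (K := K) (L := L × G) hx hy)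
      jacobi := fun hx hy hz => Subtype.ext (sbr_jacobi (K := K) (L := L × G) hx hy hz) }
  have hc : IsCentralExtension (LinearMap.fst K L G ∘ₗ S.subtype) :=
    { even := fun i x hx => hx.1
      map_bracket := fun x y => rfl
      surjective := fun x => by
        obtain ⟨s, hs, rfl⟩ := hsurj x
        exact ⟨⟨s, hs⟩, rfl⟩
      central := fun z hz x => Subtype.ext (hcentral z z.2 hz x x.2) }
  obtain ⟨φ, ⟨hφ, hφπ⟩, -⟩ := hπ.universal _ _ hc
  refine ⟨LinearMap.snd K L G ∘ₗ S.subtype ∘ₗ φ, ⟨fun i x hx => (hφ.even i x hx).2,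
    fun x y => congrArg (fun s : S => s.1.2) (hφ.map_bracket x y)⟩, fun s hs t ht => ?_⟩
  obtain ⟨x, hx⟩ := hπ.surjective s.1
  obtain ⟨y, hy⟩ := hπ.surjective t.1
  have h := LinearMap.congr_fun hφπ
  -- `φ x` and `s` lie over the same element of `L`, so their difference is in the kernel and
  -- commutes with `S`. Hence `[φ x, φ y] = [s, t]`, even though `φ x` and `s` may differ.
  have e : ∀ (x : E) (s : L × G) (hs : s ∈ S), π x = s.1 →
      ∀ t ∈ S, sbr K ((φ x : L × G) - s) t = 0 := fun x s hs hx t ht =>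
    hcentral _ (sub_mem (φ x).2 hs) (by rw [Prod.fst_sub, ← hx, ← h x]; exact sub_self _) t ht
  have h1 := e x s hs hx t ht
  have h2 : sbr K (φ x : L × G) ((φ y : L × G) - t) = 0 := by
    have := hc.central_right (z := φ y - ⟨t, ht⟩) (by
      rw [map_sub, ← LinearMap.comp_apply, hφπ, hy]; exact sub_self _) (φ x)
    exact congrArg Subtype.val this
  rw [map_sub, LinearMap.sub_apply, sub_eq_zero] at h1
  rw [map_sub, sub_eq_zero] at h2
  rw [← hx, ← hy, ← sbr_eq_liftBr]
  change (φ (sbr K x y) : L × G).2 = _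
  rw [hφ.map_bracket]
  change (sbr K (φ x : L × G) (φ y : L × G)).2 = _
  rw [h2, h1]
  rfl

end Constructions

/-! ### Generators and relations of the TKK superalgebra -/

section Generators

variable {K : Type v} [Field K] {J : Type u} [AddCommGroup J] [Module K J] [SuperSpace K J]
  [UnitalJordanSuperalgebra K J]

theorem jone_mem : jone K J ∈ gr K (V := J) 0 := UnitalJordanSuperalgebra.one_mem

theorem jone_mul (a : J) : jmul K (jone K J) a = a := UnitalJordanSuperalgebra.one_mul a

theorem mul_jone {i : ZMod 2} {a : J} (ha : a ∈ gr K (V := J) i) : jmul K a (jone K J) = a := by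
  rw [jmul_comm ha jone_mem, sgn_zero_right, one_smul, jone_mul]

variable (K) in
/-- The element `½ [L_b, P]` of degree `-1` of `Lie(J)`. -/
noncomputable def tkkY : J →ₗ[K] TKK K J :=
  (1 / 2 : K) • (inQ K (J := J)).codRestrict (tkkSubmodule K J) inQ_mem

theorem tkkY_mem_gr {i : ZMod 2} {a : J} (ha : a ∈ gr K (V := J) i) :
    tkkY K a ∈ gr K (V := TKK K J) i :=
  Submodule.smul_mem _ _ (inQ_mem_gr (K := K) ha)

theorem tkkX_tkkX (a b : J) : sbr K (tkkX (K := K) a) (tkkX b) = 0 :=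
  Subtype.ext (br_inJ_inJ a b)

theorem coe_sbr (s t : TKK K J) : (sbr K s t).1 = ambientBr K J s.1 t.1 := rfl

theorem coe_tkkX (a : J) : (tkkX (K := K) a).1 = inJ K J a := rfl

theorem coe_tkkL (a : J) : (tkkL (K := K) a).1 = inL K J a := rfl

theorem coe_tkkY (a : J) : (tkkY K a).1 = (1 / 2 : K) • inQ K a := rfl

theorem tkk_ext {s t : TKK K J} (h : s.1 = t.1) : s = t := Subtype.ext h

theorem coe_add (s t : TKK K J) : (s + t).1 = s.1 + t.1 := rfl

theorem coe_sub (s t : TKK K J) : (s - t).1 = s.1 - t.1 := rfl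

theorem coe_neg (s : TKK K J) : (-s).1 = -s.1 := rfl

theorem coe_smul (c : K) (s : TKK K J) : (c • s).1 = c • s.1 := rfl

theorem tkkY_tkkY (a b : J) : sbr K (tkkY K a) (tkkY K b) = 0 := tkk_ext (by
  rw [coe_sbr, coe_tkkY, coe_tkkY, map_smul, map_smul, LinearMap.smul_apply, br_inQ_inQ, smul_zero,
    smul_zero]
  rfl)

/-- The Jacobi identity for `L_b`, `P` and `a`, with `[P, a] = L_a`, is behind this formula. It
allows degree `0` to be written in terms of brackets of degrees `-1` and `1`. -/
theorem tkkY_tkkX {i j : ZMod 2} {a b : J} (ha : a ∈ gr K (V := J) i) (hb : b ∈ gr K (V := J) j) :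
    sbr K (tkkY K b) (tkkX a) =
      (1 / 2 : K) • (sbr K (tkkL b) (tkkL a) - tkkL (jmul K b a)) := tkk_ext (by
  rw [coe_sbr, coe_tkkY, coe_tkkX, coe_smul, coe_sub, coe_sbr, coe_tkkL, coe_tkkL, coe_tkkL,
    map_smul, LinearMap.smul_apply, br_inQ_inJ hb ha])

theorem tkkL_mem_gr {i : ZMod 2} {a : J} (ha : a ∈ gr K (V := J) i) :
    tkkL (K := K) a ∈ gr K (V := TKK K J) i :=
  inL_mem_gr (K := K) ha

theorem tkkL_tkkY {i j : ZMod 2} {a b : J} (ha : a ∈ gr K (V := J) i) (hb : b ∈ gr K (V := J) j) :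
    sbr K (tkkL a) (tkkY K b) = -tkkY K (jmul K a b) := tkk_ext (by
  rw [coe_sbr, coe_neg, coe_tkkY, coe_tkkY, coe_tkkL, map_smul, br_inL_inQ hb ha, smul_neg])

/-- The first triple product, `[[Y_b, X_a], X_c] = X_{raiseTriple b a c}`. -/
noncomputable def raiseTriple (j i : ZMod 2) (b a c : J) : J :=
  (1 / 2 : K) • (jmul K b (jmul K a c) - sgn K j i • jmul K a (jmul K b c)
    - jmul K (jmul K b a) c)

/-- The second triple product, `[[Y_b, X_a], Y_c] = Y_{lowerTriple b a c}`. -/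
noncomputable def lowerTriple (j i : ZMod 2) (b a c : J) : J :=
  (1 / 2 : K) • (jmul K b (jmul K a c) - sgn K j i • jmul K a (jmul K b c)
    + jmul K (jmul K b a) c)

/-- By the previous formulas `[Y_b, X_a]` is half of `[L_b, L_a] - L_{b·a}`, and `L_a` sends `X_c`
to `X_{a·c}` but `Y_c` to `-Y_{a·c}`. The commutator part is thus the same in degrees `1` and `-1`,
while the last term changes sign; this is the only difference between the two triple products. -/
theorem tkkYX_tkkX {i j k : ZMod 2} {a b c : J} (ha : a ∈ gr K (V := J) i)
    (hb : b ∈ gr K (V := J) j) (hc : c ∈ gr K (V := J) k) :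
    sbr K (sbr K (tkkY K b) (tkkX a)) (tkkX c) = tkkX (raiseTriple (K := K) j i b a c) := by
  have h := sbr_jacobi (tkkL_mem_gr (K := K) hb) (tkkL_mem_gr (K := K) ha)
    (tkkX_mem_gr (K := K) hc)
  rw [← sub_eq_iff_eq_add] at h
  rw [tkkY_tkkX ha hb, map_smul, LinearMap.smul_apply, map_sub, LinearMap.sub_apply, ← h,
    tkkL_tkkX, tkkL_tkkX, tkkL_tkkX, tkkL_tkkX, tkkL_tkkX, raiseTriple, map_smul, map_sub, map_sub,
    map_smul]

theorem tkkYX_tkkY {i j k : ZMod 2} {a b c : J} (ha : a ∈ gr K (V := J) i)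
    (hb : b ∈ gr K (V := J) j) (hc : c ∈ gr K (V := J) k) :
    sbr K (sbr K (tkkY K b) (tkkX a)) (tkkY K c) = tkkY K (lowerTriple (K := K) j i b a c) := by
  have h := sbr_jacobi (tkkL_mem_gr (K := K) hb) (tkkL_mem_gr (K := K) ha)
    (tkkY_mem_gr (K := K) hc)
  rw [← sub_eq_iff_eq_add] at h
  rw [tkkY_tkkX ha hb, map_smul, LinearMap.smul_apply, map_sub, LinearMap.sub_apply, ← h,
    tkkL_tkkY ha hc, tkkL_tkkY hb hc, map_neg, map_neg, tkkL_tkkY hb (jmul_mem ha hc),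
    tkkL_tkkY ha (jmul_mem hb hc), tkkL_tkkY (jmul_mem hb ha) hc, lowerTriple, map_smul, map_add,
    map_sub, map_smul]
  module

theorem tkkX_injective : Function.Injective (tkkX (K := K) (J := J)) := fun a b h =>
  congrArg (fun s : TKK K J => s.1.1) h

/-- The components of degrees `1` and `-1` of an element of `Lie(J)`. -/
theorem tkkYX_components {i j : ZMod 2} {a b : J} (ha : a ∈ gr K (V := J) i)
    (hb : b ∈ gr K (V := J) j) :
    (sbr K (tkkY K b) (tkkX a)).1.1 = 0 ∧ (sbr K (tkkY K b) (tkkX a)).1.2.2 = 0 := by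
  rw [coe_sbr, coe_tkkY, coe_tkkX, map_smul, LinearMap.smul_apply, br_inQ_inJ hb ha]
  constructor
  · rw [Prod.smul_fst, Prod.fst_sub, ambientBr_fst (inL_mem_gr hb) (inL_mem_gr ha)]
    simp [inL]
  · rw [Prod.smul_snd, Prod.smul_snd, Prod.snd_sub, Prod.snd_sub, inD_trd hb ha]
    simp [inL]

theorem tkkH_tkkY (b : J) : sbr K (tkkH K J) (tkkY K b) = -tkkY K b := by
  refine homog_induction K (p := fun b => sbr K (tkkH K J) (tkkY K b) = -tkkY K b)
    (fun x y hx hy => by rw [map_add, map_add, hx, hy, neg_add]) (fun i b hb => ?_) b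
  rw [tkkH, tkkL_tkkY jone_mem hb, jone_mul]

variable [CharZero K]

/-- Since `[h, P] = -P`, the element `f = -P` is `[L_e, P]`, that is, twice `Y_e`. This is the
source of the factors `2` below. -/
theorem two_tkkY_one : (2 : K) • tkkY K (jone K J) = tkkF K J := tkk_ext (by
  rw [coe_smul, coe_tkkY, smul_smul, mul_one_div_cancel two_ne_zero, one_smul]
  change _ = -inP K J
  rw [inP_eq, neg_neg])

/-- Evaluation of `[L_a, P]` at `(e, e)` gives `a - 2a = -a`, which recovers `a`. -/
theorem inQ_injective : Function.Injective (fun a : J => (inQ K a).2.2) := by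
  have h : ∀ a : J, (inQ K a).2.2 (jone K J) (jone K J) = -a := by
    intro a
    refine homog_induction K (p := fun a => (inQ K a).2.2 (jone K J) (jone K J) = -a)
      (fun x y hx hy => ?_) (fun i a ha => ?_) a
    · rw [map_add, Prod.snd_add, Prod.snd_add, LinearMap.add_apply, LinearMap.add_apply, hx, hy,
        neg_add]
    · rw [inQ_trd ha jone_mem jone_mem, jone_mul, mul_jone ha, mul_jone ha, jone_mul,
        sgn_zero_right, one_smul]
      abel
  intro a b hab
  have := h a
  rw [show (inQ K a).2.2 = (inQ K b).2.2 from hab, h b] at this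
  exact (neg_injective this).symm

theorem tkkY_injective : Function.Injective (tkkY K (J := J)) := fun a b h => by
  have h' : (1 / 2 : K) • (inQ K a).2.2 = (1 / 2 : K) • (inQ K b).2.2 :=
    congrArg (fun s : TKK K J => s.1.2.2) h
  exact inQ_injective (smul_right_injective _ (one_div_ne_zero two_ne_zero) h')

/-- This explains the normalization of `Y`: the element `-½ [f, [f, b]]`, whose action the
definition of the functor `Lie` prescribes, is exactly `Y_b`. -/
theorem tkkF_tkkF_tkkX (b : J) :
    sbr K (tkkF K J) (sbr K (tkkF K J) (tkkX b)) = -((2 : K) • tkkY K b) := by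
  have h : ∀ s : TKK K J, sbr K (tkkF K J) s = -sbr K s (tkkF K J) :=
    fun s => sbr_skew_even (tkkF_mem_gr K J)
  rw [h (tkkX b), tkkX_tkkF, map_neg, h (tkkL b), neg_neg]
  refine homog_induction K (p := fun b => sbr K (tkkL b) (tkkF K J) = -((2 : K) • tkkY K b))
    (fun x y hx hy => by rw [map_add, map_add, LinearMap.add_apply, hx, hy, map_add, smul_add,
      neg_add]) (fun i b hb => ?_) b
  rw [← two_tkkY_one, map_smul, tkkL_tkkY hb jone_mem, mul_jone hb, smul_neg]

/-- The previous identity, rearranged so that an element of degree `0` acts on some `Y_c`.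
Identities of this shape transfer to other triple pairs. -/
theorem tkkXY_tkkY (b : J) :
    sbr K (sbr K (tkkX b) ((2 : K) • tkkY K (jone K J))) (tkkY K (jone K J)) = -tkkY K b := by
  have h : ∀ s : TKK K J, sbr K (tkkF K J) s = -sbr K s (tkkF K J) :=
    fun s => sbr_skew_even (tkkF_mem_gr K J)
  have e := tkkF_tkkF_tkkX (K := K) b
  rw [h, h, map_neg, LinearMap.neg_apply, neg_neg] at e
  nth_rw 2 [← two_tkkY_one] at e
  rw [map_smul, ← smul_neg] at e
  rw [two_tkkY_one]
  exact smul_right_injective _ (two_ne_zero' K) e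

/-- The elements `X_a`, `Y_b` and `[Y_b, X_a]` span `Lie(J)`. -/
theorem tkk_span (s : TKK K J) : s ∈ Submodule.span K
    ({s | ∃ a : J, s = tkkX a} ∪ {s | ∃ b : J, s = tkkY K b} ∪
      {s | ∃ i j : ZMod 2, ∃ a ∈ gr K (V := J) i, ∃ b ∈ gr K (V := J) j,
        s = sbr K (tkkY K b) (tkkX a)}) := by
  set P := Submodule.span K
    ({s | ∃ a : J, s = tkkX a} ∪ {s | ∃ b : J, s = tkkY K b} ∪
      {s | ∃ i j : ZMod 2, ∃ a ∈ gr K (V := J) i, ∃ b ∈ gr K (V := J) j,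
        s = sbr K (tkkY K b) (tkkX a)}) with hP
  have hYX : ∀ i j : ZMod 2, ∀ a ∈ gr K (V := J) i, ∀ b ∈ gr K (V := J) j,
      sbr K (tkkY K b) (tkkX a) ∈ P := fun i j a ha b hb =>
    Submodule.subset_span (.inr ⟨i, j, a, ha, b, hb, rfl⟩)
  have hL : ∀ i, ∀ a ∈ gr K (V := J) i, tkkL a ∈ P := by
    intro i a ha
    -- `L_a = [a, f] = -[f, a]`, and `f = 2 Y_e`.
    have h : tkkL a = -((2 : K) • sbr K (tkkY K (jone K J)) (tkkX a)) := by
      have h1 := sbr_skew_even (tkkF_mem_gr K J) (y := tkkX a)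
      rw [← LinearMap.smul_apply, ← map_smul, two_tkkY_one, h1, tkkX_tkkF, neg_neg]
    rw [h]
    exact neg_mem (Submodule.smul_mem _ _ (hYX _ _ _ ha _ jone_mem))
  have hD : ∀ i j : ZMod 2, ∀ a ∈ gr K (V := J) i, ∀ b ∈ gr K (V := J) j,
      sbr K (tkkL a) (tkkL b) ∈ P := by
    intro i j a ha b hb
    have h := tkkY_tkkX hb ha
    -- The formula for `[Y_a, X_b]`, solved for the commutator.
    have h2 : sbr K (tkkL a) (tkkL b) = (2 : K) • sbr K (tkkY K a) (tkkX b)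
        + tkkL (jmul K a b) := by
      rw [h, smul_smul, mul_one_div_cancel two_ne_zero, one_smul, sub_add_cancel]
    rw [h2]
    exact add_mem (Submodule.smul_mem _ _ (hYX _ _ _ hb _ ha)) (hL _ _ (jmul_mem ha hb))
  obtain ⟨X, hX⟩ := s
  refine (tkk_induction (p := fun X => ∃ hX : X ∈ tkkSubmodule K J, (⟨X, hX⟩ : TKK K J) ∈ P)
    ⟨zero_mem _, zero_mem P⟩ ?_ ?_ ?_ ?_ ?_ ?_ hX).2
  · rintro X Y ⟨hX, hX'⟩ ⟨hY, hY'⟩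
    exact ⟨add_mem hX hY, add_mem hX' hY'⟩
  · rintro c X ⟨hX, hX'⟩
    exact ⟨Submodule.smul_mem _ c hX, Submodule.smul_mem P c hX'⟩
  · exact fun i a ha => ⟨inJ_mem a, Submodule.subset_span (.inl (.inl ⟨a, rfl⟩))⟩
  · exact fun i a ha => ⟨inL_mem a, hL i a ha⟩
  · exact fun i j a ha b hb => ⟨inD_mem a b, hD i j a ha b hb⟩
  · refine fun i a ha => ⟨inQ_mem a, ?_⟩
    have h : (⟨inQ K a, inQ_mem a⟩ : tkkSubmodule K J) = ((2 : K) • tkkY K a : TKK K J) :=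
      tkk_ext (by rw [coe_smul, coe_tkkY, smul_smul, mul_one_div_cancel two_ne_zero, one_smul])
    exact h ▸ Submodule.smul_mem P _ (Submodule.subset_span (.inl (.inr ⟨a, rfl⟩)))

variable (K J) in
/-- The superalgebra `Lie(J)` is perfect. -/
theorem tkk_perfect (s : TKK K J) :
    s ∈ Submodule.span K {z | ∃ x y : TKK K J, z = sbr K x y} := by
  refine Submodule.span_le.2 ?_ (tkk_span s)
  rintro _ ((⟨a, rfl⟩ | ⟨b, rfl⟩) | ⟨i, j, a, ha, b, hb, rfl⟩)
  -- Elements of degree `±1` are brackets with `h`, which acts on them by `±1`; the remaining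
  -- spanning elements are brackets by their form.
  · exact Submodule.subset_span ⟨_, _, (tkkH_tkkX a).symm⟩
  · refine Submodule.subset_span ⟨tkkH K J, -tkkY K b, ?_⟩
    rw [map_neg, tkkH_tkkY, neg_neg]
  · exact Submodule.subset_span ⟨_, _, rfl⟩

end Generators

/-! ### Homomorphisms from the universal central extension -/

section Triples

variable {K : Type v} [Field K] {J : Type u} [AddCommGroup J] [Module K J] [SuperSpace K J]
  [UnitalJordanSuperalgebra K J] {G : Type u} [AddCommGroup G] [Module K G]
  [SuperSpace K G] [LieSuperalgebra K G]

/-- A pair of families of elements of a Lie superalgebra, indexed by `J`, that satisfies the triple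
relations of the elements `X_a` and `Y_b` of `Lie(J)`. -/
structure IsTriplePair (x y : J →ₗ[K] G) : Prop where
  x_mem : ∀ i, ∀ a ∈ gr K (V := J) i, x a ∈ gr K (V := G) i
  y_mem : ∀ i, ∀ a ∈ gr K (V := J) i, y a ∈ gr K (V := G) i
  x_x : ∀ a b, sbr K (x a) (x b) = 0
  y_y : ∀ a b, sbr K (y a) (y b) = 0
  yx_x : ∀ i j k : ZMod 2, ∀ a ∈ gr K (V := J) i, ∀ b ∈ gr K (V := J) j,
    ∀ c ∈ gr K (V := J) k,
    sbr K (sbr K (y b) (x a)) (x c) = x (raiseTriple (K := K) j i b a c)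
  yx_y : ∀ i j k : ZMod 2, ∀ a ∈ gr K (V := J) i, ∀ b ∈ gr K (V := J) j,
    ∀ c ∈ gr K (V := J) k,
    sbr K (sbr K (y b) (x a)) (y c) = y (lowerTriple (K := K) j i b a c)

theorem pair_apply {A B : Type*} [AddCommGroup A] [Module K A] [AddCommGroup B] [Module K B]
    (f : J →ₗ[K] A) (g : J →ₗ[K] B) (a : J) : (f.prod g) a = (f a, g a) := rfl

theorem sbr_mk {L : Type u} [AddCommGroup L] [Module K L] [SuperSpace K L] [LieSuperalgebra K L]
    (s s' : L) (t t' : G) : sbr K (s, t) (s', t') = (sbr K s s', sbr K t t') := rfl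

/-! ### The subalgebra spanned by a triple pair -/

namespace IsTriplePair

variable {x y : J →ₗ[K] G}

/-- The triple products are computed in `J`, independently of the Lie superalgebra, so the relations
hold in both components with the same index. The subalgebra generated by this diagonal pair is the
central extension to which universality is applied. -/
theorem prod (h : IsTriplePair x y) :
    IsTriplePair ((tkkX (K := K)).prod x) ((tkkY K).prod y) where
  x_mem i a ha := ⟨tkkX_mem_gr ha, h.x_mem i a ha⟩
  y_mem i a ha := ⟨tkkY_mem_gr ha, h.y_mem i a ha⟩
  x_x a b := by rw [pair_apply, pair_apply, sbr_mk, tkkX_tkkX, h.x_x]; rfl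
  y_y a b := by rw [pair_apply, pair_apply, sbr_mk, tkkY_tkkY, h.y_y]; rfl
  yx_x i j k a ha b hb c hc := by
    rw [pair_apply, pair_apply, pair_apply, pair_apply, sbr_mk, sbr_mk, tkkYX_tkkX ha hb hc,
      h.yx_x i j k a ha b hb c hc]
  yx_y i j k a ha b hb c hc := by
    rw [pair_apply, pair_apply, pair_apply, pair_apply, sbr_mk, sbr_mk, tkkYX_tkkY ha hb hc,
      h.yx_y i j k a ha b hb c hc]

/-- The elements `[y_b, x_a]`. -/
def brackets (x y : J →ₗ[K] G) : Set G :=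
  {s | ∃ i j : ZMod 2, ∃ a ∈ gr K (V := J) i, ∃ b ∈ gr K (V := J) j, s = sbr K (y b) (x a)}

/-- The homogeneous generators `x_a`, `y_b` and `[y_b, x_a]`. -/
def gens (x y : J →ₗ[K] G) : Set G :=
  {s | ∃ i, ∃ a ∈ gr K (V := J) i, s = x a} ∪ {s | ∃ i, ∃ b ∈ gr K (V := J) i, s = y b} ∪
    brackets x y

theorem x_mem_span (x y : J →ₗ[K] G) (a : J) : x a ∈ Submodule.span K (gens x y) :=
  homog_induction K (p := fun a => x a ∈ Submodule.span K (gens x y))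
    (fun a b ha hb => by rw [map_add]; exact add_mem ha hb)
    (fun i a ha => Submodule.subset_span (.inl (.inl ⟨i, a, ha, rfl⟩))) a

theorem y_mem_span (x y : J →ₗ[K] G) (a : J) : y a ∈ Submodule.span K (gens x y) :=
  homog_induction K (p := fun a => y a ∈ Submodule.span K (gens x y))
    (fun a b ha hb => by rw [map_add]; exact add_mem ha hb)
    (fun i a ha => Submodule.subset_span (.inl (.inr ⟨i, a, ha, rfl⟩))) a

/-- A decomposition into parts of degrees `1`, `-1` and `0`. No uniqueness is claimed: `G` carries
no such grading, and `x`, `y` need not be injective. -/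
theorem exists_decomp {s : G} (hs : s ∈ Submodule.span K (gens x y)) :
    ∃ a b, ∃ w ∈ Submodule.span K (brackets x y), s = x a + y b + w := by
  induction hs using Submodule.span_induction with
  | mem s hs =>
    rcases hs with (⟨i, a, ha, rfl⟩ | ⟨i, b, hb, rfl⟩) | h
    · exact ⟨a, 0, 0, zero_mem _, by simp⟩
    · exact ⟨0, b, 0, zero_mem _, by simp⟩
    · exact ⟨0, 0, s, Submodule.subset_span h, by simp⟩
  | zero => exact ⟨0, 0, 0, zero_mem _, by simp⟩
  | add s t _ _ hs ht =>
    obtain ⟨a, b, w, hw, rfl⟩ := hs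
    obtain ⟨a', b', w', hw', rfl⟩ := ht
    exact ⟨a + a', b + b', w + w', add_mem hw hw', by rw [map_add, map_add]; abel⟩
  | smul c s _ hs =>
    obtain ⟨a, b, w, hw, rfl⟩ := hs
    exact ⟨c • a, c • b, c • w, Submodule.smul_mem _ _ hw, by
      rw [map_smul, map_smul, smul_add, smul_add]⟩

theorem brackets_homog (h : IsTriplePair x y) : ∀ s ∈ brackets x y, ∃ i, s ∈ gr K (V := G) i := by
  rintro _ ⟨i, j, a, ha, b, hb, rfl⟩
  exact ⟨_, sbr_mem (h.y_mem _ _ hb) (h.x_mem _ _ ha)⟩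

theorem gens_homog (h : IsTriplePair x y) : ∀ s ∈ gens x y, ∃ i, s ∈ gr K (V := G) i := by
  rintro s ((⟨i, a, ha, rfl⟩ | ⟨i, b, hb, rfl⟩) | hs)
  · exact ⟨i, h.x_mem _ _ ha⟩
  · exact ⟨i, h.y_mem _ _ hb⟩
  · exact h.brackets_homog s hs

/-- The degree-zero part preserves the family `x`, by the first triple relation. Only the existence
of an index is recorded, as `w` is a combination of brackets and `c` need not be homogeneous. -/
theorem bracket_x (h : IsTriplePair x y) {w : G} (hw : w ∈ Submodule.span K (brackets x y)) (c : J) :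
    sbr K w (x c) ∈ LinearMap.range x := by
  have hw' : ∀ k, ∀ c ∈ gr K (V := J) k, sbr K w (x c) ∈ LinearMap.range x := by
    intro k c hc
    refine (Submodule.span_le (p := (LinearMap.range x).comap ((sbr K).flip (x c)))).2 ?_ hw
    rintro _ ⟨i, j, a, ha, b, hb, rfl⟩
    exact ⟨_, (h.yx_x i j k a ha b hb c hc).symm⟩
  exact homog_induction K (p := fun c => sbr K w (x c) ∈ LinearMap.range x)
    (fun a b ha hb => by rw [map_add, map_add]; exact add_mem ha hb) hw' c

theorem bracket_y (h : IsTriplePair x y) {w : G} (hw : w ∈ Submodule.span K (brackets x y)) (c : J) :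
    sbr K w (y c) ∈ LinearMap.range y := by
  have hw' : ∀ k, ∀ c ∈ gr K (V := J) k, sbr K w (y c) ∈ LinearMap.range y := by
    intro k c hc
    refine (Submodule.span_le (p := (LinearMap.range y).comap ((sbr K).flip (y c)))).2 ?_ hw
    rintro _ ⟨i, j, a, ha, b, hb, rfl⟩
    exact ⟨_, (h.yx_y i j k a ha b hb c hc).symm⟩
  exact homog_induction K (p := fun c => sbr K w (y c) ∈ LinearMap.range y)
    (fun a b ha hb => by rw [map_add, map_add]; exact add_mem ha hb) hw' c

/-- In `[w, [y_b, x_a]] = [[w, y_b], x_a] ± [y_b, [w, x_a]]` the inner brackets on the right are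
again of the form `y_d` and `x_c`. -/
theorem bracket_bracket (h : IsTriplePair x y) {w w' : G} (hw : w ∈ brackets x y) (hw' : w' ∈ brackets x y) :
    sbr K w w' ∈ Submodule.span K (gens x y) := by
  obtain ⟨k, hk⟩ := h.brackets_homog w hw
  obtain ⟨i, j, a, ha, b, hb, rfl⟩ := hw'
  obtain ⟨c, hc⟩ := h.bracket_x (Submodule.subset_span hw) a
  obtain ⟨d, hd⟩ := h.bracket_y (Submodule.subset_span hw) b
  -- The indices `c` and `d` come without homogeneity, whereas the spanning brackets have
  -- homogeneous indices, so `[y_b, x_a]` is needed for arbitrary `a` and `b`.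
  have key : ∀ a b, sbr K (y b) (x a) ∈ Submodule.span K (gens x y) := by
    intro a b
    refine homog_induction K (p := fun a => sbr K (y b) (x a) ∈ Submodule.span K (gens x y))
      (fun a b ha hb => by rw [map_add, map_add]; exact add_mem ha hb) (fun i a ha => ?_) a
    refine homog_induction K (p := fun b => sbr K (y b) (x a) ∈ Submodule.span K (gens x y))
      (fun a b ha hb => by rw [map_add, map_add, LinearMap.add_apply]; exact add_mem ha hb)
      (fun j b hb => ?_) b
    exact Submodule.subset_span (.inr ⟨i, j, a, ha, b, hb, rfl⟩)
  rw [sbr_jacobi hk (h.y_mem _ _ hb) (h.x_mem _ _ ha), ← hc, ← hd]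
  exact add_mem (key _ _) (Submodule.smul_mem _ _ (key _ _))

/-- The span of the elements `x_a`, `y_b` and `[y_b, x_a]` is a subalgebra. -/
theorem span_closed (h : IsTriplePair x y) {s t : G} (hs : s ∈ Submodule.span K (gens x y))
    (ht : t ∈ Submodule.span K (gens x y)) : sbr K s t ∈ Submodule.span K (gens x y) := by
  refine apply_mem_of_mem_span (sbr K) (fun s hs t ht => ?_) hs ht
  -- Generators are homogeneous, so exchanging the arguments only changes the sign; each mixed case
  -- then needs just one order.
  have swap : sbr K t s ∈ Submodule.span K (gens x y) →
      sbr K s t ∈ Submodule.span K (gens x y) := by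
    obtain ⟨i, hi⟩ := h.gens_homog s hs
    obtain ⟨j, hj⟩ := h.gens_homog t ht
    exact sbr_mem_of_swap hi hj
  rcases hs with (⟨i, a, ha, rfl⟩ | ⟨i, a, ha, rfl⟩) | hs <;>
    rcases ht with (⟨j, b, hb, rfl⟩ | ⟨j, b, hb, rfl⟩) | ht
  · rw [h.x_x]; exact zero_mem _
  · exact swap (Submodule.subset_span (.inr ⟨i, j, a, ha, b, hb, rfl⟩))
  · obtain ⟨c, hc⟩ := h.bracket_x (Submodule.subset_span ht) a
    exact swap (hc ▸ x_mem_span x y c)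
  · exact Submodule.subset_span (.inr ⟨j, i, b, hb, a, ha, rfl⟩)
  · rw [h.y_y]; exact zero_mem _
  · obtain ⟨c, hc⟩ := h.bracket_y (Submodule.subset_span ht) a
    exact swap (hc ▸ y_mem_span x y c)
  · obtain ⟨c, hc⟩ := h.bracket_x (Submodule.subset_span hs) b
    exact hc ▸ x_mem_span x y c
  · obtain ⟨c, hc⟩ := h.bracket_y (Submodule.subset_span hs) b
    exact hc ▸ y_mem_span x y c
  · exact h.bracket_bracket hs ht

/-- A homogeneous element that commutes with all `x_a` and `y_b` commutes with the subalgebra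
spanned by the `x_a`, `y_b` and `[y_b, x_a]`. -/
theorem commutes_span (h : IsTriplePair x y) {i : ZMod 2} {z : G} (hz : z ∈ gr K (V := G) i)
    (hx : ∀ a, sbr K z (x a) = 0) (hy : ∀ b, sbr K z (y b) = 0) {t : G}
    (ht : t ∈ Submodule.span K (gens x y)) : sbr K z t = 0 := by
  refine (Submodule.span_le (p := LinearMap.ker (sbr K z))).2 ?_ ht
  rintro s ((⟨i, a, ha, rfl⟩ | ⟨i, b, hb, rfl⟩) | ⟨i, j, a, ha, b, hb, rfl⟩)
  · exact hx a
  · exact hy b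
  · change sbr K z _ = 0
    rw [sbr_jacobi hz (h.y_mem _ _ hb) (h.x_mem _ _ ha), hx, hy]
    simp

/-! ### Transfer of relations from `Lie(J)` to a triple pair -/

variable [CharZero K]

/-- In an element with parts indexed by `a`, `b` and a combination `w` of brackets, the component in
`Lie(J)` has `a` in degree `1` and `½ [L_b, P]` in degree `-1`, while `w` contributes only in degree
`0`. If this component vanishes, then `a = b = 0`, and the parts in `G` indexed by them vanish as
well. -/
theorem fst_eq_zero {s : TKK K J × G}
    (hs : s ∈ Submodule.span K (gens ((tkkX (K := K)).prod x) ((tkkY K).prod y)))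
    (h0 : s.1 = 0) :
    s ∈ Submodule.span K (brackets ((tkkX (K := K)).prod x) ((tkkY K).prod y)) := by
  obtain ⟨a, b, w, hw, rfl⟩ := exists_decomp hs
  have hw0 : w.1.1.1 = 0 ∧ w.1.1.2.2 = 0 := by
    clear hs h0
    induction hw using Submodule.span_induction with
    | mem w hw =>
      obtain ⟨i, j, a, ha, b, hb, rfl⟩ := hw
      exact tkkYX_components ha hb
    | zero => exact ⟨rfl, rfl⟩
    | add s t _ _ hs ht =>
      rw [Prod.fst_add, coe_add, Prod.fst_add, Prod.snd_add, Prod.snd_add, hs.1, hs.2, ht.1, ht.2,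
        add_zero, add_zero]
      exact ⟨rfl, rfl⟩
    | smul c s _ hs =>
      rw [Prod.smul_fst, coe_smul, Prod.smul_fst, Prod.smul_snd, Prod.smul_snd, hs.1, hs.2,
        smul_zero, smul_zero]
      exact ⟨rfl, rfl⟩
  have e : (tkkX a + tkkY K b + w.1 : TKK K J).1 = 0 := congrArg Subtype.val h0
  rw [coe_add, coe_add, coe_tkkX, coe_tkkY] at e
  have e1 : a = 0 := by
    have := congrArg Prod.fst e
    simpa [hw0.1, inQ_fst, inJ] using this
  have e2 : b = 0 := by
    have := congrArg (fun X => X.2.2) e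
    refine inQ_injective (K := K) ?_
    simpa [hw0.2, inJ] using this
  rw [e1, e2, map_zero, map_zero, zero_add, zero_add]
  exact hw

/-- The transfer principle: `w` preserves the diagonal family, so one index `d'` describes the
result in both components, and the injectivity of `X` identifies it with the `d` read off in
`Lie(J)`. -/
theorem sbr_pair_x (h : IsTriplePair x y) {w : TKK K J × G}
    (hw : w ∈ Submodule.span K (brackets ((tkkX (K := K)).prod x) ((tkkY K).prod y))) {c d : J}
    (hcd : sbr K w.1 (tkkX c) = tkkX d) : sbr K w.2 (x c) = x d := by
  obtain ⟨d', hd'⟩ := h.prod.bracket_x hw c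
  rw [pair_apply, pair_apply, sbr_prod, Prod.ext_iff] at hd'
  have e : tkkX d' = tkkX (K := K) d := hd'.1.trans hcd
  rw [← tkkX_injective e]
  exact hd'.2.symm

theorem sbr_pair_y (h : IsTriplePair x y) {w : TKK K J × G}
    (hw : w ∈ Submodule.span K (brackets ((tkkX (K := K)).prod x) ((tkkY K).prod y))) {c d : J}
    (hcd : sbr K w.1 (tkkY K c) = tkkY K d) : sbr K w.2 (y c) = y d := by
  obtain ⟨d', hd'⟩ := h.prod.bracket_y hw c
  rw [pair_apply, pair_apply, sbr_prod, Prod.ext_iff] at hd'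
  have e : tkkY K d' = tkkY K d := hd'.1.trans hcd
  rw [← tkkY_injective e]
  exact hd'.2.symm

/-- A kernel element is a combination of brackets and acts by zero on `X` and `Y`; by transfer its
second component acts by zero on `x` and `y`. It thus commutes with the generators of the
subalgebra. -/
theorem kernel_central (h : IsTriplePair x y) {s : TKK K J × G}
    (hs : s ∈ Submodule.span K (gens ((tkkX (K := K)).prod x) ((tkkY K).prod y)))
    (h0 : s.1 = 0) {t : TKK K J × G}
    (ht : t ∈ Submodule.span K (gens ((tkkX (K := K)).prod x) ((tkkY K).prod y))) :
    sbr K s t = 0 := by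
  have hodd := oddProj_mem_span h.prod.gens_homog
  have hcen : ∀ i, ∀ s ∈ Submodule.span K (gens ((tkkX (K := K)).prod x) ((tkkY K).prod y)),
      s ∈ gr K (V := TKK K J × G) i → s.1 = 0 → sbr K s t = 0 := by
    intro i s hs hi h0
    have hw := fst_eq_zero hs h0
    refine h.prod.commutes_span hi (fun a => ?_) (fun b => ?_) ht
    · have e := h.sbr_pair_x hw (c := a) (d := 0)
        (by rw [h0, map_zero, map_zero, LinearMap.zero_apply])
      rw [pair_apply, sbr_prod, h0, e, map_zero, map_zero, LinearMap.zero_apply]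
      rfl
    · have e := h.sbr_pair_y hw (c := b) (d := 0)
        (by rw [h0, map_zero, map_zero, LinearMap.zero_apply])
      rw [pair_apply, sbr_prod, h0, e, map_zero, map_zero, LinearMap.zero_apply]
      rfl
  -- The commutation argument uses the Jacobi identity and so needs a homogeneous element. The even
  -- and odd parts of `s` are again in the subalgebra and in the kernel.
  have e1 : (oddProj K s).1 = 0 := by
    have := map_oddProj_of_even (K := K) (f := LinearMap.fst K (TKK K J) G)
      (fun i x hx => ((mem_gr_prod K).1 hx).1) s
    rw [LinearMap.fst_apply, LinearMap.fst_apply] at this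
    rw [this, h0, map_zero]
  have e2 : (s - oddProj K s).1 = 0 := by rw [Prod.fst_sub, h0, e1, sub_zero]
  rw [← sub_add_cancel s (oddProj K s), map_add, LinearMap.add_apply,
    hcen 0 _ (sub_mem hs (hodd s hs)) (sub_oddProj_mem K s) e2,
    hcen 1 _ (hodd s hs) (oddProj_mem K s) e1, add_zero]

theorem fst_surjective (h : IsTriplePair x y) (s : TKK K J) :
    ∃ t ∈ Submodule.span K (gens ((tkkX (K := K)).prod x) ((tkkY K).prod y)), t.1 = s := by
  refine (Submodule.span_le (p := (Submodule.span K (gens ((tkkX (K := K)).prod x)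
    ((tkkY K).prod y))).map (LinearMap.fst K (TKK K J) G))).2 ?_ (tkk_span s)
  rintro _ ((⟨a, rfl⟩ | ⟨b, rfl⟩) | ⟨i, j, a, ha, b, hb, rfl⟩)
  · exact ⟨_, x_mem_span _ _ a, rfl⟩
  · exact ⟨_, y_mem_span _ _ b, rfl⟩
  · exact ⟨_, Submodule.subset_span (.inr ⟨i, j, a, ha, b, hb, rfl⟩), rfl⟩

/-- A lift of the element `h` of `Lie(J)` to `Lie(J) × G`. -/
theorem exists_grading (h : IsTriplePair x y) :
    ∃ w ∈ Submodule.span K (brackets ((tkkX (K := K)).prod x) ((tkkY K).prod y)),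
      w.1 = tkkH K J := by
  -- The witness comes from `h = [e, f] = -[f, e]` and `f = 2 Y_e`.
  refine ⟨-((2 : K) • sbr K ((tkkY K).prod y (jone K J)) ((tkkX (K := K)).prod x (jone K J))),
    neg_mem (Submodule.smul_mem _ _ (Submodule.subset_span
      ⟨0, 0, _, jone_mem, _, jone_mem, rfl⟩)), ?_⟩
  rw [pair_apply, pair_apply, sbr_mk, Prod.fst_neg, Prod.smul_fst, ← LinearMap.smul_apply,
    ← map_smul, two_tkkY_one, sbr_skew_even (tkkF_mem_gr K J), tkkX_tkkF, neg_neg]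
  rfl

theorem brackets_subset (x y : J →ₗ[K] G) :
    Submodule.span K (brackets x y) ≤ Submodule.span K (gens x y) :=
  Submodule.span_mono fun _ hs => .inr hs

/-- The identity `[f, [f, b]] = -2 Y_b`, transferred from `Lie(J)` to any triple pair; it computes
the action of `[f̂, [f̂, b̂]]` on `Lie(M)`. -/
theorem y_one_y_one_x (h : IsTriplePair x y) (b : J) :
    sbr K ((2 : K) • y (jone K J)) (sbr K ((2 : K) • y (jone K J)) (x b)) = -((2 : K) • y b) := by
  have h4 : sbr K ((tkkX (K := K)).prod x b) ((2 : K) • (tkkY K).prod y (jone K J)) ∈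
      Submodule.span K (brackets ((tkkX (K := K)).prod x) ((tkkY K).prod y)) := by
    rw [map_smul]
    refine Submodule.smul_mem _ _ (homog_induction K
      (p := fun b => sbr K ((tkkX (K := K)).prod x b) ((tkkY K).prod y (jone K J)) ∈
        Submodule.span K (brackets ((tkkX (K := K)).prod x) ((tkkY K).prod y)))
      (fun a b ha hb => ?_) (fun i b hb => ?_) b)
    · rw [map_add, map_add, LinearMap.add_apply]; exact add_mem ha hb
    · exact sbr_mem_of_swap (h.prod.x_mem i b hb) (h.prod.y_mem 0 _ jone_mem)
        (Submodule.subset_span ⟨i, 0, b, hb, _, jone_mem, rfl⟩)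
  have h5 : ∀ s, sbr K ((2 : K) • y (jone K J)) s = -sbr K s ((2 : K) • y (jone K J)) :=
    fun s => sbr_skew_even (Submodule.smul_mem _ _ (h.y_mem 0 _ jone_mem))
  rw [pair_apply, pair_apply, Prod.smul_mk, sbr_mk] at h4
  have h6 := h.sbr_pair_y h4 (c := jone K J) (d := -b) (by rw [tkkXY_tkkY, map_neg])
  rw [map_neg] at h6
  rw [h5, h5, map_neg, LinearMap.neg_apply, neg_neg]
  refine (map_smul (sbr K (sbr K (x b) ((2 : K) • y (jone K J)))) (2 : K) _).trans ?_
  rw [h6, smul_neg]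

/-- A pair of families in a Lie superalgebra `G` that satisfies the triple relations defines a
homomorphism from a universal central extension of `Lie(J)` to `G`. -/
theorem exists_hom (h : IsTriplePair x y) {E : Type u} [AddCommGroup E] [Module K E]
    [SuperSpace K E] [LieSuperalgebra K E] {π : E →ₗ[K] TKK K J}
    (hπ : IsUniversalCentralExtension π) :
    ∃ ρ : E →ₗ[K] G, IsLieHom ρ ∧ (∀ a, ρ (hatX hπ.toIsCentralExtension a) = x a) ∧
      ρ (hatF hπ.toIsCentralExtension) = (2 : K) • y (jone K J) := by
  obtain ⟨ρ, hρ, hρS⟩ := hπ.exists_hom (oddProj_mem_span h.prod.gens_homog)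
    (fun s hs t ht => h.prod.span_closed hs ht) h.fst_surjective
    (fun s hs h0 t ht => h.kernel_central hs h0 ht)
  obtain ⟨w, hw, hw1⟩ := h.exists_grading
  have hwS := brackets_subset _ _ hw
  refine ⟨ρ, hρ, fun a => ?_, ?_⟩
  -- `â` is the bracket of lifts of `h` and `a`, so `ρ` sends it to the bracket of the second
  -- component of `w` with `x_a`. Transfer of `[h, a] = a` shows that this is `x_a`.
  · have h1 := hρS w hwS _ (x_mem_span _ _ a)
    rw [hw1, pair_apply] at h1
    exact h1.trans (h.sbr_pair_x hw (by rw [hw1, tkkH_tkkX]))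
  -- The same for `f = 2 Y_e` with eigenvalue `-1`; the sign is absorbed by the one in the
  -- definition of `f̂`.
  · have h1 := hρS w hwS _ (Submodule.smul_mem _ (2 : K) (y_mem_span _ _ (jone K J)))
    rw [hw1, pair_apply, Prod.smul_mk, two_tkkY_one, map_smul,
      h.sbr_pair_y hw (c := jone K J) (d := -jone K J) (by rw [hw1, tkkH_tkkY, map_neg])] at h1
    rw [hatF, map_neg, h1, map_neg, smul_neg, neg_neg]

end IsTriplePair

end Triples

/-! ### Special modules as modules over the universal central extension -/

section LieOperators

variable {K : Type v} [Field K] {J : Type u} [AddCommGroup J] [Module K J] [SuperSpace K J]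
  [UnitalJordanSuperalgebra K J]

namespace SpecialModule

variable (M : SpecialModule K J)

theorem nullSplitMul_left_left (a b : J) :
    nullSplitMul M.act (a, 0) (b, 0) = (jmul K a b, 0) :=
  Prod.ext rfl (by change M.act a 0 + sflip M.act 0 b = 0; simp)

theorem nullSplitMul_left_right (a : J) (m : M.carrier) :
    nullSplitMul M.act (a, 0) (0, m) = (0, M.act a m) :=
  Prod.ext (by change jmul K a 0 = 0; simp)
    (by change M.act a m + sflip M.act 0 0 = M.act a m; simp)

theorem nullSplitMul_right_left {i j : ZMod 2} {a : J} {m : M.carrier}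
    (hm : m ∈ gr K (V := M.carrier) i) (ha : a ∈ gr K (V := J) j) :
    nullSplitMul M.act (0, m) (a, 0) = (0, sgn K j i • M.act a m) :=
  Prod.ext (by change jmul K 0 a = 0; simp)
    (by change M.act 0 0 + sflip M.act m a = _; rw [sflip_apply M.act ha hm]; simp)

theorem act_mem {i j : ZMod 2} {a : J} {m : M.carrier} (ha : a ∈ gr K (V := J) i)
    (hm : m ∈ gr K (V := M.carrier) j) : M.act a m ∈ gr K (V := M.carrier) (i + j) := by
  have h := M.isBimodule.mul_mem (i := i) (j := j) (a := (a, 0)) (b := (0, m))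
    ⟨ha, zero_mem _⟩ ⟨zero_mem _, hm⟩
  rw [nullSplitMul_left_right] at h
  exact h.2

/-- On a special module, the Jordan product acts as the (unnormalized) super anticommutator. -/
theorem act_jmul [CharZero K] {i j : ZMod 2} {a b : J} (ha : a ∈ gr K (V := J) i)
    (hb : b ∈ gr K (V := J) j) (m : M.carrier) :
    M.act (jmul K a b) m = M.act a (M.act b m) + sgn K i j • M.act b (M.act a m) := by
  refine homog_induction K (p := fun m => M.act (jmul K a b) m =
    M.act a (M.act b m) + sgn K i j • M.act b (M.act a m)) (fun m n hm hn => ?_)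
    (fun l m hm => ?_) m
  · simp only [map_add, hm, hn, smul_add]; abel
  -- With third argument `e` and fourth argument `m`, the Jordan identity reads, up to signs, `(ab)m
  -- + ½ b(am) + ½ a(bm) = ½ (ab)m + a(bm) + b(am)`, because `e` acts by `½`. This is half of the
  -- claim.
  have h := M.isBimodule.jordan (i := i) (j := j) (k := 0) (l := l) (a := (a, 0)) (b := (b, 0))
    (c := (jone K J, 0)) (d := (0, m)) ⟨ha, zero_mem _⟩ ⟨hb, zero_mem _⟩
    ⟨jone_mem, zero_mem _⟩ ⟨zero_mem _, hm⟩
  simp only [nullSplitMul_left_left, nullSplitMul_left_right, jone_mul,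
    mul_jone (jmul_mem ha hb), mul_jone ha, mul_jone hb,
    M.nullSplitMul_right_left (M.act_mem ha hm) jone_mem,
    M.nullSplitMul_right_left (M.act_mem hb hm) jone_mem, sgn_zero_left, sgn_zero_right, one_smul,
    M.act_one, M.nullSplitMul_right_left (Submodule.smul_mem _ (1 / 2 : K) (M.act_mem ha hm)) hb,
    M.nullSplitMul_right_left (Submodule.smul_mem _ (1 / 2 : K) (M.act_mem hb hm)) ha,
    M.nullSplitMul_right_left (M.act_mem ha hm) hb] at h
  have h2 := congrArg Prod.snd h
  simp only [Prod.snd_add, Prod.smul_snd, map_smul] at h2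
  clear h
  refine smul_right_injective _ (one_div_ne_zero (two_ne_zero' K)) ?_
  change (1 / 2 : K) • _ = (1 / 2 : K) • _
  rcases zmod2_cases i with rfl | rfl <;> rcases zmod2_cases j with rfl | rfl <;>
  rcases zmod2_cases l with rfl | rfl <;>
  simp only [sgn_zero_left, sgn_zero_right, sgn_one_one, zmod2_one_add_one, add_zero, zero_add,
    one_smul, neg_smul, mul_one, mul_neg, neg_neg] at h2 ⊢ <;>
  linear_combination (norm := module) h2

/-- The operator `(m₁, m₂) ↦ (0, a ∘ m₁)` on `M ⊕ M`. -/
noncomputable def raise : J →ₗ[K] (M.carrier × M.carrier) →ₗ[K] (M.carrier × M.carrier) :=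
  LinearMap.mk₂ K (fun a m => (0, M.act a m.1))
    (fun a b m => Prod.ext (by simp) (by simp)) (fun c a m => Prod.ext (by simp) (by simp))
    (fun a m n => Prod.ext (by simp) (by simp)) (fun c a m => Prod.ext (by simp) (by simp))

/-- The operator `(m₁, m₂) ↦ (b ∘ m₂, 0)` on `M ⊕ M`. -/
noncomputable def lower : J →ₗ[K] (M.carrier × M.carrier) →ₗ[K] (M.carrier × M.carrier) :=
  LinearMap.mk₂ K (fun b m => (M.act b m.2, 0))
    (fun a b m => Prod.ext (by simp) (by simp)) (fun c a m => Prod.ext (by simp) (by simp))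
    (fun a m n => Prod.ext (by simp) (by simp)) (fun c a m => Prod.ext (by simp) (by simp))

theorem raise_apply (a : J) (m : M.carrier × M.carrier) : M.raise a m = (0, M.act a m.1) := rfl

theorem lower_apply (b : J) (m : M.carrier × M.carrier) : M.lower b m = (M.act b m.2, 0) := rfl

theorem raise_mem {i : ZMod 2} {a : J} (ha : a ∈ gr K (V := J) i) :
    M.raise a ∈ gr K (V := (M.carrier × M.carrier) →ₗ[K] (M.carrier × M.carrier)) i :=
  fun _ _ hm => ⟨zero_mem _, M.act_mem ha hm.1⟩

theorem lower_mem {i : ZMod 2} {a : J} (ha : a ∈ gr K (V := J) i) :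
    M.lower a ∈ gr K (V := (M.carrier × M.carrier) →ₗ[K] (M.carrier × M.carrier)) i :=
  fun _ _ hm => ⟨M.act_mem ha hm.2, zero_mem _⟩

/-- Two raisings or two lowerings compose to zero because they factor through the missing copy of
`M`. For the triple relations, both sides become cubic words in the operators of `J` on `M`: up to
signs of parity, `-(abc + cba)` for raising and `bac + cab` for lowering, once the anticommutator
relation has expanded the Jordan products. -/
theorem isTriplePair [CharZero K] : IsTriplePair M.raise M.lower where
  x_mem _ _ ha := M.raise_mem ha
  y_mem _ _ ha := M.lower_mem ha
  x_x a b := by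
    revert b
    refine homog_induction K (p := fun a => ∀ b, sbr K (M.raise a) (M.raise b) = 0)
      (fun a a' h h' b => by simp [h, h']) (fun i a ha => ?_) a
    refine homog_induction K (fun b b' h h' => by simp [h, h']) (fun j b hb => ?_)
    refine LinearMap.ext fun m => ?_
    simp [sbr_end (M.raise_mem ha) (M.raise_mem hb), raise_apply]
  y_y a b := by
    revert b
    refine homog_induction K (p := fun a => ∀ b, sbr K (M.lower a) (M.lower b) = 0)
      (fun a a' h h' b => by simp [h, h']) (fun i a ha => ?_) a
    refine homog_induction K (fun b b' h h' => by simp [h, h']) (fun j b hb => ?_)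
    refine LinearMap.ext fun m => ?_
    simp [sbr_end (M.lower_mem ha) (M.lower_mem hb), lower_apply]
  yx_x i j k a ha b hb c hc := by
    refine LinearMap.ext fun m => ?_
    rw [sbr_end (sbr_mem (M.lower_mem hb) (M.raise_mem ha)) (M.raise_mem hc)]
    simp only [sbr_end (M.lower_mem hb) (M.raise_mem ha), raise_apply, lower_apply, raiseTriple]
    refine Prod.ext (by simp) ?_
    simp only [Prod.snd_sub, Prod.smul_snd, Prod.fst_sub, Prod.smul_fst, map_sub, map_smul,
      map_neg, map_zero, smul_zero, sub_zero, zero_sub, LinearMap.sub_apply, LinearMap.smul_apply,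
      M.act_jmul hb (jmul_mem ha hc), M.act_jmul ha (jmul_mem hb hc),
      M.act_jmul (jmul_mem hb ha) hc, M.act_jmul ha hc, M.act_jmul hb hc, M.act_jmul hb ha,
      map_add]
    rcases zmod2_cases i with rfl | rfl <;> rcases zmod2_cases j with rfl | rfl <;>
    rcases zmod2_cases k with rfl | rfl <;>
    simp only [sgn_zero_left, sgn_zero_right, sgn_one_one, zmod2_one_add_one, add_zero, zero_add] <;>
    module
  yx_y i j k a ha b hb c hc := by
    refine LinearMap.ext fun m => ?_
    rw [sbr_end (sbr_mem (M.lower_mem hb) (M.raise_mem ha)) (M.lower_mem hc)]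
    simp only [sbr_end (M.lower_mem hb) (M.raise_mem ha), raise_apply, lower_apply, lowerTriple]
    refine Prod.ext ?_ (by simp)
    simp only [Prod.snd_sub, Prod.smul_snd, Prod.fst_sub, Prod.smul_fst, map_sub, map_smul,
      map_neg, map_zero, smul_zero, sub_zero, zero_sub, LinearMap.sub_apply, LinearMap.smul_apply,
      M.act_jmul hb (jmul_mem ha hc), M.act_jmul ha (jmul_mem hb hc),
      M.act_jmul (jmul_mem hb ha) hc, M.act_jmul ha hc, M.act_jmul hb hc, M.act_jmul hb ha,
      map_add, LinearMap.add_apply]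
    rcases zmod2_cases i with rfl | rfl <;> rcases zmod2_cases j with rfl | rfl <;>
    rcases zmod2_cases k with rfl | rfl <;>
    simp only [sgn_zero_left, sgn_zero_right, sgn_one_one, zmod2_one_add_one, add_zero, zero_add] <;>
    module

end SpecialModule

end LieOperators

/-! ### Generation of the universal central extension by `f̂` and all `â` -/

section Modules

variable {K : Type v} [Field K] [CharZero K] {J : Type u} [AddCommGroup J] [Module K J]
  [SuperSpace K J] [UnitalJordanSuperalgebra K J] {E : Type u} [AddCommGroup E] [Module K E]
  [SuperSpace K E] [LieSuperalgebra K E] {π : E →ₗ[K] TKK K J}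

/-- The universal central extension of `Lie(J)` is generated by the elements `â` and `f̂`. -/
theorem IsUniversalCentralExtension.span_eq_top (hπ : IsUniversalCentralExtension π) {C : Set E}
    (homog : ∀ s ∈ C, ∃ i, s ∈ gr K (V := E) i) (hbr : ∀ s ∈ C, ∀ t ∈ C, sbr K s t ∈ C)
    (hX : ∀ i, ∀ a ∈ gr K (V := J) i, hatX hπ.toIsCentralExtension a ∈ C)
    (hF : hatF hπ.toIsCentralExtension ∈ C) : Submodule.span K C = ⊤ := by
  have hY : ∀ b, tkkY K b = (-(1 / 2) : K) • sbr K (tkkF K J) (sbr K (tkkF K J) (tkkX b)) := by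
    intro b
    rw [tkkF_tkkF_tkkX]
    module
  have hCX : ∀ a, tkkX a ∈ Submodule.span K (π '' C) := by
    intro a
    refine homog_induction K (p := fun a => tkkX a ∈ Submodule.span K (π '' C))
      (fun a b ha hb => by rw [map_add]; exact add_mem ha hb) (fun i a ha => ?_) a
    exact Submodule.subset_span ⟨_, hX i a ha, map_hatX _ a⟩
  have hπC : ∀ s ∈ Submodule.span K (π '' C), ∀ t ∈ Submodule.span K (π '' C),
      sbr K s t ∈ Submodule.span K (π '' C) := by
    intro s hs t ht
    refine apply_mem_of_mem_span (sbr K) ?_ hs ht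
    rintro _ ⟨s, hs, rfl⟩ _ ⟨t, ht, rfl⟩
    exact Submodule.subset_span ⟨_, hbr s hs t ht, hπ.map_bracket s t⟩
  have hCF : tkkF K J ∈ Submodule.span K (π '' C) :=
    Submodule.subset_span ⟨_, hF, map_hatF _⟩
  have hCY : ∀ b, tkkY K b ∈ Submodule.span K (π '' C) := fun b => by
    rw [hY]
    exact Submodule.smul_mem _ _ (hπC _ hCF _ (hπC _ hCF _ (hCX b)))
  -- The image of `C` spans `Lie(J)`: it contains `f` and, up to linear combinations, all `X_a`,
  -- hence `Y_b = -½ [f, [f, b]]`, hence the brackets of the two.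
  have htop : ∀ s, s ∈ Submodule.span K (π '' C) := by
    intro s
    refine (Submodule.span_le (p := Submodule.span K (π '' C))).2 ?_ (tkk_span s)
    rintro _ ((⟨a, rfl⟩ | ⟨b, rfl⟩) | ⟨i, j, a, ha, b, hb, rfl⟩)
    · exact hCX a
    · exact hCY b
    · exact hπC _ (hCY b) _ (hCX a)
  -- Brackets in `E` depend only on the images in `Lie(J)`, which are combinations of elements of
  -- `π(C)`. So the span of `C` contains all brackets, and perfectness disposes of the kernel.
  refine hπ.perfect (fun s t => ?_) (oddProj_mem_span homog)
  rw [sbr_eq_liftBr hπ.toIsCentralExtension]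
  refine apply_mem_of_mem_span (liftBr hπ.toIsCentralExtension) ?_ (htop _) (htop _)
  rintro _ ⟨s, hs, rfl⟩ _ ⟨t, ht, rfl⟩
  rw [← sbr_eq_liftBr]
  exact Submodule.subset_span (hbr s hs t ht)

/-- A linear map between modules over the universal central extension commutes with the action if
it commutes with `f̂` and all `â`. -/
theorem IsUniversalCentralExtension.commutes (hπ : IsUniversalCentralExtension π)
    {V W : VeryShortModule hπ.toIsCentralExtension} (f : V.carrier →ₗ[K] W.carrier)
    (hX : ∀ a m, f (V.act (hatX hπ.toIsCentralExtension a) m) =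
      W.act (hatX hπ.toIsCentralExtension a) (f m))
    (hF : ∀ m, f (V.act (hatF hπ.toIsCentralExtension) m) =
      W.act (hatF hπ.toIsCentralExtension) (f m)) (s : E) (m : V.carrier) :
    f (V.act s m) = W.act s (f m) := by
  -- Homogeneity is built into the set because the module axiom for a bracket is stated for
  -- homogeneous elements.
  have hs : s ∈ Submodule.span K {s : E | (∃ i, s ∈ gr K (V := E) i) ∧
      ∀ m, f (V.act s m) = W.act s (f m)} := by
    have htop := hπ.span_eq_top (C := {s : E | (∃ i, s ∈ gr K (V := E) i) ∧
      ∀ m, f (V.act s m) = W.act s (f m)}) (fun s hs => hs.1) ?_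
      (fun i a ha => ⟨⟨i, hatX_mem_gr _ ha⟩, hX a⟩) ⟨⟨0, hatF_mem_gr _⟩, hF⟩
    · rw [htop]; trivial
    · rintro s ⟨⟨i, hi⟩, hs⟩ t ⟨⟨j, hj⟩, ht⟩
      refine ⟨⟨_, sbr_mem hi hj⟩, fun m => ?_⟩
      rw [V.act_bracket hi hj, W.act_bracket hi hj, map_sub, map_smul, hs, ht, ht, hs]
  induction hs using Submodule.span_induction with
  | mem s hs => exact hs.2 m
  | zero => simp
  | add s t _ _ hs ht => rw [map_add, map_add, LinearMap.add_apply, LinearMap.add_apply, map_add, hs, ht]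
  | smul c s _ hs => rw [map_smul, map_smul, LinearMap.smul_apply, LinearMap.smul_apply, map_smul, hs]

/-- Two exchanges turn the left side into `[[ê, f̂], f̂] = [ĥ, f̂]`. It recovers `f̂` from the
operators that the definition of `Lie` prescribes. -/
theorem hatF_hatF_hatE (hπ : IsCentralExtension π) :
    sbr K (hatF hπ) (sbr K (hatF hπ) (hatX hπ (jone K J))) = -hatF hπ := by
  rw [sbr_skew_even (hatF_mem_gr hπ) (y := hatX hπ (jone K J)), map_neg,
    sbr_skew_even (hatF_mem_gr hπ), neg_neg]
  exact hatH_hatF hπ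

/-! ### The functor `Lie` -/

section LieFunctor

variable (hπ : IsUniversalCentralExtension π)

/-- The action of the universal central extension on `M ⊕ M`. -/
noncomputable def lieAct (M : SpecialModule K J) :
    E →ₗ[K] (M.carrier × M.carrier) →ₗ[K] (M.carrier × M.carrier) :=
  (M.isTriplePair.exists_hom hπ).choose

theorem lieAct_isLieHom (M : SpecialModule K J) : IsLieHom (lieAct hπ M) :=
  (M.isTriplePair.exists_hom hπ).choose_spec.1

theorem lieAct_hatX (M : SpecialModule K J) (a : J) :
    lieAct hπ M (hatX hπ.toIsCentralExtension a) = M.raise a :=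
  (M.isTriplePair.exists_hom hπ).choose_spec.2.1 a

theorem lieAct_hatF (M : SpecialModule K J) :
    lieAct hπ M (hatF hπ.toIsCentralExtension) = (2 : K) • M.lower (jone K J) :=
  (M.isTriplePair.exists_hom hπ).choose_spec.2.2

/-- The factor `2` in `f = 2 Y_e` cancels the `½` by which `e` acts on `M`. -/
theorem lieAct_hatF_apply (M : SpecialModule K J) (m : M.carrier × M.carrier) :
    lieAct hπ M (hatF hπ.toIsCentralExtension) m = (m.2, 0) := by
  rw [lieAct_hatF, LinearMap.smul_apply, M.lower_apply, M.act_one]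
  simp

theorem lieAct_bracket (M : SpecialModule K J) {i j : ZMod 2} {s t : E}
    (hs : s ∈ gr K (V := E) i) (ht : t ∈ gr K (V := E) j) (m : M.carrier × M.carrier) :
    lieAct hπ M (sbr K s t) m =
      lieAct hπ M s (lieAct hπ M t m) - sgn K i j • lieAct hπ M t (lieAct hπ M s m) := by
  rw [(lieAct_isLieHom hπ M).map_bracket, sbr_end ((lieAct_isLieHom hπ M).even i s hs)
    ((lieAct_isLieHom hπ M).even j t ht)]

/-- Computed as the commutator of `ê : (m₁, m₂) ↦ (0, ½ m₁)` and `f̂ : (m₁, m₂) ↦ (m₂, 0)`. The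
second copy of `M` is therefore the one of weight `½`. -/
theorem lieAct_hatH_apply (M : SpecialModule K J) (m : M.carrier × M.carrier) :
    lieAct hπ M (hatH hπ.toIsCentralExtension) m =
      (-((1 / 2 : K) • m.1), (1 / 2 : K) • m.2) := by
  rw [hatH, hatE, lieAct_bracket hπ M (hatX_mem_gr _ jone_mem) (hatF_mem_gr _), lieAct_hatX,
    lieAct_hatF_apply, lieAct_hatF_apply, M.raise_apply, M.raise_apply, M.act_one, M.act_one]
  simp [sgn_zero_left]

/-- The module `Lie(M) = M ⊕ M`. -/
noncomputable def lieObj (M : SpecialModule K J) : VeryShortModule hπ.toIsCentralExtension where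
  carrier := M.carrier × M.carrier
  act := lieAct hπ M
  act_mem hs hm := (lieAct_isLieHom hπ M).even _ _ hs _ _ hm
  act_bracket hs ht m := lieAct_bracket hπ M hs ht m
  veryShort := by
    rw [eq_top_iff]
    rintro ⟨m₁, m₂⟩ -
    refine Submodule.mem_sup.2 ⟨(0, m₂), ?_, (m₁, 0), ?_, by simp⟩
    · rw [Module.End.mem_eigenspace_iff]
      exact (lieAct_hatH_apply hπ M _).trans (by simp)
    · rw [Module.End.mem_eigenspace_iff]
      exact (lieAct_hatH_apply hπ M _).trans (by simp)

/-- The functor `Lie`. -/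
noncomputable def lieFunctor : SpecialModule K J ⥤ VeryShortModule hπ.toIsCentralExtension where
  obj := lieObj hπ
  map {M N} φ :=
    { toLin := LinearMap.prodMap (SpecialModule.Hom.toLin φ) (SpecialModule.Hom.toLin φ)
      even := fun i m hm => ⟨SpecialModule.Hom.even φ i _ hm.1, SpecialModule.Hom.even φ i _ hm.2⟩
      map_act := by
        refine hπ.commutes (V := lieObj hπ M) (W := lieObj hπ N)
          (LinearMap.prodMap (SpecialModule.Hom.toLin φ) (SpecialModule.Hom.toLin φ))
          (fun a (m : M.carrier × M.carrier) => ?_) (fun (m : M.carrier × M.carrier) => ?_)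
        · change LinearMap.prodMap _ _ (lieAct hπ M _ m) = lieAct hπ N _ (LinearMap.prodMap _ _ m)
          rw [lieAct_hatX, lieAct_hatX, M.raise_apply, N.raise_apply]
          exact Prod.ext (map_zero (SpecialModule.Hom.toLin φ)) (SpecialModule.Hom.map_act φ _ _)
        · change LinearMap.prodMap _ _ (lieAct hπ M _ m) = lieAct hπ N _ (LinearMap.prodMap _ _ m)
          rw [lieAct_hatF_apply, lieAct_hatF_apply]
          exact Prod.ext rfl (map_zero (SpecialModule.Hom.toLin φ)) }

theorem isLieFunctor_lieFunctor : IsLieFunctor (lieFunctor hπ) := by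
  refine ⟨fun M => LinearEquiv.refl K _, fun M i m₁ m₂ h₁ h₂ => ⟨h₁, h₂⟩, fun M a m₁ m₂ => ?_,
    fun M b m₁ m₂ => ?_, fun M N φ m₁ m₂ => rfl⟩
  · change lieAct hπ M _ (m₁, m₂) = _
    rw [lieAct_hatX]
    rfl
  · change lieAct hπ M _ (m₁, m₂) = _
    have h := lieAct_isLieHom hπ M
    -- The double bracket acts as `-2` times the lowering operator of `b`, which the factor `-½`
    -- normalizes.
    rw [map_smul, h.map_bracket, h.map_bracket, lieAct_hatF, lieAct_hatX,
      M.isTriplePair.y_one_y_one_x, smul_neg, neg_smul, neg_neg, smul_smul,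
      one_div_mul_cancel two_ne_zero, one_smul]
    rfl

end LieFunctor

end Modules

/-! ### The equivalence -/

section Equivalence

variable {K : Type v} [Field K] {J : Type u} [AddCommGroup J] [Module K J]
  [SuperSpace K J] [UnitalJordanSuperalgebra K J] {E : Type u} [AddCommGroup E] [Module K E]
  [SuperSpace K E] [LieSuperalgebra K E] {π : E →ₗ[K] TKK K J}

/-- A bijective morphism of special modules is an isomorphism. -/
noncomputable def SpecialModule.isoOfBijective {M N : SpecialModule K J} (φ : M ⟶ N)
    (hφ : Function.Bijective (SpecialModule.Hom.toLin φ)) : M ≅ N where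
  hom := φ
  inv :=
    { toLin := (LinearEquiv.ofBijective (SpecialModule.Hom.toLin φ) hφ).symm.toLinearMap
      even := fun i n hn => by
        refine mem_gr_of_even_injective hφ.1 (SpecialModule.Hom.even φ) ?_
        exact ((LinearEquiv.ofBijective _ hφ).apply_symm_apply n).symm ▸ hn
      map_act := fun a n => by
        refine hφ.1 ?_
        rw [SpecialModule.Hom.map_act φ]
        exact ((LinearEquiv.ofBijective _ hφ).apply_symm_apply _).trans
          (congrArg _ ((LinearEquiv.ofBijective _ hφ).apply_symm_apply n).symm) }
  hom_inv_id := SpecialModule.Hom.ext (LinearMap.ext fun m =>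
    (LinearEquiv.ofBijective _ hφ).symm_apply_apply m)
  inv_hom_id := SpecialModule.Hom.ext (LinearMap.ext fun m =>
    (LinearEquiv.ofBijective _ hφ).apply_symm_apply m)

namespace VeryShortModule

/-- A bijective morphism of modules with a very short grading is an isomorphism. -/
noncomputable def isoOfBijective {hπ : IsCentralExtension π} {V W : VeryShortModule hπ}
    (φ : V ⟶ W) (hφ : Function.Bijective (VeryShortModule.Hom.toLin φ)) : V ≅ W where
  hom := φ
  inv :=
    { toLin := (LinearEquiv.ofBijective (VeryShortModule.Hom.toLin φ) hφ).symm.toLinearMap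
      even := fun i n hn => by
        refine mem_gr_of_even_injective hφ.1 (VeryShortModule.Hom.even φ) ?_
        exact ((LinearEquiv.ofBijective _ hφ).apply_symm_apply n).symm ▸ hn
      map_act := fun a n => by
        refine hφ.1 ?_
        rw [VeryShortModule.Hom.map_act φ]
        exact ((LinearEquiv.ofBijective _ hφ).apply_symm_apply _).trans
          (congrArg _ ((LinearEquiv.ofBijective _ hφ).apply_symm_apply n).symm) }
  hom_inv_id := VeryShortModule.Hom.ext (LinearMap.ext fun m =>
    (LinearEquiv.ofBijective _ hφ).symm_apply_apply m)
  inv_hom_id := VeryShortModule.Hom.ext (LinearMap.ext fun m =>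
    (LinearEquiv.ofBijective _ hφ).apply_symm_apply m)

/-! ### Reconstruction of a very short module from `V[1/2]` -/

section Half

variable {hπ : IsCentralExtension π} {V : VeryShortModule hπ}

theorem hatH_hatF_act (m : V.carrier) : V.act (hatH hπ) (V.act (hatF hπ) m) =
    V.act (hatF hπ) (V.act (hatH hπ) m) - V.act (hatF hπ) m := by
  have h := act_bracket_even (V := V) (hatH_mem_gr hπ) (y := hatF hπ) m
  rw [hatH_hatF, map_neg, LinearMap.neg_apply] at h
  rw [sub_eq_add_neg, h]
  abel

theorem hatH_eq (m : V.carrier) : V.act (hatH hπ) m =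
    V.act (hatE hπ) (V.act (hatF hπ) m) - V.act (hatF hπ) (V.act (hatE hπ) m) :=
  act_bracket_even (V := V) (hatX_mem_gr hπ jone_mem) m

variable [CharZero K]

theorem hatF_act_half {m : V.carrier} (hm : m ∈ V.half) :
    V.act (hatH hπ) (V.act (hatF hπ) m) = (-(1 / 2) : K) • V.act (hatF hπ) m := by
  rw [hatH_hatF_act, mem_half.1 hm, map_smul]
  module

/-- On `V[1/2]` the term `f̂ ê` of `ĥ = [ê, f̂]` vanishes. Thus `2ê` is a left inverse of `f̂`
there. -/
theorem hatE_hatF_half {m : V.carrier} (hm : m ∈ V.half) :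
    V.act (hatE hπ) (V.act (hatF hπ) m) = (1 / 2 : K) • m := by
  have h := hatH_eq m
  rw [mem_half.1 hm, hatE, hatX_half _ hm, map_zero, sub_zero] at h
  exact h.symm

variable (V) in
/-- The inclusion of `Jor(V) = V[1/2]` in `V`. -/
noncomputable def jorIncl : V.jorObj.carrier →ₗ[K] V.carrier := V.half.subtype

theorem jorIncl_mem (v : V.jorObj.carrier) : V.jorIncl v ∈ V.half := v.2

theorem jorIncl_injective : Function.Injective V.jorIncl := Subtype.val_injective

theorem jorIncl_act (a : J) (v : V.jorObj.carrier) :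
    V.jorIncl (V.jorObj.act a v) = V.act (hatL hπ a) (V.jorIncl v) := rfl

variable (V) in
/-- The map `V[1/2] ⊕ V[1/2] → V`, `(v, w) ↦ f̂ v + w`. -/
noncomputable def halfSum : (V.jorObj.carrier × V.jorObj.carrier) →ₗ[K] V.carrier :=
  V.act (hatF hπ) ∘ₗ V.jorIncl ∘ₗ LinearMap.fst K _ _ + V.jorIncl ∘ₗ LinearMap.snd K _ _

theorem halfSum_apply (v : V.jorObj.carrier × V.jorObj.carrier) :
    V.halfSum v = V.act (hatF hπ) (V.jorIncl v.1) + V.jorIncl v.2 := rfl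

theorem halfSum_mem {i : ZMod 2} {v : V.jorObj.carrier × V.jorObj.carrier}
    (hv : v ∈ gr K (V := V.jorObj.carrier × V.jorObj.carrier) i) :
    V.halfSum v ∈ gr K (V := V.carrier) i := by
  obtain ⟨h1, h2⟩ := (mem_gr_prod K).1 hv
  have h := V.act_mem (m := V.jorIncl v.1) (hatF_mem_gr hπ) h1
  rw [zero_add] at h
  exact add_mem h h2

/-- The two summands land in different eigenspaces of `ĥ`, and `f̂` identifies `V[1/2]` with
`V[-1/2]`, with inverse `2ê`. -/
theorem halfSum_bijective : Function.Bijective V.halfSum := by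
  constructor
  · rw [← LinearMap.ker_eq_bot, LinearMap.ker_eq_bot']
    rintro ⟨v, w⟩ h
    rw [halfSum_apply] at h
    have h1 := congrArg (V.act (hatH hπ)) h
    rw [map_add, hatF_act_half (jorIncl_mem _), mem_half.1 (jorIncl_mem _), map_zero] at h1
    -- `ĥ` turns `f̂ v + w = 0` into `-½ f̂ v + ½ w = 0`; adding half of the former leaves `w = 0`.
    have hw : V.jorIncl w = 0 := by
      linear_combination (norm := module) h1 + (1 / 2 : K) • h
    have hv : V.jorIncl v = 0 := by
      rw [hw, add_zero] at h
      have h2 := hatE_hatF_half (jorIncl_mem v)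
      rw [h, map_zero] at h2
      exact (smul_eq_zero.1 h2.symm).resolve_left (one_div_ne_zero two_ne_zero)
    exact Prod.ext (jorIncl_injective (hv.trans (map_zero _).symm))
      (jorIncl_injective (hw.trans (map_zero _).symm))
  · intro m
    have hm : m ∈ Module.End.eigenspace (V.act (hatH hπ)) (1 / 2) ⊔
        Module.End.eigenspace (V.act (hatH hπ)) (-(1 / 2)) := by
      rw [V.veryShort]; trivial
    obtain ⟨w, hw, n, hn, rfl⟩ := Submodule.mem_sup.1 hm
    rw [Module.End.mem_eigenspace_iff] at hn
    have hEn : V.act (hatE hπ) n ∈ V.half := by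
      have h := act_bracket_even (V := V) (hatH_mem_gr hπ) (y := hatX hπ (jone K J)) n
      rw [hatH_hatX, hn, map_smul, eq_sub_iff_add_eq] at h
      rw [mem_half, hatE, ← h]
      module
    -- `f̂ n` would have eigenvalue `-3/2`.
    have hFn : V.act (hatF hπ) n = 0 := by
      refine eq_zero_of_eigen (c := -(3 / 2)) (V := V) ?_ (by norm_num)
      rw [hatH_hatF_act, hn, map_smul]
      module
    have h := hatH_eq n
    rw [hn, hFn, map_zero, zero_sub] at h
    -- With `f̂ n = 0`, the relation `ĥ = ê f̂ - f̂ ê` on `n` reads `-½ n = -f̂ ê n`, so `2ê n` is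
    -- the preimage of `n` under `f̂`.
    refine ⟨((⟨(2 : K) • V.act (hatE hπ) n, Submodule.smul_mem _ _ hEn⟩ : V.half),
      (⟨w, hw⟩ : V.half)), ?_⟩
    change V.act (hatF hπ) ((2 : K) • V.act (hatE hπ) n) + w = w + n
    rw [map_smul]
    linear_combination (norm := module) (2 : K) • h

/-- Together with the formula for `f̂`, this matches the action on `V` with the one on `Lie(Jor(V))`
for the generators of the extension. -/
theorem halfSum_hatX (a : J) (v : V.jorObj.carrier × V.jorObj.carrier) :
    V.act (hatX hπ a) (V.halfSum v) = V.halfSum (0, V.jorObj.act a v.1) := by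
  rw [halfSum_apply, halfSum_apply, map_add, hatX_half a (jorIncl_mem _), add_zero,
    ← act_hatL_eq a (jorIncl_mem _), jorIncl_act, map_zero, map_zero, zero_add]

theorem halfSum_hatF (v : V.jorObj.carrier × V.jorObj.carrier) :
    V.act (hatF hπ) (V.halfSum v) = V.halfSum (v.2, 0) := by
  rw [halfSum_apply, halfSum_apply, map_add, hatF_hatF_half (jorIncl_mem _), zero_add, map_zero,
    add_zero]

end Half

end VeryShortModule

open VeryShortModule

/-! ### The unit and the counit of the equivalence -/

section

variable [CharZero K] {hπ : IsCentralExtension π}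

/-- A form of the definition of the functor `Lie` in terms of the action of `f̂`. -/
theorem act_hatF_of_lower {M : SpecialModule K J} {V : VeryShortModule hπ}
    (ι : (M.carrier × M.carrier) ≃ₗ[K] V.carrier)
    (h : ∀ (b : J) (m₁ m₂ : M.carrier),
      V.act (-(1 / 2 : K) • sbr K (hatF hπ) (sbr K (hatF hπ) (hatX hπ b)))
        (ι (m₁, m₂)) = ι (M.act b m₂, 0)) (m₁ m₂ : M.carrier) :
    V.act (hatF hπ) (ι (m₁, m₂)) = ι (m₂, 0) := by
  -- At `b = e` the prescribed operator is `½ f̂`, and `e` acts on `m₂` by `½`; the two factors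
  -- cancel.
  have h1 := h (jone K J) m₁ m₂
  have e : ((1 / 2 : K) • m₂, (0 : M.carrier)) = (1 / 2 : K) • (m₂, (0 : M.carrier)) := by simp
  rw [hatF_hatF_hatE, M.act_one, e, map_smul ι, smul_neg, neg_smul, neg_neg, map_smul,
    LinearMap.smul_apply] at h1
  exact smul_right_injective _ (one_div_ne_zero (two_ne_zero' K)) h1

variable {M : SpecialModule K J} {V : VeryShortModule hπ}
  (ι : (M.carrier × M.carrier) ≃ₗ[K] V.carrier)

theorem act_hatH_of_raise (hX : ∀ (a : J) (m₁ m₂ : M.carrier),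
      V.act (hatX hπ a) (ι (m₁, m₂)) = ι (0, M.act a m₁))
    (hF : ∀ m₁ m₂ : M.carrier, V.act (hatF hπ) (ι (m₁, m₂)) = ι (m₂, 0)) (m₁ m₂ : M.carrier) :
    V.act (hatH hπ) (ι (m₁, m₂)) = ι (-((1 / 2 : K) • m₁), (1 / 2 : K) • m₂) := by
  rw [hatH_eq, hatE, hF, hX, hX, hF, M.act_one, M.act_one, ← map_sub]
  simp

theorem mem_half_of_raise (hX : ∀ (a : J) (m₁ m₂ : M.carrier),
      V.act (hatX hπ a) (ι (m₁, m₂)) = ι (0, M.act a m₁))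
    (hF : ∀ m₁ m₂ : M.carrier, V.act (hatF hπ) (ι (m₁, m₂)) = ι (m₂, 0)) (m : M.carrier) :
    ι (0, m) ∈ V.half := by
  rw [mem_half, act_hatH_of_raise ι hX hF, ← map_smul]
  simp

/-- The isomorphism of `M` with `Jor(Lie(M))`. -/
noncomputable def unitHom (heven : ∀ (i : ZMod 2) (m₁ m₂ : M.carrier),
      m₁ ∈ gr K (V := M.carrier) i → m₂ ∈ gr K (V := M.carrier) i →
      ι (m₁, m₂) ∈ gr K (V := V.carrier) i)
    (hX : ∀ (a : J) (m₁ m₂ : M.carrier),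
      V.act (hatX hπ a) (ι (m₁, m₂)) = ι (0, M.act a m₁))
    (hF : ∀ m₁ m₂ : M.carrier, V.act (hatF hπ) (ι (m₁, m₂)) = ι (m₂, 0)) :
    M ⟶ V.jorObj where
  toLin := (ι.toLinearMap ∘ₗ LinearMap.inr K M.carrier M.carrier).codRestrict V.half
    (mem_half_of_raise ι hX hF)
  even i m hm := heven i 0 m (zero_mem _) hm
  map_act a m := Subtype.ext (by
    -- On `V[1/2]` the element `[â, f̂]` acts as `â f̂`: here `f̂` moves `m` to the first copy, and
    -- `â` returns it as `a ∘ m` in the second.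
    change ι (0, M.act a m) = V.act (hatL hπ a) (ι (0, m))
    rw [act_hatL_eq a (mem_half_of_raise ι hX hF m), hF, hX])

/-- `ĥ` acts by `-½` on the first copy of `M` and by `½` on the second, so the eigenspace for `½` is
exactly the second copy. -/
theorem unitHom_bijective (heven : ∀ (i : ZMod 2) (m₁ m₂ : M.carrier),
      m₁ ∈ gr K (V := M.carrier) i → m₂ ∈ gr K (V := M.carrier) i →
      ι (m₁, m₂) ∈ gr K (V := V.carrier) i)
    (hX : ∀ (a : J) (m₁ m₂ : M.carrier),
      V.act (hatX hπ a) (ι (m₁, m₂)) = ι (0, M.act a m₁))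
    (hF : ∀ m₁ m₂ : M.carrier, V.act (hatF hπ) (ι (m₁, m₂)) = ι (m₂, 0)) :
    Function.Bijective (SpecialModule.Hom.toLin (unitHom ι heven hX hF)) := by
  constructor
  · intro m n h
    have h1 : ι (0, m) = ι (0, n) := congrArg Subtype.val h
    exact (Prod.ext_iff.1 (ι.injective h1)).2
  · rintro ⟨v, hv⟩
    obtain ⟨⟨m₁, m₂⟩, rfl⟩ := ι.surjective v
    rw [mem_half, act_hatH_of_raise ι hX hF, ← map_smul ι] at hv
    have h1 := (Prod.ext_iff.1 (ι.injective hv)).1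
    change -((1 / 2 : K) • m₁) = (1 / 2 : K) • m₁ at h1
    have h2 : m₁ = 0 := by linear_combination (norm := module) -h1
    exact ⟨m₂, Subtype.ext (congrArg (fun m => ι (m, m₂)) h2.symm)⟩

end

variable [CharZero K] (hπ : IsUniversalCentralExtension π)

/-- The isomorphism of `Lie(Jor(V))` with `V`. -/
noncomputable def counitHom {V W : VeryShortModule hπ.toIsCentralExtension}
    (ι : (V.jorObj.carrier × V.jorObj.carrier) ≃ₗ[K] W.carrier)
    (heven : ∀ (i : ZMod 2) (m₁ m₂ : V.jorObj.carrier),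
      m₁ ∈ gr K (V := V.jorObj.carrier) i → m₂ ∈ gr K (V := V.jorObj.carrier) i →
      ι (m₁, m₂) ∈ gr K (V := W.carrier) i)
    (hX : ∀ (a : J) (m₁ m₂ : V.jorObj.carrier),
      W.act (hatX hπ.toIsCentralExtension a) (ι (m₁, m₂)) = ι (0, V.jorObj.act a m₁))
    (hF : ∀ m₁ m₂ : V.jorObj.carrier,
      W.act (hatF hπ.toIsCentralExtension) (ι (m₁, m₂)) = ι (m₂, 0)) : W ⟶ V where
  toLin := V.halfSum ∘ₗ ι.symm.toLinearMap
  even i w hw := by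
    obtain ⟨v, rfl⟩ := ι.surjective w
    have hv : v ∈ gr K (V := V.jorObj.carrier × V.jorObj.carrier) i :=
      mem_gr_of_even_injective (f := ι.toLinearMap) ι.injective
        (fun i v hv => heven i v.1 v.2 ((mem_gr_prod K).1 hv).1 ((mem_gr_prod K).1 hv).2) hw
    rw [LinearMap.comp_apply, LinearEquiv.coe_coe, ι.symm_apply_apply]
    exact halfSum_mem hv
  -- It suffices to compare `f̂` and the `â`; their action is given by the same formulas through `ι`
  -- and through the map `(v, w) ↦ f̂ v + w`.
  map_act := hπ.commutes (V := W) (W := V) (V.halfSum ∘ₗ ι.symm.toLinearMap)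
    (fun a w => by
      obtain ⟨⟨m₁, m₂⟩, rfl⟩ := ι.surjective w
      rw [LinearMap.comp_apply, LinearMap.comp_apply, LinearEquiv.coe_coe, hX,
        ι.symm_apply_apply, ι.symm_apply_apply]
      exact (halfSum_hatX a (m₁, m₂)).symm)
    (fun w => by
      obtain ⟨⟨m₁, m₂⟩, rfl⟩ := ι.surjective w
      rw [LinearMap.comp_apply, LinearMap.comp_apply, LinearEquiv.coe_coe, hF,
        ι.symm_apply_apply, ι.symm_apply_apply]
      exact (halfSum_hatF (m₁, m₂)).symm)

/-- Any functor `Lie` is an equivalence with inverse `Jor`. -/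
theorem IsLieFunctor.exists_equivalence
    {F : SpecialModule K J ⥤ VeryShortModule hπ.toIsCentralExtension} (hF : IsLieFunctor F) :
    ∃ Φ : SpecialModule K J ≌ VeryShortModule hπ.toIsCentralExtension,
      Φ.functor = F ∧ Φ.inverse = VeryShortModule.Jor hπ.toIsCentralExtension := by
  obtain ⟨ι, heven, hX, hY, hmap⟩ := hF
  have hf := fun M => act_hatF_of_lower (ι M) (hY M)
  let η : 𝟭 (SpecialModule K J) ≅ F ⋙ VeryShortModule.Jor hπ.toIsCentralExtension :=
    NatIso.ofComponents (fun M => SpecialModule.isoOfBijective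
      (unitHom (ι M) (heven M) (hX M) (hf M)) (unitHom_bijective (ι M) (heven M) (hX M) (hf M)))
      (fun {M N} φ => SpecialModule.Hom.ext (LinearMap.ext fun m => Subtype.ext (by
        change ι N (0, SpecialModule.Hom.toLin φ m) =
          VeryShortModule.Hom.toLin (F.map φ) (ι M (0, m))
        rw [hmap, map_zero])))
  let ε : VeryShortModule.Jor hπ.toIsCentralExtension ⋙ F ≅
      𝟭 (VeryShortModule hπ.toIsCentralExtension) :=
    NatIso.ofComponents (fun V => VeryShortModule.isoOfBijective
      (counitHom hπ (V := V) (ι V.jorObj) (heven V.jorObj) (hX V.jorObj) (hf V.jorObj))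
      (halfSum_bijective.comp (ι V.jorObj).symm.bijective))
      (fun {V W} φ => VeryShortModule.Hom.ext (LinearMap.ext fun x => by
        obtain ⟨⟨v, w⟩, rfl⟩ := (ι V.jorObj).surjective x
        change W.halfSum ((ι W.jorObj).symm (VeryShortModule.Hom.toLin
          (F.map ((VeryShortModule.Jor hπ.toIsCentralExtension).map φ)) (ι V.jorObj (v, w)))) =
          VeryShortModule.Hom.toLin φ (V.halfSum ((ι V.jorObj).symm (ι V.jorObj (v, w))))
        have h := hmap V.jorObj W.jorObj ((VeryShortModule.Jor hπ.toIsCentralExtension).map φ) v w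
        refine (congrArg (fun t => W.halfSum ((ι W.jorObj).symm t)) h).trans ?_
        -- Naturality of the counit reduces to `φ (f̂ v + w) = f̂ (φ v) + φ w`.
        rw [LinearEquiv.symm_apply_apply, LinearEquiv.symm_apply_apply, halfSum_apply,
          halfSum_apply, map_add, VeryShortModule.Hom.map_act φ]
        rfl))
  -- No triangle identity has to be checked: `Equivalence.mk` corrects the unit and leaves the two
  -- functors unchanged.
  exact ⟨CategoryTheory.Equivalence.mk F (VeryShortModule.Jor hπ.toIsCentralExtension) η ε,
    rfl, rfl⟩

end Equivalence

end Super

/-- For a unital Jordan superalgebra `J`, the Lie superalgebra `Lie(J)` has a universal central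
extension, and over any such extension the functors `Lie` and `Jor` are mutually inverse
equivalences between special `J`-modules and modules with a very short grading. -/
theorem mainTheorem12 {K : Type v} [Field K] [CharZero K] {J : Type u} [AddCommGroup J]
    [Module K J] [SuperSpace K J] [UnitalJordanSuperalgebra K J] :
    (∃ (E : Type u) (_ : AddCommGroup E) (_ : Module K E) (_ : SuperSpace K E)
      (_ : LieSuperalgebra K E) (π : E →ₗ[K] TKK K J), IsUniversalCentralExtension π) ∧
    ∀ (E : Type u) [AddCommGroup E] [Module K E] [SuperSpace K E] [LieSuperalgebra K E]
      (π : E →ₗ[K] TKK K J) (hπ : IsUniversalCentralExtension π),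
      (∃ Lie : SpecialModule K J ⥤ VeryShortModule hπ.toIsCentralExtension, IsLieFunctor Lie) ∧
      ∀ Lie : SpecialModule K J ⥤ VeryShortModule hπ.toIsCentralExtension, IsLieFunctor Lie →
        ∃ Φ : SpecialModule K J ≌ VeryShortModule hπ.toIsCentralExtension,
          Φ.functor = Lie ∧ Φ.inverse = VeryShortModule.Jor hπ.toIsCentralExtension := by
  refine ⟨⟨UCE K (TKK K J), inferInstance, inferInstance, inferInstance, inferInstance,
    uceProj K (TKK K J), uceProj_universal (tkk_perfect K J)⟩, ?_⟩
  intro E _ _ _ _ π hπ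
  exact ⟨⟨lieFunctor hπ, isLieFunctor_lieFunctor hπ⟩, fun F hF => hF.exists_equivalence hπ⟩
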